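/- Let $\langle A,B\rangle=-\tfrac12(A_{11}B_{22}-A_{12}B_{21}-A_{21}B_{12}+A_{22}B_{11})$ on real $2\times2$ matrices; it restricts to a bi-invariant Lorentzian metric on $\mathrm{SL}_2\mathbb R$. On $\mathrm{SL}_2\mathbb R\times \mathrm{SL}_2\mathbb R$, whose tangent vectors at $(A,B)$ are $(A\alpha,B\beta)$ with $\alpha,\beta\in\mathfrak{sl}_2\mathbb R$, put $$J(A\alpha,B\beta)=\tfrac1{\sqrt3}\big(A(\alpha-2\beta),B(2\alpha-\beta)\big),\qquad P(A\alpha,B\beta)=(A\beta,B\alpha),\qquad g(Z,Z')=\tfrac14\big(\langle Z,Z'\rangle+\langle JZ,JZ'\rangle\big),$$ where in the last formula $\langle\,,\rangle$ is the product metric. Let $\nabla$ be the Levi-Civita connection of $g$ and $G(X,Y)=(\nabla_XJ)Y$. Let $\Sigma$ be a connected smooth surface and $F=(p,q):\Sigma\to \mathrm{SL}_2\mathbb R\times \mathrm{SL}_2\mathbb R$ a smooth immersion such that every tangent plane $dF(T_x\Sigma)$ is $J$-invariant, $g$ vanishes identically on it, and it is not $P$-invariant, for every $x\in\Sigma$ (so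 the distribution $T\Sigma+PT\Sigma$ has dimension four everywhere). Then: 1. Both $p$ and $q$ are immersions into $(\mathrm{SL}_2\mathbb R,\langle\,,\rangle)$ whose induced metric is Lorentzian and flat; they are isoparametric (the principal curvatures, i.e. the complex eigenvalues of the shape operator with multiplicity, are constant), and they have constant mean curvature. 2. Around every point of $\Sigma$ there is a smooth tangent vector field $X$ with $g(X,PX)=1$ and $g(X,JPX)=0$, and there is a constant $\phi\in\mathbb R$ such that every such local field satisfies $\nabla_XX=\cos\phi\,G(X,PX)+\sin\phi\,JG(X,PX)$. Put $\psi=\phi+\frac\pi3$ and $\xi=\phi-\frac\pi3$. 3. There are globally defined smooth spacelike unit normal fields $N_p$ of $p$ and $N_q$ of $q$, given for every such $X$ by $(N_p,0)=\frac12G(X,PX)-\frac{\sqrt3}2JG(X,PX)$ and $(0,N_q)=-\frac12G(X,PX)-\frac{\sqrt3}2JG(X,PX)$. For the shape operators $S$ defined by $\nabla^{\mathrm{SL}_2\mathbb R}_vN_p=-dp(Sv)$, respectively $\nabla^{\mathrm{SL}_2\mathbb R}_vN_q=-dq(Sv)$, the principal curvatures of $p$ and of $q$ are $$\tfrac1{\sqrt3}\Big(\mp\sqrt{-1-2\cos2\psi}+2\sin\psi\Big),\qquad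 \tfrac1{\sqrt3}\Big(\mp\sqrt{-1-2\cos2\xi}+2\sin\xi\Big)$$ respectively (complex conjugate if the radicand is negative), and the mean curvature vectors, i.e. half the metric traces of the second fundamental forms, are $H_p=\frac{2\sin\psi}{\sqrt3}N_p$ and $H_q=\frac{2\sin\xi}{\sqrt3}N_q$. -/

import Mathlib

open scoped Manifold ContDiff

attribute [local instance] Matrix.normedAddCommGroup Matrix.normedSpace

namespace NKSL

noncomputable section

/-! ### The ambient space: `SL(2,ℝ)` and the nearly Kähler `SL(2,ℝ) × SL(2,ℝ)` -/

/-- Real `2 × 2` matrices. -/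
abbrev Mat2 : Type := Matrix (Fin 2) (Fin 2) ℝ

/-- The Lie group `SL(2,ℝ)`. -/
abbrev SL2 : Type := Matrix.SpecialLinearGroup (Fin 2) ℝ

/-- The model space of surfaces. -/
abbrev Plane : Type := EuclideanSpace ℝ (Fin 2)

/-- The inner product of signature `(2,2)` on `2 × 2` matrices, for which `ip A A = - det A`.
Its restriction to the tangent spaces of `SL(2,ℝ)` is the bi-invariant Lorentzian metric. -/
def ip (A B : Mat2) : ℝ :=
  -(1 / 2) * (A 0 0 * B 1 1 - A 0 1 * B 1 0 - A 1 0 * B 0 1 + A 1 1 * B 0 0)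

/-! A tangent vector `(A α, B β)` at `(A, B)` is represented by the pair `(α, β)` of (traceless)
matrices, that is, by left translation to the identity.  The tensors `J`, `P` and `g` are
left-invariant, so they are given by the following maps on such pairs. -/

/-- The almost complex structure. -/
def J (z : Mat2 × Mat2) : Mat2 × Mat2 :=
  ((1 / √3) • (z.1 - (2 : ℝ) • z.2), (1 / √3) • ((2 : ℝ) • z.1 - z.2))

/-- The almost product structure. -/
def P (z : Mat2 × Mat2) : Mat2 × Mat2 := (z.2, z.1)

/-- The product metric. -/
def ipProd (z w : Mat2 × Mat2) : ℝ := ip z.1 w.1 + ip z.2 w.2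

/-- The nearly Kähler metric. -/
def g (z w : Mat2 × Mat2) : ℝ := (1 / 4) * (ipProd z w + ipProd (J z) (J w))

/-- The commutator of matrices. -/
def comm (a b : Mat2) : Mat2 := a * b - b * a

/-- The Levi-Civita connection of `g` on left-invariant vector fields: `∇_x y = Gamma x y`.  It is
characterized by `Gamma_torsion` and `Gamma_metric` below. -/
def Gamma (x y : Mat2 × Mat2) : Mat2 × Mat2 :=
  ((1 / 2 : ℝ) • comm x.1 y.1 + (1 / 6 : ℝ) • (comm x.2 y.1 - comm x.1 y.2),
    (1 / 2 : ℝ) • comm x.2 y.2 + (1 / 6 : ℝ) • (comm x.1 y.2 - comm x.2 y.1))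

/-- The connection is torsion-free. -/
theorem Gamma_torsion (x y : Mat2 × Mat2) :
    Gamma x y - Gamma y x = (comm x.1 y.1, comm x.2 y.2) := by
  obtain ⟨a, b⟩ := x
  obtain ⟨c, d⟩ := y
  simp only [Gamma, comm, Prod.mk_sub_mk, Prod.mk.injEq]
  constructor <;> module

/-- The connection is compatible with the metric `g`. -/
theorem Gamma_metric (x y z : Mat2 × Mat2) : g (Gamma x y) z + g y (Gamma x z) = 0 := by
  obtain ⟨a, b⟩ := x
  obtain ⟨c, d⟩ := y
  obtain ⟨e, f⟩ := z
  have h3 : (√3 : ℝ)⁻¹ ^ 2 = 1 / 3 := by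
    rw [inv_pow, Real.sq_sqrt (by norm_num)]; norm_num
  simp only [g, ipProd, ip, J, Gamma, comm, Matrix.smul_apply, Matrix.add_apply, Matrix.sub_apply,
    Matrix.mul_apply, Fin.sum_univ_two, smul_eq_mul, one_div]
  ring_nf
  simp only [h3]
  ring

/-- The tensor `G(X,Y) = (∇_X J) Y`. -/
def G (x y : Mat2 × Mat2) : Mat2 × Mat2 := Gamma x (J y) - J (Gamma x y)

/-! ### Maps of surfaces -/

section Maps

variable {M : Type*} [TopologicalSpace M] [ChartedSpace Plane M]
  [IsManifold 𝓘(ℝ, Plane) ∞ M]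

/-- The derivative of a vector-valued function `u` on `M` at `x` in the direction `v`. -/
def dirDeriv {V : Type*} [NormedAddCommGroup V] [NormedSpace ℝ V] (u : M → V) (x : M)
    (v : TangentSpace 𝓘(ℝ, Plane) x) : V :=
  mfderiv 𝓘(ℝ, Plane) 𝓘(ℝ, V) u x v

/-- Smoothness on `U` of a vector-valued function on `M`. -/
def SmoothOn {V : Type*} [NormedAddCommGroup V] [NormedSpace ℝ V] (u : M → V) (U : Set M) : Prop :=
  ContMDiffOn 𝓘(ℝ, Plane) 𝓘(ℝ, V) ∞ u U

/-- A map to `SL(2,ℝ)`, seen as a matrix-valued map. -/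
def toMat (f : M → SL2) : M → Mat2 := fun x => (f x : Mat2)

/-- The differential of `f : M → SL(2,ℝ)`, as a vector of `T_{f x} SL(2,ℝ) ⊆ Mat2`. -/
def diff (f : M → SL2) (x : M) (v : TangentSpace 𝓘(ℝ, Plane) x) : Mat2 :=
  dirDeriv (toMat f) x v

/-- Smoothness of a map into the embedded submanifold `SL(2,ℝ)` of the space of matrices. -/
def IsSmooth (f : M → SL2) : Prop := SmoothOn (toMat f) Set.univ

/-- First component. -/
def fstMap (F : M → SL2 × SL2) : M → SL2 := fun x => (F x).1

/-- Second component. -/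
def sndMap (F : M → SL2 × SL2) : M → SL2 := fun x => (F x).2

/-- The differential of `F = (p, q)`, left-translated: if `dF(v) = (p α, q β)`, this is `(α, β)`. -/
def omega (F : M → SL2 × SL2) (x : M) (v : TangentSpace 𝓘(ℝ, Plane) x) : Mat2 × Mat2 :=
  (((fstMap F x)⁻¹ : SL2) * diff (fstMap F) x v, ((sndMap F x)⁻¹ : SL2) * diff (sndMap F) x v)

/-- `F` is a smooth immersion whose image is a degenerate almost complex surface: its tangent
planes are `J`-invariant and `g` vanishes identically on them. -/
structure IsDegenerateAlmostComplex (F : M → SL2 × SL2) : Prop where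
  smooth_fst : IsSmooth (fstMap F)
  smooth_snd : IsSmooth (sndMap F)
  immersion : ∀ x, Function.Injective (omega F x)
  almostComplex : ∀ x v, ∃ w, J (omega F x v) = omega F x w
  degenerate : ∀ x v w, g (omega F x v) (omega F x w) = 0

/-- The tangent plane of `F` at `x` is invariant under `P`. -/
def PPreservesTangentAt (F : M → SL2 × SL2) (x : M) : Prop :=
  ∀ v, ∃ w, P (omega F x v) = omega F x w

/-- The vector field `dF(X)` along `F`, left-translated. -/
def along (F : M → SL2 × SL2) (X : ∀ x : M, TangentSpace 𝓘(ℝ, Plane) x) : M → Mat2 × Mat2 :=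
  fun x => omega F x (X x)

/-- The Levi-Civita connection `∇_v Z` of `g` on (left-translated) vector fields `Z` along `F`. -/
def nablaNK (F : M → SL2 × SL2) (Z : M → Mat2 × Mat2) (x : M)
    (v : TangentSpace 𝓘(ℝ, Plane) x) : Mat2 × Mat2 :=
  dirDeriv Z x v + Gamma (omega F x v) (Z x)

/-- `X` is a smooth tangent vector field on `U` with `g(X, PX) = 1` and `g(X, JPX) = 0`. -/
def IsAdaptedField (F : M → SL2 × SL2) (U : Set M)
    (X : ∀ x : M, TangentSpace 𝓘(ℝ, Plane) x) : Prop :=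
  ContMDiffOn 𝓘(ℝ, Plane) 𝓘(ℝ, Plane).tangent ∞
      (fun x => (⟨x, X x⟩ : TangentBundle 𝓘(ℝ, Plane) M)) U ∧
    ∀ x ∈ U, g (along F X x) (P (along F X x)) = 1 ∧
      g (along F X x) (J (P (along F X x))) = 0

/-- The vector field `G(X, PX)` along `F`. -/
def GXPX (F : M → SL2 × SL2) (X : ∀ x : M, TangentSpace 𝓘(ℝ, Plane) x) (x : M) : Mat2 × Mat2 :=
  G (along F X x) (P (along F X x))

/-- `φ` is the (constant) angle of `F`: adapted vector fields exist around every point, and all of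
them satisfy `∇_X X = cos φ G(X, PX) + sin φ J G(X, PX)`. -/
def IsAngle (F : M → SL2 × SL2) (φ : ℝ) : Prop :=
  (∀ x, ∃ U : Set M, IsOpen U ∧ x ∈ U ∧ ∃ X, IsAdaptedField F U X) ∧
    ∀ U : Set M, IsOpen U → ∀ X, IsAdaptedField F U X → ∀ x ∈ U,
      nablaNK F (along F X) x (X x) =
        Real.cos φ • GXPX F X x + Real.sin φ • J (GXPX F X x)

/-! ### Lorentzian surfaces in `SL(2,ℝ)` -/

/-- `f` is a smooth immersion. -/
def IsImmersedSurface (f : M → SL2) : Prop :=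
  IsSmooth f ∧ ∀ x, Function.Injective (diff f x)

/-- The metric induced by `f` on the (two-dimensional) tangent spaces has signature `(1,1)`. -/
def IsLorentzian (f : M → SL2) : Prop :=
  ∀ x, ∃ v w, ip (diff f x v) (diff f x v) = 1 ∧ ip (diff f x w) (diff f x w) = -1 ∧
    ip (diff f x v) (diff f x w) = 0

/-- The Levi-Civita connection of `SL(2,ℝ)` on vector fields `V` along `f`: the tangential part of
the flat connection of the space of matrices. -/
def nablaSL (f : M → SL2) (V : M → Mat2) (x : M) (v : TangentSpace 𝓘(ℝ, Plane) x) : Mat2 :=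
  dirDeriv V x v - ip (diff f x v) (V x) • (f x : Mat2)

/-- `N` is a smooth spacelike unit normal vector field, tangent to `SL(2,ℝ)`, of `f` on `U`. -/
def IsUnitNormalOn (f : M → SL2) (U : Set M) (N : M → Mat2) : Prop :=
  SmoothOn N U ∧
    ∀ x ∈ U, ip (N x) (f x) = 0 ∧ ip (N x) (N x) = 1 ∧ ∀ v, ip (diff f x v) (N x) = 0

/-- `S` is the shape operator of `f` at `x` for the unit normal `N` (formula of Weingarten).
The tangent spaces of `M` are copies of the model space `Plane`. -/
def IsShapeOperator (f : M → SL2) (N : M → Mat2) (x : M) (S : Plane →ₗ[ℝ] Plane) : Prop :=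
  ∀ v : Plane, nablaSL f N x v = -diff f x (S v)

/-- The complex eigenvalues, with multiplicity, of a shape operator. -/
def principalCurvatures (S : Plane →ₗ[ℝ] Plane) : Multiset ℂ :=
  (S.charpoly.map (algebraMap ℝ ℂ)).roots

/-- Isoparametric surfaces: constant principal curvatures. -/
def IsIsoparametric (f : M → SL2) : Prop :=
  ∀ U : Set M, IsOpen U → IsPreconnected U → ∀ N, IsUnitNormalOn f U N →
    ∃ m : Multiset ℂ, ∀ x ∈ U, ∃ S, IsShapeOperator f N x S ∧ principalCurvatures S = m

/-! The intrinsic geometry and the second fundamental form in charts. -/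

/-- Partial derivative of a function on the plane. -/
def pd {V : Type*} [NormedAddCommGroup V] [NormedSpace ℝ V] (i : Fin 2) (u : Plane → V)
    (y : Plane) : V :=
  fderiv ℝ u y (EuclideanSpace.single i 1)

/-- The Christoffel symbols `Γ^k_{ij}` of a metric `γ`. -/
def christoffel (γ : Plane → Matrix (Fin 2) (Fin 2) ℝ) (k i j : Fin 2) (y : Plane) : ℝ :=
  (1 / 2) * ∑ l, (γ y)⁻¹ k l *
    (pd i (fun t => γ t j l) y + pd j (fun t => γ t i l) y - pd l (fun t => γ t i j) y)

/-- The components of the Riemann curvature tensor, `R(∂_i, ∂_j) ∂_k = ∑ l, R^l_{kij} ∂_l`. -/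
def riemann (γ : Plane → Matrix (Fin 2) (Fin 2) ℝ) (l k i j : Fin 2) (y : Plane) : ℝ :=
  pd i (christoffel γ l j k) y - pd j (christoffel γ l i k) y +
    ∑ m, (christoffel γ l i m y * christoffel γ m j k y -
      christoffel γ l j m y * christoffel γ m i k y)

/-- The expression of `f` in the chart `e`. -/
def localRep (f : M → SL2) (e : OpenPartialHomeomorph M Plane) : Plane → Mat2 :=
  fun y => (f (e.symm y) : Mat2)

/-- The induced metric in the chart `e`. -/
def gram (f : M → SL2) (e : OpenPartialHomeomorph M Plane) (y : Plane) :
    Matrix (Fin 2) (Fin 2) ℝ :=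
  Matrix.of fun i j => ip (pd i (localRep f e) y) (pd j (localRep f e) y)

/-- The induced metric is flat: its curvature tensor vanishes in every smooth chart. -/
def IsFlat (f : M → SL2) : Prop :=
  ∀ e ∈ IsManifold.maximalAtlas 𝓘(ℝ, Plane) ∞ M, ∀ y ∈ e.target, ∀ l k i j,
    riemann (gram f e) l k i j y = 0

/-- The second fundamental form `h(∂_i, ∂_j)` in the chart `e`, by the formula of Gauss: the
difference of the connection of `SL(2,ℝ)` and the Levi-Civita connection of the induced metric. -/
def secondFundForm (f : M → SL2) (e : OpenPartialHomeomorph M Plane) (i j : Fin 2) (y : Plane) :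
    Mat2 :=
  pd i (pd j (localRep f e)) y - gram f e y i j • localRep f e y -
    ∑ k, christoffel (gram f e) k i j y • pd k (localRep f e) y

/-- The mean curvature vector field `H`: half the metric trace of the second fundamental form. -/
def meanCurvatureVector (f : M → SL2) (x : M) : Mat2 :=
  (1 / 2 : ℝ) • ∑ i, ∑ j, (gram f (chartAt Plane x) (chartAt Plane x x))⁻¹ i j •
    secondFundForm f (chartAt Plane x) i j (chartAt Plane x x)

/-- Constant mean curvature: `H = c N` with `c` constant, for every local unit normal `N`. -/
def HasConstantMeanCurvature (f : M → SL2) : Prop :=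
  ∀ U : Set M, IsOpen U → IsPreconnected U → ∀ N, IsUnitNormalOn f U N →
    ∃ c : ℝ, ∀ x ∈ U, meanCurvatureVector f x = c • N x

/-- The two numbers `(∓ √(-1 - 2 cos 2θ) + 2 sin θ) / √3`; the square root may be imaginary. -/
def curvaturePair (θ : ℝ) : Multiset ℂ :=
  {(-Complex.sqrt ((-1 - 2 * Real.cos (2 * θ) : ℝ) : ℂ) + ((2 * Real.sin θ : ℝ) : ℂ)) /
      ((√3 : ℝ) : ℂ),
    (Complex.sqrt ((-1 - 2 * Real.cos (2 * θ) : ℝ) : ℂ) + ((2 * Real.sin θ : ℝ) : ℂ)) /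
      ((√3 : ℝ) : ℂ)}

/-- With respect to the unit normal field `N` on all of `M`, the principal curvatures of `f` are
`curvaturePair θ` and its mean curvature vector is `(2 sin θ / √3) N`. -/
def HasCurvatures (f : M → SL2) (N : M → Mat2) (θ : ℝ) : Prop :=
  IsUnitNormalOn f Set.univ N ∧
    ∀ x, (∃ S, IsShapeOperator f N x S ∧ principalCurvatures S = curvaturePair θ) ∧
      meanCurvatureVector f x = (2 * Real.sin θ / √3) • N x

end Maps

end

end NKSL

open NKSL

namespace NKSL

open Filter Topology

set_option linter.unusedSectionVars false

/-! ### Algebra of the inner product on `2 × 2` matrices -/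

/-! Left translation turns dF into a pair (a, b) of sl₂-valued one-forms, each satisfying the
Maurer–Cartan equation. Put K(a, b) = (-b, a - b). Then J = (1 + 2K)/√3 and K² + K + 1 = 0, so K
acts as a primitive cube root of unity and a J-invariant plane consists of the multiples (s + tK)z
of one vector z; `framePair` is this multiplication. P conjugates K into K². Nullity of the plane
means ⟨a, b⟩ = ⟨a, a⟩ + ⟨b, b⟩ on it. The two norms left over form one complex number that scales by
σ² when z is multiplied by σ, and it is zero only if the plane is P-invariant (`degenerate_plane`).
A smooth square root (`exists_smooth_scaling`) therefore gives a local frame z = (α, β) with ⟨α, α⟩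
= ⟨β, β⟩ = 1/2 and ⟨α, β⟩ = 1, unique up to sign. These are exactly the adapted fields. Let s, t be
the dual coframe and κ = [α, β], which spans the normal direction. The components of the
Maurer–Cartan equations along α and β give ds = dt = 0 and make dα, dβ multiples of κ; the
components along κ leave two unknown functions: dα = (m s - (1 + n) t)κ and dβ = (n s + (m - n - 1)
t)κ (`first_order`, `second_order`). Now d²α = d²β = 0 says two things. First, m² - mn + n² - m + n
= 0, which is a circle for the norm |m + nK|² = m² - mn + n². Second, d(m + nK) ∧ (s + tK) = 0, so m
+ nK is holomorphic. A holomorphic function with values in a circle is locally constant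
(`angle_rigid`). Since m and n do not see the sign of the frame, they are constants of the connected
surface, and φ is the angle on that circle. All the geometry of p then has constant coefficients.
Its metric is (s² + t²)/2 - 2st in a closed coframe, hence Lorentzian and flat. Its normal is
-pκ/√3, which is also insensitive to the sign of the frame. Its shape operator has a constant
matrix, of determinant 1 by the circle relation and trace 4 sin ψ/√3. The claims on q follow by
exchanging the factors, which replaces (m, n) by (-n, -m). -/

theorem ip_comm (A B : Mat2) : ip A B = ip B A := by
  simp only [ip]; ring

theorem ip_add_left (A B C : Mat2) : ip (A + B) C = ip A C + ip B C := by
  simp only [ip, Matrix.add_apply]; ring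

theorem ip_sub_left (A B C : Mat2) : ip (A - B) C = ip A C - ip B C := by
  simp only [ip, Matrix.sub_apply]; ring

theorem ip_smul_left (r : ℝ) (A B : Mat2) : ip (r • A) B = r * ip A B := by
  simp only [ip, Matrix.smul_apply, smul_eq_mul]; ring

theorem ip_zero_left (B : Mat2) : ip 0 B = 0 := by
  simp [ip]

theorem ip_add_right (A B C : Mat2) : ip C (A + B) = ip C A + ip C B := by
  simp only [ip, Matrix.add_apply]; ring

theorem ip_sub_right (A B C : Mat2) : ip C (A - B) = ip C A - ip C B := by
  simp only [ip, Matrix.sub_apply]; ring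

theorem ip_smul_right (r : ℝ) (A B : Mat2) : ip A (r • B) = r * ip A B := by
  simp only [ip, Matrix.smul_apply, smul_eq_mul]; ring

theorem ip_neg_right (A B : Mat2) : ip A (-B) = -ip A B := by
  simp only [ip, Matrix.neg_apply]; ring

theorem ip_zero_right (B : Mat2) : ip B 0 = 0 := by
  simp [ip]

theorem ip_mul_left (A B C : Mat2) : ip (A * B) (A * C) = A.det * ip B C := by
  simp only [ip, Matrix.mul_apply, Fin.sum_univ_two, Matrix.det_fin_two]; ring

theorem ip_self (A : Mat2) : ip A A = -A.det := by
  simp only [ip, Matrix.det_fin_two]; ring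

theorem SL2_ip_mul (p : SL2) (B C : Mat2) : ip ((p : Mat2) * B) ((p : Mat2) * C) = ip B C := by
  rw [ip_mul_left, p.det_coe, one_mul]

theorem SL2_ip_mul_self (p : SL2) (B : Mat2) : ip ((p : Mat2) * B) (p : Mat2) = ip B 1 := by
  simpa using SL2_ip_mul p B 1

theorem SL2_inv_mul (p : SL2) (A : Mat2) : ((p⁻¹ : SL2) : Mat2) * ((p : Mat2) * A) = A := by
  rw [← Matrix.mul_assoc, ← Matrix.SpecialLinearGroup.coe_mul]; simp

theorem SL2_mul_inv (p : SL2) (A : Mat2) : (p : Mat2) * (((p⁻¹ : SL2) : Mat2) * A) = A := by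
  rw [← Matrix.mul_assoc, ← Matrix.SpecialLinearGroup.coe_mul]; simp

theorem trace_zero {A : Mat2} (h : ip A 1 = 0) : A 1 1 = -A 0 0 := by
  simp [ip] at h; linarith

/-- For traceless matrices the anticommutator is twice the inner product. -/
theorem mul_add_mul_swap {A B : Mat2} (hA : ip A 1 = 0) (hB : ip B 1 = 0) :
    A * B + B * A = (2 * ip A B) • (1 : Mat2) := by
  have h1 := trace_zero hA
  have h2 := trace_zero hB
  ext i j
  fin_cases i <;> fin_cases j <;>
    simp [ip, Matrix.mul_apply, Fin.sum_univ_two, h1, h2] <;> ring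

/-- Splits a product into a part tangent to SL(2) at the identity and a radial part. Applied to
derivatives of p, the radial part is what the Levi-Civita connection of SL(2) removes. -/
theorem mul_eq_half_comm {A B : Mat2} (hA : ip A 1 = 0) (hB : ip B 1 = 0) :
    A * B = (1 / 2 : ℝ) • comm A B + ip A B • (1 : Mat2) := by
  have h := mul_add_mul_swap hA hB
  have : B * A = (2 * ip A B) • (1 : Mat2) - A * B := by rw [← h]; abel
  rw [comm, this]; module

theorem comm_self (A : Mat2) : comm A A = 0 := by simp [comm]

theorem comm_swap (A B : Mat2) : comm A B = -comm B A := by simp [comm]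

theorem comm_add_left (A B C : Mat2) : comm (A + B) C = comm A C + comm B C := by
  simp only [comm, add_mul, mul_add]; abel

theorem comm_sub_left (A B C : Mat2) : comm (A - B) C = comm A C - comm B C := by
  simp only [comm, sub_mul, mul_sub]; abel

theorem comm_smul_left (r : ℝ) (A B : Mat2) : comm (r • A) B = r • comm A B := by
  simp only [comm, smul_mul_assoc, mul_smul_comm, smul_sub]

theorem comm_neg_left (A B : Mat2) : comm (-A) B = -comm A B := by
  simp only [comm, neg_mul, mul_neg]; abel

theorem comm_add_right (A B C : Mat2) : comm C (A + B) = comm C A + comm C B := by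
  simp only [comm, add_mul, mul_add]; abel

theorem comm_sub_right (A B C : Mat2) : comm C (A - B) = comm C A - comm C B := by
  simp only [comm, sub_mul, mul_sub]; abel

theorem comm_smul_right (r : ℝ) (A B : Mat2) : comm A (r • B) = r • comm A B := by
  simp only [comm, smul_mul_assoc, mul_smul_comm, smul_sub]

theorem ip_comm_one (A B : Mat2) : ip (comm A B) 1 = 0 := by
  simp [ip, comm, Matrix.mul_apply, Fin.sum_univ_two]; ring

theorem ip_comm_left {A B : Mat2} : ip (comm A B) A = 0 := by
  simp only [ip, comm, Matrix.mul_apply, Matrix.sub_apply, Fin.sum_univ_two]; ring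

theorem ip_comm_right {A B : Mat2} : ip (comm A B) B = 0 := by
  simp only [ip, comm, Matrix.mul_apply, Matrix.sub_apply, Fin.sum_univ_two]; ring

/-- A pair of traceless matrices with Gram matrix `[[1/2, 1], [1, 1/2]]`. -/
structure IsGramPair (α β : Mat2) : Prop where
  tr₁ : ip α 1 = 0
  tr₂ : ip β 1 = 0
  aa : ip α α = 1 / 2
  bb : ip β β = 1 / 2
  ab : ip α β = 1

namespace IsGramPair

variable {α β : Mat2}

theorem ba (h : IsGramPair α β) : ip β α = 1 := by rw [ip_comm, h.ab]

theorem swap (h : IsGramPair α β) : IsGramPair β α := ⟨h.tr₂, h.tr₁, h.bb, h.aa, h.ba⟩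

theorem comm_norm (h : IsGramPair α β) : ip (comm α β) (comm α β) = 3 := by
  have h1 := trace_zero h.tr₁
  have h2 := trace_zero h.tr₂
  -- Lagrange's identity: the commutator is a multiple of the Lorentzian cross product on traceless
  -- matrices.
  have e : ip (comm α β) (comm α β) = 4 * (ip α β * ip α β - ip α α * ip β β) := by
    simp only [ip, comm, Matrix.mul_apply, Matrix.sub_apply, Fin.sum_univ_two, h1, h2]; ring
  rw [e, h.aa, h.bb, h.ab]; norm_num

theorem comm_comm_right (h : IsGramPair α β) :
    comm (comm α β) β = (2 : ℝ) • α - (4 : ℝ) • β := by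
  have e : comm (comm α β) β = (4 * ip β β) • α - (4 * ip α β) • β := by
    have h1 := trace_zero h.tr₁
    have h2 := trace_zero h.tr₂
    ext i j
    fin_cases i <;> fin_cases j <;>
      simp [ip, comm, Matrix.mul_apply, Fin.sum_univ_two, h1, h2] <;> ring
  rw [e, h.bb, h.ab]; norm_num

theorem comm_comm_left (h : IsGramPair α β) :
    comm α (comm α β) = (2 : ℝ) • β - (4 : ℝ) • α := by
  have := h.swap.comm_comm_right
  rw [comm_swap β α, comm_neg_left] at this
  rw [comm_swap, this]

/-- Expansion of a traceless matrix in the basis `α, β, [α, β]`. -/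
theorem expansion (h : IsGramPair α β) {x : Mat2} (hx : ip x 1 = 0) :
    x = ((4 / 3) * ip x β - (2 / 3) * ip x α) • α - ((2 / 3) * ip x β - (4 / 3) * ip x α) • β +
      (ip x (comm α β) / 3) • comm α β := by
  have h1 := trace_zero h.tr₁
  have h2 := trace_zero h.tr₂
  have h3 := trace_zero hx
  -- Cramer's rule for the basis α, β, [α, β]; the factor on the left is the norm of [α, β].
  have e : (4 * (ip α β * ip α β - ip α α * ip β β)) • x =
      (4 * (ip α β * ip x β - ip β β * ip x α)) • α +
      (4 * (ip α β * ip x α - ip α α * ip x β)) • β + ip x (comm α β) • comm α β := by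
    ext i j
    fin_cases i <;> fin_cases j <;>
      simp [ip, comm, Matrix.mul_apply, Fin.sum_univ_two, h1, h2, h3] <;> ring
  rw [h.aa, h.bb, h.ab] at e
  have e' : x = (1 / 3 : ℝ) • ((4 * (1 * 1 - 1 / 2 * (1 / 2)) : ℝ) • x) := by
    rw [smul_smul]; norm_num
  refine e'.trans ?_
  rw [e]; module

theorem eq_smul_comm (h : IsGramPair α β) {x : Mat2} (hx : ip x 1 = 0) (h1 : ip x α = 0)
    (h2 : ip x β = 0) : x = (ip x (comm α β) / 3) • comm α β := by
  have := h.expansion hx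
  rw [h1, h2] at this
  simpa using this

theorem comm_ne_zero (h : IsGramPair α β) : comm α β ≠ 0 := by
  intro h0
  have := h.comm_norm
  rw [h0, ip_zero_left] at this
  norm_num at this

theorem coeff_eq (h : IsGramPair α β) {s t s' t' : ℝ} (e : s • α + t • β = s' • α + t' • β) :
    s = s' ∧ t = t' := by
  have h1 := congrArg (ip · α) e
  have h2 := congrArg (ip · β) e
  simp only [ip_add_left, ip_smul_left, h.aa, h.ba, h.ab, h.bb] at h1 h2
  constructor <;> linarith

end IsGramPair

/-! ### Partial derivatives on the plane -/

section Pd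

variable {V W Z : Type*} [NormedAddCommGroup V] [NormedSpace ℝ V] [NormedAddCommGroup W]
  [NormedSpace ℝ W] [NormedAddCommGroup Z] [NormedSpace ℝ Z] {O : Set Plane} {y : Plane}

theorem diffAt {u : Plane → V} (hu : ContDiffOn ℝ ∞ u O) (hO : IsOpen O) (hy : y ∈ O) :
    DifferentiableAt ℝ u y :=
  (hu.contDiffAt (hO.mem_nhds hy)).differentiableAt (by simp)

theorem contDiffOn_pd {u : Plane → V} (hO : IsOpen O) (hu : ContDiffOn ℝ ∞ u O) (i : Fin 2) :
    ContDiffOn ℝ ∞ (pd i u) O :=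
  (hu.fderiv_of_isOpen hO (m := ∞) (by simp)).clm_apply contDiffOn_const

theorem pd_congr {u v : Plane → V} (hO : IsOpen O) (h : ∀ z ∈ O, u z = v z) (hy : y ∈ O)
    (i : Fin 2) : pd i u y = pd i v y := by
  have : u =ᶠ[𝓝 y] v := by filter_upwards [hO.mem_nhds hy] with z hz using h z hz
  rw [pd, pd, this.fderiv_eq]

theorem pd_const (c : V) (i : Fin 2) : pd i (fun _ => c) y = 0 := by simp [pd]

theorem pd_eq_zero {u : Plane → V} {c : V} (hO : IsOpen O) (h : ∀ z ∈ O, u z = c) (hy : y ∈ O)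
    (i : Fin 2) : pd i u y = 0 := by
  rw [pd_congr hO h hy, pd_const]

theorem pd_add {u v : Plane → V} (hu : DifferentiableAt ℝ u y) (hv : DifferentiableAt ℝ v y)
    (i : Fin 2) : pd i (fun z => u z + v z) y = pd i u y + pd i v y := by
  simp only [pd]; rw [fderiv_fun_add hu hv]; rfl

theorem pd_sub {u v : Plane → V} (hu : DifferentiableAt ℝ u y) (hv : DifferentiableAt ℝ v y)
    (i : Fin 2) : pd i (fun z => u z - v z) y = pd i u y - pd i v y := by
  simp only [pd]; rw [fderiv_fun_sub hu hv]; rfl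

theorem pd_const_mul {u : Plane → ℝ} (hu : DifferentiableAt ℝ u y) (c : ℝ) (i : Fin 2) :
    pd i (fun z => c * u z) y = c * pd i u y := by
  simp only [pd]; rw [fderiv_const_mul hu]; rfl

theorem pd_smul {c : Plane → ℝ} {u : Plane → V} (hc : DifferentiableAt ℝ c y)
    (hu : DifferentiableAt ℝ u y) (i : Fin 2) :
    pd i (fun z => c z • u z) y = c y • pd i u y + pd i c y • u y := by
  simp only [pd]; rw [fderiv_fun_smul hc hu]; simp

theorem pd_mul {c d : Plane → ℝ} (hc : DifferentiableAt ℝ c y) (hd : DifferentiableAt ℝ d y)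
    (i : Fin 2) : pd i (fun z => c z * d z) y = c y * pd i d y + pd i c y * d y :=
  pd_smul hc hd i

theorem pd_bilin (B : V →L[ℝ] W →L[ℝ] Z) {u : Plane → V} {v : Plane → W}
    (hu : DifferentiableAt ℝ u y) (hv : DifferentiableAt ℝ v y) (i : Fin 2) :
    pd i (fun z => B (u z) (v z)) y = B (u y) (pd i v y) + B (pd i u y) (v y) := by
  simp only [pd]; rw [B.fderiv_of_bilinear hu hv]; simp

/-- Matrix multiplication as a continuous bilinear map. -/
noncomputable def mulCLM : Mat2 →L[ℝ] Mat2 →L[ℝ] Mat2 :=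
  (LinearMap.mul ℝ Mat2).toContinuousBilinearMap

/-- The inner product as a continuous bilinear map. -/
noncomputable def ipCLM : Mat2 →L[ℝ] Mat2 →L[ℝ] ℝ :=
  (LinearMap.mk₂ ℝ ip ip_add_left (fun r A B => ip_smul_left r A B)
    (fun A B C => ip_add_right B C A) (fun r A B => ip_smul_right r A B)).toContinuousBilinearMap

theorem pd_matMul {u v : Plane → Mat2} (hu : DifferentiableAt ℝ u y)
    (hv : DifferentiableAt ℝ v y) (i : Fin 2) :
    pd i (fun z => u z * v z) y = u y * pd i v y + pd i u y * v y :=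
  pd_bilin mulCLM hu hv i

theorem pd_ip {u v : Plane → Mat2} (hu : DifferentiableAt ℝ u y)
    (hv : DifferentiableAt ℝ v y) (i : Fin 2) :
    pd i (fun z => ip (u z) (v z)) y = ip (u y) (pd i v y) + ip (pd i u y) (v y) :=
  pd_bilin ipCLM hu hv i

theorem differentiableAt_matMul {u v : Plane → Mat2} (hu : DifferentiableAt ℝ u y)
    (hv : DifferentiableAt ℝ v y) : DifferentiableAt ℝ (fun z => u z * v z) y :=
  (mulCLM.hasFDerivAt_of_bilinear hu.hasFDerivAt hv.hasFDerivAt).differentiableAt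

theorem pd_matComm {u v : Plane → Mat2} (hu : DifferentiableAt ℝ u y)
    (hv : DifferentiableAt ℝ v y) (i : Fin 2) :
    pd i (fun z => comm (u z) (v z)) y = comm (u y) (pd i v y) + comm (pd i u y) (v y) := by
  simp only [comm]
  rw [pd_sub (differentiableAt_matMul hu hv) (differentiableAt_matMul hv hu),
    pd_matMul hu hv, pd_matMul hv hu]
  abel

theorem contDiffOn_matMul {E : Type*} [NormedAddCommGroup E] [NormedSpace ℝ E] {O : Set E}
    {u v : E → Mat2} (hu : ContDiffOn ℝ ∞ u O) (hv : ContDiffOn ℝ ∞ v O) :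
    ContDiffOn ℝ ∞ (fun z => u z * v z) O :=
  mulCLM.isBoundedBilinearMap.contDiff.comp_contDiffOn (hu.prodMk hv)

theorem contDiffOn_ip {E : Type*} [NormedAddCommGroup E] [NormedSpace ℝ E] {O : Set E}
    {u v : E → Mat2} (hu : ContDiffOn ℝ ∞ u O) (hv : ContDiffOn ℝ ∞ v O) :
    ContDiffOn ℝ ∞ (fun z => ip (u z) (v z)) O :=
  ipCLM.isBoundedBilinearMap.contDiff.comp_contDiffOn (hu.prodMk hv)

theorem contDiffOn_comm {E : Type*} [NormedAddCommGroup E] [NormedSpace ℝ E] {O : Set E}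
    {u v : E → Mat2} (hu : ContDiffOn ℝ ∞ u O) (hv : ContDiffOn ℝ ∞ v O) :
    ContDiffOn ℝ ∞ (fun z => comm (u z) (v z)) O :=
  (contDiffOn_matMul hu hv).sub (contDiffOn_matMul hv hu)

/-- The adjugate as a continuous linear map. -/
noncomputable def adjCLM : Mat2 →L[ℝ] Mat2 :=
  LinearMap.toContinuousLinearMap
    { toFun := fun A => !![A 1 1, -A 0 1; -A 1 0, A 0 0]
      map_add' := fun A B => by
        ext i j; fin_cases i <;> fin_cases j <;> simp <;> ring
      map_smul' := fun r A => by
        ext i j; fin_cases i <;> fin_cases j <;> simp }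

/-- On SL(2) the inverse is linear in the entries, so left translation inherits smoothness from p.
-/
theorem adjCLM_coe (p : SL2) : adjCLM (p : Mat2) = ((p⁻¹ : SL2) : Mat2) := by
  rw [Matrix.SpecialLinearGroup.coe_inv, Matrix.adjugate_fin_two]; rfl

theorem pd_pd_comm {u : Plane → V} (hO : IsOpen O) (hu : ContDiffOn ℝ ∞ u O) (hy : y ∈ O)
    (i j : Fin 2) : pd i (pd j u) y = pd j (pd i u) y := by
  have hc := hu.contDiffAt (hO.mem_nhds hy)
  have hs : IsSymmSndFDerivAt ℝ u y := hc.isSymmSndFDerivAt (by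
    simpa using WithTop.coe_le_coe.2 (le_top : (2 : ℕ∞) ≤ ⊤))
  have hd : DifferentiableAt ℝ (fderiv ℝ u) y :=
    diffAt (hu.fderiv_of_isOpen hO (m := ∞) (by simp)) hO hy
  have key : ∀ k l : Fin 2, pd k (pd l u) y =
      fderiv ℝ (fderiv ℝ u) y (EuclideanSpace.single k 1) (EuclideanSpace.single l 1) := by
    intro k l
    have : pd l u = fun z => fderiv ℝ u z (EuclideanSpace.single l 1) := rfl
    rw [this]
    simp only [pd]
    rw [fderiv_clm_apply hd (differentiableAt_const _)]
    simp
  rw [key, key, hs]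

theorem fderiv_eq_pd (u : Plane → V) (y w : Plane) :
    fderiv ℝ u y w = w 0 • pd 0 u y + w 1 • pd 1 u y := by
  have hw : w = w 0 • EuclideanSpace.single 0 (1 : ℝ) + w 1 • EuclideanSpace.single 1 (1 : ℝ) := by
    ext i; fin_cases i <;> simp
  conv_lhs => rw [hw]
  simp only [pd, map_add, map_smul]

theorem eq_of_pd_eq_zero {u : Plane → V} (hO : IsOpen O) (hc : IsPreconnected O)
    (hu : ContDiffOn ℝ ∞ u O) (h : ∀ z ∈ O, ∀ i, pd i u z = 0) {z z' : Plane} (hz : z ∈ O)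
    (hz' : z' ∈ O) : u z = u z' := by
  refine hO.is_const_of_fderiv_eq_zero (𝕜 := ℝ) hc (hu.differentiableOn (by simp)) ?_ hz hz'
  intro x hx
  ext w
  rw [fderiv_eq_pd, h x hx, h x hx]; simp

end Pd

/-! ### Adapted frames of the left-translated differential, over open subsets of the plane -/

/-- The matrix-valued one-forms `a`, `b` are expressed through a frame `α`, `β` and a real coframe
`s`, `t` as `a = s α - t β` and `b = s β + t (α - β)`. -/
structure IsAdaptedCoframe (O : Set Plane) (a b : Fin 2 → Plane → Mat2) (α β : Plane → Mat2)
    (s t : Fin 2 → Plane → ℝ) : Prop where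
  smooth_α : ContDiffOn ℝ ∞ α O
  smooth_β : ContDiffOn ℝ ∞ β O
  smooth_s : ∀ i, ContDiffOn ℝ ∞ (s i) O
  smooth_t : ∀ i, ContDiffOn ℝ ∞ (t i) O
  gram : ∀ y ∈ O, IsGramPair (α y) (β y)
  fst : ∀ y ∈ O, ∀ i, a i y = s i y • α y - t i y • β y
  snd : ∀ y ∈ O, ∀ i, b i y = s i y • β y + t i y • (α y - β y)
  det_ne : ∀ y ∈ O, s 0 y * t 1 y - s 1 y * t 0 y ≠ 0

/-- The structure equations of Maurer and Cartan. -/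
def MaurerCartan (O : Set Plane) (a : Fin 2 → Plane → Mat2) : Prop :=
  ∀ y ∈ O, pd 0 (a 1) y - pd 1 (a 0) y = comm (a 1 y) (a 0 y)

/-- A and B stand for ⟨a, a⟩ and ⟨b, b⟩ of a null vector z = (a, b), for which ⟨a, b⟩ = A + B. The
two equations prescribe the norms of the components of (u + vK)z. Encoded in one complex number Q
they read σ²Q = const with σ = u + vK, so the task is to choose a smooth branch of a square root. -/
theorem exists_smooth_scaling {O : Set Plane} (hO : IsOpen O) {y₀ : Plane} (hy₀ : y₀ ∈ O)
    {A B : Plane → ℝ} (hA : ContDiffOn ℝ ∞ A O) (hB : ContDiffOn ℝ ∞ B O)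
    (h0 : ¬ (A y₀ = 0 ∧ B y₀ = 0)) :
    ∃ O' ⊆ O, IsOpen O' ∧ y₀ ∈ O' ∧ ∃ u v : Plane → ℝ, ContDiffOn ℝ ∞ u O' ∧
      ContDiffOn ℝ ∞ v O' ∧ ∀ y ∈ O',
        u y ^ 2 * A y - 2 * u y * v y * (A y + B y) + v y ^ 2 * B y = 1 / 2 ∧
        u y ^ 2 * B y + 2 * u y * v y * A y - v y ^ 2 * (A y + B y) = 1 / 2 := by
  have r2 : √3 * √3 = 3 := Real.mul_self_sqrt (by norm_num)
  have r0 : √3 ≠ 0 := by positivity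
  -- With J acting as i and K as -1/2 + i√3/2, this combination satisfies Q(σz) = σ²Q(z).
  let Q : Plane → ℂ := fun y => ((-(3 / 2) * B y : ℝ) : ℂ) +
    ((√3 / 2 * (2 * A y + B y) : ℝ) : ℂ) * Complex.I
  have hQs : ContDiffOn ℝ ∞ Q O := by
    refine ContDiffOn.add ?_ (ContDiffOn.mul ?_ contDiffOn_const)
    · exact Complex.ofRealCLM.contDiff.comp_contDiffOn (contDiffOn_const.mul hB)
    · exact Complex.ofRealCLM.contDiff.comp_contDiffOn
        (contDiffOn_const.mul ((contDiffOn_const.mul hA).add hB))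
  have hQre : ∀ y, (Q y).re = -(3 / 2) * B y := fun y => by simp [Q]
  have hQim : ∀ y, (Q y).im = √3 / 2 * (2 * A y + B y) := fun y => by simp [Q]
  have hQ0 : Q y₀ ≠ 0 := by
    intro h
    have h1 : (Q y₀).re = 0 := by rw [h]; rfl
    have h2 : (Q y₀).im = 0 := by rw [h]; rfl
    rw [hQre] at h1
    rw [hQim] at h2
    have hb : B y₀ = 0 := by linarith
    have ha : 2 * A y₀ + B y₀ = 0 := by
      rcases mul_eq_zero.1 h2 with h | h
      · exact absurd h (by positivity)
      · exact h
    exact h0 ⟨by linarith, hb⟩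
  -- The numerator is the value of Q at A = B = 1/2.
  obtain ⟨c, hc⟩ := IsAlgClosed.exists_pow_nat_eq
    ((-(3 / 4) + (3 * √3 / 4 : ℝ) * Complex.I) / Q y₀) (n := 2) (by norm_num)
  -- Dividing by Q y₀ places the quotient near 1, where the principal logarithm is smooth.
  let O' : Set Plane := O ∩ (fun y => Q y / Q y₀) ⁻¹' Complex.slitPlane
  have hO' : IsOpen O' :=
    (hQs.continuousOn.div_const _).isOpen_inter_preimage hO Complex.isOpen_slitPlane
  have hsub : O' ⊆ O := Set.inter_subset_left
  let σ : Plane → ℂ := fun y => c * Complex.exp (-(1 / 2) * Complex.log (Q y / Q y₀))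
  have hσs : ContDiffOn ℝ ∞ σ O' := by
    have h1 : ContDiffOn ℝ ∞ (fun y => Q y / Q y₀) O' := (hQs.mono hsub).div_const _
    have h2 : ContDiffOn ℝ ∞ (fun y => Complex.log (Q y / Q y₀)) O' := by
      intro y hy
      have h := (Complex.contDiffAt_log (n := ∞) hy.2).restrict_scalars ℝ
      exact h.comp_contDiffWithinAt (f := fun y => Q y / Q y₀) y (h1 y hy)
    have h3 : ContDiff ℝ ∞ Complex.exp := Complex.contDiff_exp
    exact contDiffOn_const.mul (h3.comp_contDiffOn ((contDiffOn_const (c := (-(1 / 2) : ℂ))).mul h2))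
  have hσ : ∀ y ∈ O', σ y * σ y * Q y = -(3 / 4) + (3 * √3 / 4 : ℝ) * Complex.I := by
    intro y hy
    have hne : Q y / Q y₀ ≠ 0 := Complex.slitPlane_ne_zero hy.2
    have e : Complex.exp (-(1 / 2) * Complex.log (Q y / Q y₀)) *
        Complex.exp (-(1 / 2) * Complex.log (Q y / Q y₀)) = (Q y / Q y₀)⁻¹ := by
      rw [← Complex.exp_add, ← Complex.exp_log (inv_ne_zero hne)]
      rw [← Complex.exp_log hne, ← Complex.exp_neg, Complex.exp_log hne,
        Complex.exp_log (Complex.exp_ne_zero _)]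
      congr 1; ring
    have hQy : Q y ≠ 0 := fun h => hne (by rw [h, zero_div])
    calc σ y * σ y * Q y = c ^ 2 * (Complex.exp (-(1 / 2) * Complex.log (Q y / Q y₀)) *
          Complex.exp (-(1 / 2) * Complex.log (Q y / Q y₀))) * Q y := by
            simp only [σ]; ring
      _ = _ := by rw [e, hc]; field_simp
  -- u and v are read off from u + vK = σ, that is, u - v/2 = Re σ and (√3/2)v = Im σ.
  refine ⟨O', hsub, hO', ⟨hy₀, ?_⟩, fun y => (σ y).re + (σ y).im / √3, fun y => 2 * (σ y).im / √3,
    ?_, ?_, ?_⟩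
  · simp [div_self hQ0]
  · exact (Complex.reCLM.contDiff.comp_contDiffOn hσs).add
      ((Complex.imCLM.contDiff.comp_contDiffOn hσs).div_const _)
  · exact (contDiffOn_const.mul (Complex.imCLM.contDiff.comp_contDiffOn hσs)).div_const _
  · intro y hy
    have h := hσ y hy
    have hre := congrArg Complex.re h
    have him := congrArg Complex.im h
    simp only [Complex.mul_re, Complex.mul_im, hQre, hQim, Complex.add_re, Complex.add_im,
      Complex.ofReal_re, Complex.ofReal_im, Complex.I_re, Complex.I_im] at hre him
    norm_num at hre him
    set ρ := (σ y).re
    set τ := (σ y).im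
    have hr : (√3)⁻¹ = √3 / 3 := by field_simp; rw [sq, r2]
    simp only [div_eq_mul_inv, hr]
    generalize A y = A' at *
    generalize B y = B' at *
    have him' : √3 * ((ρ * ρ - τ * τ) * (2 * A' + B')) / 2 - 3 * (ρ * τ) * B' = 3 * √3 / 4 := by
      linear_combination him
    have him2 : (ρ * ρ - τ * τ) * (2 * A' + B') / 2 - √3 * (ρ * τ) * B' = 3 / 4 := by
      apply mul_left_cancel₀ r0
      linear_combination him' - ρ * τ * B' * r2
    constructor
    · linear_combination him2 + (1 / 3) * hre + -(1 / 3) * τ ^ 2 * A' * r2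
    · linear_combination -(2 / 3) * hre - (τ ^ 2 * B' / 3) * r2

/-! ### Consequences of the Maurer–Cartan equations: closed coframe and constant structure functions
-/

variable {O : Set Plane} {a b : Fin 2 → Plane → Mat2} {α β : Plane → Mat2}
  {s t : Fin 2 → Plane → ℝ}

/-- The coframe is closed and the frame has no tangential derivative. -/
theorem IsAdaptedCoframe.first_order (h : IsAdaptedCoframe O a b α β s t) (hO : IsOpen O)
    (ha : MaurerCartan O a) (hb : MaurerCartan O b) {y : Plane} (hy : y ∈ O) :
    pd 0 (s 1) y = pd 1 (s 0) y ∧ pd 0 (t 1) y = pd 1 (t 0) y ∧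
    ∃ μ ν : Fin 2 → ℝ, (∀ i, pd i α y = μ i • comm (α y) (β y)) ∧
      (∀ i, pd i β y = ν i • comm (α y) (β y)) ∧
      s 1 y * μ 0 - s 0 y * μ 1 - t 1 y * ν 0 + t 0 y * ν 1 = s 0 y * t 1 y - s 1 y * t 0 y ∧
      s 1 y * ν 0 - s 0 y * ν 1 + t 1 y * (μ 0 - ν 0) - t 0 y * (μ 1 - ν 1) =
        s 0 y * t 1 y - s 1 y * t 0 y := by
  have g := h.gram y hy
  have dα := diffAt h.smooth_α hO hy
  have dβ := diffAt h.smooth_β hO hy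
  have ds := fun i => diffAt (h.smooth_s i) hO hy
  have dt := fun i => diffAt (h.smooth_t i) hO hy
  -- Differentiating the Gram relations leaves one tangential unknown, the form ρ = ⟨dα, β⟩ = -⟨dβ,
  -- α⟩.
  have e1 : ∀ i, ip (pd i α y) 1 = 0 := fun i => by
    have e := pd_eq_zero hO (fun z hz => (h.gram z hz).tr₁) hy i
    rw [pd_ip dα (differentiableAt_const _), pd_const, ip_zero_right, zero_add] at e
    exact e
  have e2 : ∀ i, ip (pd i β y) 1 = 0 := fun i => by
    have e := pd_eq_zero hO (fun z hz => (h.gram z hz).tr₂) hy i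
    rw [pd_ip dβ (differentiableAt_const _), pd_const, ip_zero_right, zero_add] at e
    exact e
  have e3 : ∀ i, ip (pd i α y) (α y) = 0 := fun i => by
    have e := pd_eq_zero hO (fun z hz => (h.gram z hz).aa) hy i
    rw [pd_ip dα dα, ip_comm (α y)] at e
    linarith
  have e4 : ∀ i, ip (pd i β y) (β y) = 0 := fun i => by
    have e := pd_eq_zero hO (fun z hz => (h.gram z hz).bb) hy i
    rw [pd_ip dβ dβ, ip_comm (β y)] at e
    linarith
  have e5 : ∀ i, ip (pd i β y) (α y) = -ip (pd i α y) (β y) := fun i => by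
    have e := pd_eq_zero hO (fun z hz => (h.gram z hz).ab) hy i
    rw [pd_ip dα dβ, ip_comm (α y)] at e
    linarith
  have pa : ∀ i j, pd i (a j) y = s j y • pd i α y + pd i (s j) y • α y -
      (t j y • pd i β y + pd i (t j) y • β y) := fun i j => by
    rw [pd_congr hO (fun z hz => h.fst z hz j) hy,
      pd_sub ((ds j).fun_smul dα) ((dt j).fun_smul dβ), pd_smul (ds j) dα, pd_smul (dt j) dβ]
  have pb : ∀ i j, pd i (b j) y = s j y • pd i β y + pd i (s j) y • β y +
      (t j y • (pd i α y - pd i β y) + pd i (t j) y • (α y - β y)) := fun i j => by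
    rw [pd_congr hO (fun z hz => h.snd z hz j) hy,
      pd_add ((ds j).fun_smul dβ) ((dt j).fun_smul (dα.fun_sub dβ)), pd_smul (ds j) dβ,
      pd_smul (dt j) (dα.fun_sub dβ), pd_sub dα dβ]
  have ca : comm (a 1 y) (a 0 y) =
      (s 0 y * t 1 y - s 1 y * t 0 y) • comm (α y) (β y) := by
    rw [h.fst y hy, h.fst y hy]
    simp only [comm_sub_left, comm_sub_right, comm_smul_left, comm_smul_right, comm_self,
      comm_swap (β y) (α y)]
    module
  have cb : comm (b 1 y) (b 0 y) =
      (s 0 y * t 1 y - s 1 y * t 0 y) • comm (α y) (β y) := by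
    rw [h.snd y hy, h.snd y hy]
    simp only [comm_sub_left, comm_sub_right, comm_smul_left, comm_smul_right, comm_self,
      comm_add_left, comm_add_right, comm_swap (β y) (α y)]
    module
  have A := ha y hy
  have B := hb y hy
  rw [pa, pa, ca] at A
  rw [pb, pb, cb] at B
  have Aα := congrArg (ip · (α y)) A
  have Aβ := congrArg (ip · (β y)) A
  have Aκ := congrArg (ip · (comm (α y) (β y))) A
  have Bα := congrArg (ip · (α y)) B
  have Bβ := congrArg (ip · (β y)) B
  have Bκ := congrArg (ip · (comm (α y) (β y))) B
  have k1 : ip (α y) (comm (α y) (β y)) = 0 := by rw [ip_comm, ip_comm_left]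
  have k2 : ip (β y) (comm (α y) (β y)) = 0 := by rw [ip_comm, ip_comm_right]
  simp only [ip_sub_left, ip_add_left, ip_smul_left, ip_comm_left, ip_comm_right, e3, e4, e5,
    g.aa, g.bb, g.ab, g.ba, k1, k2, g.comm_norm] at Aα Aβ Aκ Bα Bβ Bκ
  -- The four components along α and β are linear equations in ds, dt, s ∧ ρ and t ∧ ρ with only the
  -- zero solution; since s, t is a coframe, ρ = 0.
  have hτ : pd 0 (t 1) y = pd 1 (t 0) y := by linarith
  have hσ : pd 0 (s 1) y = pd 1 (s 0) y := by linarith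
  have hS : s 1 y * ip (pd 0 α y) (β y) - s 0 y * ip (pd 1 α y) (β y) = 0 := by linarith
  have hT : t 1 y * ip (pd 0 α y) (β y) - t 0 y * ip (pd 1 α y) (β y) = 0 := by linarith
  have hΔ := h.det_ne y hy
  have r0 : ip (pd 0 α y) (β y) = 0 := by
    apply mul_left_cancel₀ hΔ
    linear_combination s 0 y * hT - t 0 y * hS
  have r1 : ip (pd 1 α y) (β y) = 0 := by
    apply mul_left_cancel₀ hΔ
    linear_combination s 1 y * hT - t 1 y * hS
  have r : ∀ i, ip (pd i α y) (β y) = 0 := by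
    intro i; fin_cases i
    · exact r0
    · exact r1
  refine ⟨hσ, hτ, fun i => ip (pd i α y) (comm (α y) (β y)) / 3,
    fun i => ip (pd i β y) (comm (α y) (β y)) / 3,
    fun i => g.eq_smul_comm (e1 i) (e3 i) (r i),
    fun i => g.eq_smul_comm (e2 i) (by rw [e5, r, neg_zero]) (e4 i), ?_, ?_⟩
  · linear_combination Aκ / 3
  · linear_combination Bκ / 3

theorem pd_comm_frame {y : Plane} {μ ν : ℝ} (g : IsGramPair (α y) (β y))
    (dα : DifferentiableAt ℝ α y) (dβ : DifferentiableAt ℝ β y) {i : Fin 2}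
    (hα : pd i α y = μ • comm (α y) (β y)) (hβ : pd i β y = ν • comm (α y) (β y)) :
    pd i (fun z => comm (α z) (β z)) y =
      (2 * μ - 4 * ν) • α y + (2 * ν - 4 * μ) • β y := by
  rw [pd_matComm dα dβ, hα, hβ, comm_smul_left, comm_smul_right, g.comm_comm_right,
    g.comm_comm_left]
  module

/-- `c1` and `c2` are the Cauchy–Riemann equations d(m + nK) ∧ (s + tK) = 0, and `p0`, `p1` say that
the derivative is tangent to the circle `hq`. The differential of a holomorphic function is zero or
onto the real plane, so tangency to a curve forces it to vanish. -/
theorem angle_rigid {M N m0 m1 n0 n1 s0 s1 t0 t1 : ℝ}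
    (hq : M ^ 2 - M * N + N ^ 2 - M + N = 0) (hd : s0 * t1 - s1 * t0 ≠ 0)
    (c1 : m0 * s1 - n0 * t1 = m1 * s0 - n1 * t0)
    (c2 : n0 * s1 + (m0 - n0) * t1 = n1 * s0 + (m1 - n1) * t0)
    (p0 : (2 * M - N - 1) * m0 + (2 * N - M + 1) * n0 = 0)
    (p1 : (2 * M - N - 1) * m1 + (2 * N - M + 1) * n1 = 0) :
    m0 = 0 ∧ n0 = 0 ∧ m1 = 0 ∧ n1 = 0 := by
  have px : (2 * M - N - 1) * (m0 * t1 - m1 * t0) +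
      (2 * N - M + 1) * (n0 * t1 - n1 * t0) = 0 := by
    linear_combination t1 * p0 - t0 * p1
  have pw : (2 * M - N - 1) * (m1 * s0 - m0 * s1) +
      (2 * N - M + 1) * (n1 * s0 - n0 * s1) = 0 := by
    linear_combination s0 * p1 - s1 * p0
  have w1 : m1 * s0 - m0 * s1 = -(n0 * t1 - n1 * t0) := by linear_combination -c1
  have w2 : n1 * s0 - n0 * s1 = (m0 * t1 - m1 * t0) - (n0 * t1 - n1 * t0) := by
    linear_combination -c2
  rw [w1, w2] at pw
  -- With p = 2M - N - 1 and q = 2N - M + 1, `px` and `pw` form a linear system of determinant -(p²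
  -- + pq + q²). Now p² + pq + q² equals 1 plus three times the left side of `hq`, so the system is
  -- invertible on the circle.
  have hx : m0 * t1 - m1 * t0 = 0 := by
    linear_combination (M + N) * px + (2 * N - M + 1) * pw - 3 * (m0 * t1 - m1 * t0) * hq
  have hz : n0 * t1 - n1 * t0 = 0 := by
    linear_combination (2 * N - M + 1) * px - (2 * M - N - 1) * pw - 3 * (n0 * t1 - n1 * t0) * hq
  refine ⟨?_, ?_, ?_, ?_⟩ <;> apply mul_left_cancel₀ hd
  · linear_combination s0 * hx + t0 * w1 - t0 * hz
  · linear_combination s0 * hz + t0 * w2 + t0 * hx - t0 * hz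
  · linear_combination s1 * hx + t1 * w1 - t1 * hz
  · linear_combination s1 * hz + t1 * w2 + t1 * hx - t1 * hz

/-- The frame satisfies `dα = (m s - (1 + n) t) [α, β]`, `dβ = (n s + (m - n - 1) t) [α, β]` with
constants `m` and `n`, subject to a quadratic relation. -/
theorem IsAdaptedCoframe.second_order (h : IsAdaptedCoframe O a b α β s t) (hO : IsOpen O)
    (hconn : IsPreconnected O) (ha : MaurerCartan O a) (hb : MaurerCartan O b)
    {y₀ : Plane} (hy₀ : y₀ ∈ O) :
    ∃ m n : ℝ, m ^ 2 - m * n + n ^ 2 - m + n = 0 ∧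
      ∀ y ∈ O, ∀ i, pd i α y = (m * s i y - (1 + n) * t i y) • comm (α y) (β y) ∧
        pd i β y = (n * s i y + (m - n - 1) * t i y) • comm (α y) (β y) := by
  let κ : Plane → Mat2 := fun y => comm (α y) (β y)
  have sκ : ContDiffOn ℝ ∞ κ O := contDiffOn_comm h.smooth_α h.smooth_β
  let μ : Fin 2 → Plane → ℝ := fun i y => ip (pd i α y) (κ y) / 3
  let ν : Fin 2 → Plane → ℝ := fun i y => ip (pd i β y) (κ y) / 3
  have sμ : ∀ i, ContDiffOn ℝ ∞ (μ i) O := fun i =>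
    (contDiffOn_ip (contDiffOn_pd hO h.smooth_α i) sκ).div_const _
  have sν : ∀ i, ContDiffOn ℝ ∞ (ν i) O := fun i =>
    (contDiffOn_ip (contDiffOn_pd hO h.smooth_β i) sκ).div_const _
  have hμ : ∀ y ∈ O, ∀ i, pd i α y = μ i y • κ y := fun y hy i => by
    obtain ⟨-, -, μ', -, e, -⟩ := h.first_order hO ha hb hy
    simp only [μ, κ, e i, ip_smul_left, (h.gram y hy).comm_norm]
    rw [mul_div_assoc]; norm_num
  have hν : ∀ y ∈ O, ∀ i, pd i β y = ν i y • κ y := fun y hy i => by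
    obtain ⟨-, -, -, ν', -, e, -⟩ := h.first_order hO ha hb hy
    simp only [ν, κ, e i, ip_smul_left, (h.gram y hy).comm_norm]
    rw [mul_div_assoc]; norm_num
  have hlin : ∀ y ∈ O,
      s 1 y * μ 0 y - s 0 y * μ 1 y - t 1 y * ν 0 y + t 0 y * ν 1 y =
        s 0 y * t 1 y - s 1 y * t 0 y ∧
      s 1 y * ν 0 y - s 0 y * ν 1 y + t 1 y * (μ 0 y - ν 0 y) - t 0 y * (μ 1 y - ν 1 y) =
        s 0 y * t 1 y - s 1 y * t 0 y := fun y hy => by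
    obtain ⟨-, -, μ', ν', e, e', l⟩ := h.first_order hO ha hb hy
    have q : ∀ i, μ i y = μ' i ∧ ν i y = ν' i := fun i => by
      simp only [μ, ν, κ, e i, e' i, ip_smul_left, (h.gram y hy).comm_norm]
      constructor <;> ring
    simpa only [(q 0).1, (q 1).1, (q 0).2, (q 1).2] using l
  let Δ : Plane → ℝ := fun y => s 0 y * t 1 y - s 1 y * t 0 y
  have sΔ : ContDiffOn ℝ ∞ Δ O := ((h.smooth_s 0).mul (h.smooth_t 1)).sub
    ((h.smooth_s 1).mul (h.smooth_t 0))
  have hΔ : ∀ y ∈ O, Δ y ≠ 0 := h.det_ne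
  -- m and n are the s-components of the forms μ and ν; the two relations of `hlin` then determine
  -- the t-components.
  let m : Plane → ℝ := fun y => (μ 0 y * t 1 y - μ 1 y * t 0 y) / Δ y
  let n : Plane → ℝ := fun y => (ν 0 y * t 1 y - ν 1 y * t 0 y) / Δ y
  have sm : ContDiffOn ℝ ∞ m O := (((sμ 0).mul (h.smooth_t 1)).sub
    ((sμ 1).mul (h.smooth_t 0))).div sΔ hΔ
  have sn : ContDiffOn ℝ ∞ n O := (((sν 0).mul (h.smooth_t 1)).sub
    ((sν 1).mul (h.smooth_t 0))).div sΔ hΔ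
  have hm : ∀ y ∈ O, m y * Δ y = μ 0 y * t 1 y - μ 1 y * t 0 y := fun y hy =>
    div_mul_cancel₀ _ (hΔ y hy)
  have hn : ∀ y ∈ O, n y * Δ y = ν 0 y * t 1 y - ν 1 y * t 0 y := fun y hy =>
    div_mul_cancel₀ _ (hΔ y hy)
  have μe : ∀ y ∈ O, ∀ i, μ i y = m y * s i y - (1 + n y) * t i y := fun y hy i => by
    apply mul_left_cancel₀ (hΔ y hy)
    obtain ⟨l1, l2⟩ := hlin y hy
    have h1 := hm y hy
    have h2 := hn y hy
    fin_cases i <;> simp only [Δ, Fin.zero_eta, Fin.mk_one] at *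
    · linear_combination -s 0 y * h1 + t 0 y * h2 - t 0 y * l1
    · linear_combination -s 1 y * h1 + t 1 y * h2 - t 1 y * l1
  have νe : ∀ y ∈ O, ∀ i, ν i y = n y * s i y + (m y - n y - 1) * t i y := fun y hy i => by
    apply mul_left_cancel₀ (hΔ y hy)
    obtain ⟨l1, l2⟩ := hlin y hy
    have h1 := hm y hy
    have h2 := hn y hy
    fin_cases i <;> simp only [Δ, Fin.zero_eta, Fin.mk_one] at *
    · linear_combination -s 0 y * h2 - t 0 y * h1 + t 0 y * h2 - t 0 y * l2
    · linear_combination -s 1 y * h2 - t 1 y * h1 + t 1 y * h2 - t 1 y * l2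
  have hκ : ∀ y ∈ O, ∀ i, pd i κ y =
      (2 * μ i y - 4 * ν i y) • α y + (2 * ν i y - 4 * μ i y) • β y := fun y hy i =>
    pd_comm_frame (h.gram y hy) (diffAt h.smooth_α hO hy) (diffAt h.smooth_β hO hy)
      (hμ y hy i) (hν y hy i)
  -- Equality of mixed partials of α and β. Since dκ is tangential, the κ-components say that μ and
  -- ν are closed, and the β-component of the relation for α gives μ ∧ ν = 0, which becomes the
  -- circle relation.
  have hcross : ∀ y ∈ O, (pd 0 (μ 1) y = pd 1 (μ 0) y ∧ pd 0 (ν 1) y = pd 1 (ν 0) y) ∧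
      μ 0 y * ν 1 y = μ 1 y * ν 0 y := fun y hy => by
    have g := h.gram y hy
    have k1 : ip (α y) (κ y) = 0 := by rw [ip_comm]; exact ip_comm_left
    have k2 : ip (β y) (κ y) = 0 := by rw [ip_comm]; exact ip_comm_right
    have k3 : ip (κ y) (κ y) = 3 := g.comm_norm
    have k5 : ip (κ y) (β y) = 0 := ip_comm_right
    have c1 := pd_pd_comm hO h.smooth_α hy 0 1
    have c2 := pd_pd_comm hO h.smooth_β hy 0 1
    rw [pd_congr hO (fun z hz => hμ z hz 1) hy, pd_congr hO (fun z hz => hμ z hz 0) hy,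
      pd_smul (diffAt (sμ 1) hO hy) (diffAt sκ hO hy),
      pd_smul (diffAt (sμ 0) hO hy) (diffAt sκ hO hy), hκ y hy, hκ y hy] at c1
    rw [pd_congr hO (fun z hz => hν z hz 1) hy, pd_congr hO (fun z hz => hν z hz 0) hy,
      pd_smul (diffAt (sν 1) hO hy) (diffAt sκ hO hy),
      pd_smul (diffAt (sν 0) hO hy) (diffAt sκ hO hy), hκ y hy, hκ y hy] at c2
    have d1 := congrArg (ip · (κ y)) c1
    have d2 := congrArg (ip · (κ y)) c2
    have d3 := congrArg (ip · (β y)) c1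
    simp only [ip_add_left, ip_smul_left, k1, k2, k3, k5, g.ab, g.bb] at d1 d2 d3
    refine ⟨⟨by linarith, by linarith⟩, ?_⟩
    linear_combination (1 / 3) * d3
  have hquad : ∀ y ∈ O, m y ^ 2 - m y * n y + n y ^ 2 - m y + n y = 0 := fun y hy => by
    have := (hcross y hy).2
    rw [μe y hy, μe y hy, νe y hy, νe y hy] at this
    apply mul_left_cancel₀ (hΔ y hy)
    simp only [Δ]
    linear_combination this
  -- Closedness of μ, ν, s and t turns into the Cauchy–Riemann equations for m + nK.
  have hconst : ∀ y ∈ O, ∀ i, pd i m y = 0 ∧ pd i n y = 0 := fun y hy => by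
    have dm := diffAt sm hO hy
    have dn := diffAt sn hO hy
    have ds := fun i => diffAt (h.smooth_s i) hO hy
    have dt := fun i => diffAt (h.smooth_t i) hO hy
    obtain ⟨cs, ct, -⟩ := h.first_order hO ha hb hy
    obtain ⟨⟨c1, c2⟩, -⟩ := hcross y hy
    have pμ : ∀ i j, pd i (μ j) y = m y * pd i (s j) y + pd i m y * s j y -
        ((1 + n y) * pd i (t j) y + pd i n y * t j y) := fun i j => by
      have d1n : DifferentiableAt ℝ (fun z => 1 + n z) y := dn.const_add _
      rw [pd_congr hO (fun z hz => μe z hz j) hy, pd_sub (dm.fun_mul (ds j)) (d1n.fun_mul (dt j)),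
        pd_mul dm (ds j), pd_mul d1n (dt j), pd_add (differentiableAt_const _) dn, pd_const,
        zero_add]
    have pν : ∀ i j, pd i (ν j) y = n y * pd i (s j) y + pd i n y * s j y +
        ((m y - n y - 1) * pd i (t j) y + (pd i m y - pd i n y) * t j y) := fun i j => by
      have d1n : DifferentiableAt ℝ (fun z => m z - n z - 1) y := (dm.sub dn).sub_const _
      rw [pd_congr hO (fun z hz => νe z hz j) hy, pd_add (dn.fun_mul (ds j)) (d1n.fun_mul (dt j)),
        pd_mul dn (ds j), pd_mul d1n (dt j), pd_sub (dm.fun_sub dn) (differentiableAt_const _),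
        pd_const, sub_zero, pd_sub dm dn]
    rw [pμ, pμ, cs, ct] at c1
    rw [pν, pν, cs, ct] at c2
    have pq : ∀ i, (2 * m y - n y - 1) * pd i m y + (2 * n y - m y + 1) * pd i n y = 0 :=
      fun i => by
        have e := pd_eq_zero hO (fun z hz => (by
          linear_combination hquad z hz : m z * (m z - n z - 1) + n z * (n z + 1) = 0)) hy i
        have d1 : DifferentiableAt ℝ (fun z => m z - n z - 1) y := (dm.sub dn).sub_const _
        have d2 : DifferentiableAt ℝ (fun z => n z + 1) y := dn.add_const _
        rw [pd_add (dm.fun_mul d1) (dn.fun_mul d2), pd_mul dm d1, pd_mul dn d2,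
          pd_sub (dm.fun_sub dn) (differentiableAt_const _), pd_sub dm dn,
          pd_add dn (differentiableAt_const _), pd_const] at e
        linear_combination e
    have := angle_rigid (hquad y hy) (hΔ y hy) (by linear_combination c1)
      (by linear_combination c2) (pq 0) (pq 1)
    intro i
    fin_cases i
    exacts [⟨this.1, this.2.1⟩, ⟨this.2.2.1, this.2.2.2⟩]
  refine ⟨m y₀, n y₀, hquad y₀ hy₀, fun y hy i => ?_⟩
  rw [hμ y hy, hν y hy, μe y hy, νe y hy,
    eq_of_pd_eq_zero hO hconn sm (fun z hz i => (hconst z hz i).1) hy hy₀,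
    eq_of_pd_eq_zero hO hconn sn (fun z hz i => (hconst z hz i).2) hy hy₀]
  exact ⟨rfl, rfl⟩

/-- `hspan` says that the second coordinate vector is (c + dK) times the first, so normalizing the
first one normalizes the whole complex line. `hnull` and `hnd` allow `exists_smooth_scaling` to be
applied to it. -/
theorem exists_adaptedCoframe {O : Set Plane} {a b : Fin 2 → Plane → Mat2} (hO : IsOpen O)
    (ha : ∀ i, ContDiffOn ℝ ∞ (a i) O) (hb : ∀ i, ContDiffOn ℝ ∞ (b i) O)
    (ta : ∀ y ∈ O, ip (a 0 y) 1 = 0) (tb : ∀ y ∈ O, ip (b 0 y) 1 = 0)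
    (hnull : ∀ y ∈ O, ip (a 0 y) (b 0 y) = ip (a 0 y) (a 0 y) + ip (b 0 y) (b 0 y))
    (hnd : ∀ y ∈ O, ¬ (ip (a 0 y) (a 0 y) = 0 ∧ ip (b 0 y) (b 0 y) = 0))
    (hspan : ∀ y ∈ O, ∃ c d : ℝ, d ≠ 0 ∧ a 1 y = c • a 0 y - d • b 0 y ∧
      b 1 y = c • b 0 y + d • (a 0 y - b 0 y)) {y₀ : Plane} (hy₀ : y₀ ∈ O) :
    ∃ O' ⊆ O, IsOpen O' ∧ y₀ ∈ O' ∧ ∃ α β s t, IsAdaptedCoframe O' a b α β s t := by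
  obtain ⟨O', hsub, hO', hy', u, v, su, sv, huv⟩ := exists_smooth_scaling hO hy₀
    (contDiffOn_ip (ha 0) (ha 0)) (contDiffOn_ip (hb 0) (hb 0)) (hnd y₀ hy₀)
  have ha' := fun i => (ha i).mono hsub
  have hb' := fun i => (hb i).mono hsub
  let α : Plane → Mat2 := fun y => u y • a 0 y - v y • b 0 y
  let β : Plane → Mat2 := fun y => u y • b 0 y + v y • (a 0 y - b 0 y)
  have sα : ContDiffOn ℝ ∞ α O' := (su.smul (ha' 0)).sub (sv.smul (hb' 0))
  have sβ : ContDiffOn ℝ ∞ β O' := (su.smul (hb' 0)).add (sv.smul ((ha' 0).sub (hb' 0)))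
  have hgram : ∀ y ∈ O', IsGramPair (α y) (β y) := fun y hy => by
    obtain ⟨e1, e2⟩ := huv y hy
    have e3 := hnull y (hsub hy)
    have e4 := ta y (hsub hy)
    have e5 := tb y (hsub hy)
    constructor <;> simp only [α, β, ip_sub_left, ip_add_left, ip_smul_left, ip_sub_right,
      ip_add_right, ip_smul_right, e4, e5, ip_comm (b 0 y) (a 0 y), e3]
    · ring
    · ring
    · linear_combination e1
    · linear_combination e2
    · linear_combination e1 + e2
  have key : ∀ y ∈ O', ∀ i, ∃ s t : ℝ, a i y = s • α y - t • β y ∧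
      b i y = s • β y + t • (α y - β y) := fun y hy => by
    -- This is |u + vK|²; its inverse serves to divide by u + vK.
    have hN : u y ^ 2 - u y * v y + v y ^ 2 ≠ 0 := by
      intro h0
      have hv : v y = 0 := by nlinarith [sq_nonneg (2 * u y - v y), sq_nonneg (v y)]
      have hu : u y = 0 := by
        rw [hv] at h0
        simpa using h0
      have := (huv y hy).1
      rw [hu, hv] at this
      norm_num at this
    have e0 : ∃ s t : ℝ, a 0 y = s • α y - t • β y ∧ b 0 y = s • β y + t • (α y - β y) := by
      have hk := inv_mul_cancel₀ hN
      set r := (u y ^ 2 - u y * v y + v y ^ 2)⁻¹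
      refine ⟨(u y - v y) * r, -v y * r, ?_, ?_⟩
      · ext k l
        simp only [α, β, Matrix.sub_apply, Matrix.add_apply, Matrix.smul_apply, smul_eq_mul]
        linear_combination -(a 0 y k l) * hk
      · ext k l
        simp only [α, β, Matrix.sub_apply, Matrix.add_apply, Matrix.smul_apply, smul_eq_mul]
        linear_combination -(b 0 y k l) * hk
    intro i
    fin_cases i
    · exact e0
    · obtain ⟨s, t, e1, e2⟩ := e0
      obtain ⟨c, d, -, e3, e4⟩ := hspan y (hsub hy)
      refine ⟨c * s - d * t, c * t + d * s - d * t, ?_, ?_⟩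
      · simp only [Fin.mk_one]
        rw [e3, e1, e2]; module
      · simp only [Fin.mk_one]
        rw [e4, e1, e2]; module
  -- The coordinates are recovered by inverting the constant Gram matrix, which makes their
  -- smoothness visible.
  let s : Fin 2 → Plane → ℝ := fun i y =>
    (4 / 3) * ip (a i y) (β y) - (2 / 3) * ip (a i y) (α y)
  let t : Fin 2 → Plane → ℝ := fun i y =>
    (2 / 3) * ip (a i y) (β y) - (4 / 3) * ip (a i y) (α y)
  have hst : ∀ y ∈ O', ∀ i, a i y = s i y • α y - t i y • β y ∧
      b i y = s i y • β y + t i y • (α y - β y) := fun y hy i => by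
    obtain ⟨s', t', e1, e2⟩ := key y hy i
    have g := hgram y hy
    have hs : s i y = s' := by
      simp only [s, e1, ip_sub_left, ip_smul_left, g.aa, g.ab, g.ba, g.bb]; ring
    have ht : t i y = t' := by
      simp only [t, e1, ip_sub_left, ip_smul_left, g.aa, g.ab, g.ba, g.bb]; ring
    rw [hs, ht]
    exact ⟨e1, e2⟩
  refine ⟨O', hsub, hO', hy', α, β, s, t, sα, sβ, fun i => ?_, fun i => ?_, hgram,
    fun y hy i => (hst y hy i).1, fun y hy i => (hst y hy i).2, fun y hy h0 => ?_⟩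
  · exact (contDiffOn_const.mul (contDiffOn_ip (ha' i) sβ)).sub
      (contDiffOn_const.mul (contDiffOn_ip (ha' i) sα))
  · exact (contDiffOn_const.mul (contDiffOn_ip (ha' i) sβ)).sub
      (contDiffOn_const.mul (contDiffOn_ip (ha' i) sα))
  · have g := hgram y hy
    obtain ⟨c, d, hd, e3, e4⟩ := hspan y (hsub hy)
    have q := (hst y hy 1).1
    rw [e3, (hst y hy 0).1, (hst y hy 0).2] at q
    have q' : (c * s 0 y - d * t 0 y) • α y + (d * t 0 y - d * s 0 y - c * t 0 y) • β y =
        s 1 y • α y + (-t 1 y) • β y := by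
      rw [neg_smul, ← sub_eq_add_neg, ← q]; module
    obtain ⟨q1, q2⟩ := g.coeff_eq q'
    -- From s₁ + t₁K = (c + dK)(s₀ + t₀K) the determinant of the coframe is d|s₀ + t₀K|².
    have h1 : d * (s 0 y ^ 2 - s 0 y * t 0 y + t 0 y ^ 2) = 0 := by
      linear_combination h0 - s 0 y * q2 - t 0 y * q1
    have h2 : s 0 y ^ 2 - s 0 y * t 0 y + t 0 y ^ 2 = 0 := (mul_eq_zero.1 h1).resolve_left hd
    have ht : t 0 y = 0 := by nlinarith [sq_nonneg (2 * s 0 y - t 0 y), sq_nonneg (t 0 y)]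
    have hs : s 0 y = 0 := by
      rw [ht] at h2
      simpa using h2
    refine hnd y (hsub hy) ⟨?_, ?_⟩
    · rw [(hst y hy 0).1, hs, ht]; simp [ip_zero_left]
    · rw [(hst y hy 0).2, hs, ht]; simp [ip_zero_left]

/-- Equality of mixed partials of p, multiplied on the left by the inverse of p. -/
theorem maurerCartan_of_leftTranslation {O : Set Plane} {p : Plane → Mat2}
    {a : Fin 2 → Plane → Mat2} (hO : IsOpen O) (hp : ContDiffOn ℝ ∞ p O)
    (hp' : ∀ y ∈ O, ∃ P : SL2, p y = P) (ha : ∀ i, ContDiffOn ℝ ∞ (a i) O)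
    (hpa : ∀ y ∈ O, ∀ i, pd i p y = p y * a i y) : MaurerCartan O a := by
  intro y hy
  have e := pd_pd_comm hO hp hy 0 1
  have dp := diffAt hp hO hy
  have da := fun i => diffAt (ha i) hO hy
  rw [pd_congr hO (fun z hz => hpa z hz 1) hy, pd_congr hO (fun z hz => hpa z hz 0) hy,
    pd_matMul dp (da 1), pd_matMul dp (da 0), hpa y hy, hpa y hy, mul_assoc, mul_assoc,
    ← mul_add, ← mul_add] at e
  obtain ⟨P, hP⟩ := hp' y hy
  rw [hP] at e
  have e' := congrArg (fun X => ((P⁻¹ : SL2) : Mat2) * X) e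
  simp only [SL2_inv_mul] at e'
  rw [comm, sub_eq_sub_iff_add_eq_add, e']
  abel

/-! ### Pointwise algebra of a degenerate complex line -/

theorem inv_sqrt_three_sq : (1 / √3) * (1 / √3) = 1 / 3 := by
  rw [div_mul_div_comm, Real.mul_self_sqrt (by norm_num)]; norm_num

theorem J_J (z : Mat2 × Mat2) : J (J z) = -z := by
  have h := inv_sqrt_three_sq
  ext i j
  · simp only [J, Matrix.sub_apply, Matrix.smul_apply, smul_eq_mul, Prod.fst_neg, Matrix.neg_apply]
    linear_combination (-3 * z.1 i j) * h
  · simp only [J, Matrix.sub_apply, Matrix.smul_apply, smul_eq_mul, Prod.snd_neg, Matrix.neg_apply]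
    linear_combination (-3 * z.2 i j) * h

theorem J_smul (r : ℝ) (z : Mat2 × Mat2) : J (r • z) = r • J z := by
  simp only [J, Prod.smul_fst, Prod.smul_snd, Prod.smul_mk, Prod.mk.injEq]
  constructor <;> module

theorem g_eq (z w : Mat2 × Mat2) :
    g z w = (2 / 3) * (ip z.1 w.1 + ip z.2 w.2) - (1 / 3) * (ip z.1 w.2 + ip z.2 w.1) := by
  have h := inv_sqrt_three_sq
  simp only [g, ipProd, J, ip_smul_left, ip_smul_right, ip_sub_left, ip_sub_right]
  generalize 1 / √3 = r at h
  linear_combination (1 / 4 * (5 * ip z.1 w.1 + 5 * ip z.2 w.2 - 4 * ip z.1 w.2 -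
    4 * ip z.2 w.1)) * h

/-- The Lorentzian space of traceless matrices contains no totally null plane. -/
theorem exists_smul_of_null {a b : Mat2} (ha : ip a 1 = 0) (hb : ip b 1 = 0) (haa : ip a a = 0)
    (hbb : ip b b = 0) (hab : ip a b = 0) (h0 : a ≠ 0) : ∃ r : ℝ, b = r • a := by
  have h1 := trace_zero ha
  have h2 := trace_zero hb
  simp only [ip, h1, h2] at haa hbb hab
  -- Each minor of (a, b) is, up to its square, a combination of the three vanishing products.
  have key : (b 0 0 * a 0 1 - b 0 1 * a 0 0) ^ 2 = 0 := by
    linear_combination a 0 1 ^ 2 * hbb - 2 * b 0 1 * a 0 1 * hab + b 0 1 ^ 2 * haa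
  have key' : (b 0 0 * a 1 0 - b 1 0 * a 0 0) ^ 2 = 0 := by
    linear_combination a 1 0 ^ 2 * hbb - 2 * b 1 0 * a 1 0 * hab + b 1 0 ^ 2 * haa
  have key1 := pow_eq_zero_iff (two_ne_zero) |>.1 key
  have key2 := pow_eq_zero_iff (two_ne_zero) |>.1 key'
  by_cases h01 : a 0 1 = 0
  · have h00 : a 0 0 = 0 := by
      rw [h01] at haa
      nlinarith [sq_nonneg (a 0 0)]
    have h10 : a 1 0 ≠ 0 := by
      intro h10
      apply h0
      ext i j
      fin_cases i <;> fin_cases j <;> simp [h00, h01, h10, h1]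
    refine ⟨b 1 0 / a 1 0, ?_⟩
    have c1 : b 0 0 = 0 := by
      rw [h00] at key2
      have : b 0 0 * a 1 0 = 0 := by linarith
      exact (mul_eq_zero.1 this).resolve_right h10
    have c2 : b 0 1 = 0 := by
      rw [h00, h01] at hab
      have : b 0 1 * a 1 0 = 0 := by linarith
      exact (mul_eq_zero.1 this).resolve_right h10
    ext i j
    fin_cases i <;> fin_cases j <;> simp [h00, h01, h1, h2, c1, c2, h10]
  · refine ⟨b 0 1 / a 0 1, ?_⟩
    have c1 : b 0 0 = b 0 1 / a 0 1 * a 0 0 := by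
      field_simp
      linarith
    have c2 : b 1 0 = b 0 1 / a 0 1 * a 1 0 := by
      have e : b 0 1 / a 0 1 * a 0 1 = b 0 1 := div_mul_cancel₀ _ h01
      apply mul_left_cancel₀ h01
      rw [c1] at hab
      linear_combination 2 * hab - 2 * (b 0 1 / a 0 1) * haa + a 1 0 * e
    ext i j
    fin_cases i <;> fin_cases j <;> simp [h1, h2, h01]
    · exact c1
    · exact c2
    · exact c1

/-- The linear algebra of a null, `J`-invariant plane that is not `P`-invariant. -/
theorem degenerate_plane (L : Plane →ₗ[ℝ] Mat2 × Mat2) (hL : Function.Injective L)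
    (hJ : ∀ v, ∃ w, J (L v) = L w) (hg : ∀ v, g (L v) (L v) = 0)
    (htr : ∀ v, ip (L v).1 1 = 0 ∧ ip (L v).2 1 = 0) (hP : ¬ ∀ v, ∃ w, P (L v) = L w)
    {z z' : Mat2 × Mat2} (hz : L (EuclideanSpace.single 0 1) = z)
    (hz' : L (EuclideanSpace.single 1 1) = z') :
    ip z.1 z.2 = ip z.1 z.1 + ip z.2 z.2 ∧ ¬ (ip z.1 z.1 = 0 ∧ ip z.2 z.2 = 0) ∧
      ∃ c d : ℝ, d ≠ 0 ∧ z'.1 = c • z.1 - d • z.2 ∧ z'.2 = c • z.2 + d • (z.1 - z.2) := by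
  have hz0 : z ≠ 0 := by
    rw [← hz, Ne, ← map_zero L, hL.eq_iff]
    simp
  have hLv : ∀ v : Plane, L v = v 0 • z + v 1 • z' := fun v => by
    have hv : v = v 0 • EuclideanSpace.single 0 (1 : ℝ) +
        v 1 • EuclideanSpace.single 1 (1 : ℝ) := by
      ext i; fin_cases i <;> simp
    conv_lhs => rw [hv]
    rw [map_add, map_smul, map_smul, hz, hz']
  have hnull : ip z.1 z.2 = ip z.1 z.1 + ip z.2 z.2 := by
    have := hg (EuclideanSpace.single 0 1)
    rw [hz, g_eq, ip_comm z.2 z.1] at this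
    linarith
  have hspan : ∃ c d : ℝ, d ≠ 0 ∧ z'.1 = c • z.1 - d • z.2 ∧
      z'.2 = c • z.2 + d • (z.1 - z.2) := by
    obtain ⟨w, hw⟩ := hJ (EuclideanSpace.single 0 1)
    rw [hz, hLv] at hw
    -- Otherwise Jz would be a real multiple of z, against J² = -1.
    have hw1 : w 1 ≠ 0 := by
      intro h0
      rw [h0, zero_smul, add_zero] at hw
      have h1 := J_J z
      rw [hw, J_smul, hw, smul_smul] at h1
      have h2 : (w 0 * w 0 + 1) • z = 0 := by rw [add_smul, h1]; simp
      rcases smul_eq_zero.1 h2 with h | h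
      · nlinarith [mul_self_nonneg (w 0)]
      · exact hz0 h
    have h3 : 1 / √3 ≠ 0 := by positivity
    simp only [J] at hw
    generalize 1 / √3 = r at *
    have e1 := congrArg Prod.fst hw
    have e2 := congrArg Prod.snd hw
    simp only [Prod.fst_add, Prod.snd_add, Prod.smul_fst, Prod.smul_snd] at e1 e2
    -- Solve Jz = w₀z + w₁z' for z', using J = r(1 + 2K) with r = 1/√3.
    refine ⟨(r - w 0) / w 1, 2 * r / w 1, div_ne_zero (mul_ne_zero two_ne_zero h3) hw1, ?_, ?_⟩
    · have : z'.1 = (w 1)⁻¹ • (w 1 • z'.1) := by rw [smul_smul, inv_mul_cancel₀ hw1, one_smul]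
      rw [this, eq_sub_of_add_eq' e1.symm]
      module
    · have : z'.2 = (w 1)⁻¹ • (w 1 • z'.2) := by rw [smul_smul, inv_mul_cancel₀ hw1, one_smul]
      rw [this, eq_sub_of_add_eq' e2.symm]
      module
  refine ⟨hnull, ?_, hspan⟩
  rintro ⟨h1, h2⟩
  rw [h1, h2, add_zero] at hnull
  obtain ⟨t1, t2⟩ := htr (EuclideanSpace.single 0 1)
  rw [hz] at t1 t2
  -- If both norms vanish, nullity makes the components orthogonal as well, hence multiples of one
  -- matrix ε. The plane is then all of {(Xε, Yε)}, which P preserves, a contradiction.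
  obtain ⟨ε, x, y, hx, hy⟩ : ∃ (ε : Mat2) (x y : ℝ), z.1 = x • ε ∧ z.2 = y • ε := by
    by_cases h0 : z.1 = 0
    · exact ⟨z.2, 0, 1, by simp [h0], by simp⟩
    · obtain ⟨r, hr⟩ := exists_smul_of_null t1 t2 h1 h2 hnull h0
      exact ⟨z.1, 1, r, by simp, hr⟩
  obtain ⟨c, d, hd, e1, e2⟩ := hspan
  have hN : x ^ 2 - x * y + y ^ 2 ≠ 0 := by
    intro h0
    have hy0 : y = 0 := by nlinarith [sq_nonneg (2 * x - y), sq_nonneg y]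
    have hx0 : x = 0 := by
      rw [hy0] at h0
      simpa using h0
    exact hz0 (Prod.ext (by rw [hx, hx0]; simp) (by rw [hy, hy0]; simp))
  -- Solve (X, Y) = (k + lK)(x, y), which is possible because |x + yK|² = x² - xy + y² is nonzero.
  have hmem : ∀ X Y : ℝ, ∃ w, (X • ε, Y • ε) = L w := fun X Y => by
    have hk := inv_mul_cancel₀ hN
    have hk' := inv_mul_cancel₀ hd
    set r := (x ^ 2 - x * y + y ^ 2)⁻¹
    set k := r * (X * (x - y) + Y * y)
    set l := r * (Y * x - X * y)
    refine ⟨(k - l * d⁻¹ * c) • EuclideanSpace.single 0 1 + (l * d⁻¹) • EuclideanSpace.single 1 1, ?_⟩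
    rw [map_add, map_smul, map_smul, hz, hz']
    have q : l = l * d⁻¹ * d := by rw [mul_assoc, hk', mul_one]
    ext i j
    · simp only [Prod.fst_add, Prod.smul_fst, e1, hx, hy, Matrix.add_apply, Matrix.smul_apply,
        Matrix.sub_apply, smul_eq_mul]
      linear_combination (-X * ε i j) * hk - y * ε i j * q
    · simp only [Prod.snd_add, Prod.smul_snd, e2, hx, hy, Matrix.add_apply, Matrix.smul_apply,
        Matrix.sub_apply, smul_eq_mul]
      linear_combination (-Y * ε i j) * hk + (x - y) * ε i j * q
  apply hP
  intro v
  have : P (L v) = ((v 0 * y + v 1 * (c * y + d * (x - y))) • ε,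
      (v 0 * x + v 1 * (c * x - d * y)) • ε) := by
    rw [hLv]
    simp only [P, Prod.snd_add, Prod.smul_snd, Prod.fst_add, Prod.smul_fst, e1, e2, hx, hy,
      Prod.mk.injEq]
    constructor <;> module
  rw [this]
  exact hmem _ _

/-! ### Transfer between the surface and its charts -/

section Transfer

variable {M : Type*} [TopologicalSpace M] [ChartedSpace Plane M] [IsManifold 𝓘(ℝ, Plane) ∞ M]
  {V : Type*} [NormedAddCommGroup V] [NormedSpace ℝ V] {e : OpenPartialHomeomorph M Plane}

/-- The differential of the inverse of a chart. -/
noncomputable def chartInvDeriv (e : OpenPartialHomeomorph M Plane) (y : Plane) :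
    Plane →L[ℝ] TangentSpace 𝓘(ℝ, Plane) (e.symm y) :=
  mfderiv 𝓘(ℝ, Plane) 𝓘(ℝ, Plane) e.symm y

theorem mdifferentiable_of_mem (he : e ∈ IsManifold.maximalAtlas 𝓘(ℝ, Plane) ∞ M) :
    e.MDifferentiable 𝓘(ℝ, Plane) 𝓘(ℝ, Plane) :=
  ⟨(contMDiffOn_of_mem_maximalAtlas he).mdifferentiableOn (by simp),
    (contMDiffOn_symm_of_mem_maximalAtlas he).mdifferentiableOn (by simp)⟩

theorem chartInvDeriv_bijective (he : e ∈ IsManifold.maximalAtlas 𝓘(ℝ, Plane) ∞ M) {y : Plane}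
    (hy : y ∈ e.target) : Function.Bijective (chartInvDeriv e y) :=
  ((mdifferentiable_of_mem he).symm.mfderiv hy).bijective

theorem contDiffOn_comp_chart (he : e ∈ IsManifold.maximalAtlas 𝓘(ℝ, Plane) ∞ M) {u : M → V}
    {U : Set M} (hu : SmoothOn u U) :
    ContDiffOn ℝ ∞ (fun y => u (e.symm y)) (e.target ∩ e.symm ⁻¹' U) := by
  rw [← contMDiffOn_iff_contDiffOn]
  exact ContMDiffOn.comp hu ((contMDiffOn_symm_of_mem_maximalAtlas he).mono Set.inter_subset_left)
    fun y hy => hy.2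

theorem isOpen_chart_preimage {U : Set M} (hU : IsOpen U) : IsOpen (e.target ∩ e.symm ⁻¹' U) :=
  e.symm.isOpen_inter_preimage hU

theorem smoothOn_comp_chart (he : e ∈ IsManifold.maximalAtlas 𝓘(ℝ, Plane) ∞ M) {u : Plane → V}
    {O : Set Plane} (hu : ContDiffOn ℝ ∞ u O) :
    SmoothOn (fun x => u (e x)) (e.source ∩ e ⁻¹' O) :=
  ContMDiffOn.comp hu.contMDiffOn
    ((contMDiffOn_of_mem_maximalAtlas he).mono Set.inter_subset_left) fun _ hx => hx.2

theorem SmoothOn.mdifferentiableAt {u : M → V} {U : Set M} (hu : SmoothOn u U) (hU : IsOpen U)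
    {x : M} (hx : x ∈ U) : MDifferentiableAt 𝓘(ℝ, Plane) 𝓘(ℝ, V) u x :=
  (ContMDiffOn.contMDiffAt hu (hU.mem_nhds hx)).mdifferentiableAt (by simp)

theorem fderiv_comp_chart (he : e ∈ IsManifold.maximalAtlas 𝓘(ℝ, Plane) ∞ M) {u : M → V}
    {U : Set M} (hU : IsOpen U) (hu : SmoothOn u U) {y : Plane} (hy : y ∈ e.target)
    (hyU : e.symm y ∈ U) (w : Plane) :
    fderiv ℝ (fun z => u (e.symm z)) y w = dirDeriv u (e.symm y) (chartInvDeriv e y w) := by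
  have h1 := hu.mdifferentiableAt hU hyU
  have h2 : MDifferentiableAt 𝓘(ℝ, Plane) 𝓘(ℝ, Plane) e.symm y :=
    (mdifferentiable_of_mem he).mdifferentiableAt_symm hy
  have := mfderiv_comp y h1 h2
  rw [mfderiv_eq_fderiv] at this
  change fderiv ℝ (u ∘ e.symm) y w = _
  rw [this]
  rfl

theorem dirDeriv_congr {u v : M → V} {U : Set M} (hU : IsOpen U) (h : ∀ x ∈ U, u x = v x) {x : M}
    (hx : x ∈ U) (w : TangentSpace 𝓘(ℝ, Plane) x) : dirDeriv u x w = dirDeriv v x w := by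
  have : u =ᶠ[𝓝 x] v := by filter_upwards [hU.mem_nhds hx] with z hz using h z hz
  exact congrArg (fun L : Plane →L[ℝ] V => L w) this.mfderiv_eq

theorem dirDeriv_comp_chart (he : e ∈ IsManifold.maximalAtlas 𝓘(ℝ, Plane) ∞ M) {u : Plane → V}
    {O : Set Plane} (hO : IsOpen O) (hOe : O ⊆ e.target) (hu : ContDiffOn ℝ ∞ u O) {y : Plane}
    (hy : y ∈ O) (w : Plane) :
    dirDeriv (fun x => u (e x)) (e.symm y) (chartInvDeriv e y w) = fderiv ℝ u y w := by
  rw [← fderiv_comp_chart he (e.isOpen_inter_preimage hO) (smoothOn_comp_chart he hu) (hOe hy)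
    ⟨e.map_target (hOe hy), by simpa [e.right_inv (hOe hy)] using hy⟩]
  have : (fun z => u (e (e.symm z))) =ᶠ[𝓝 y] u := by
    filter_upwards [hO.mem_nhds hy] with z hz
    rw [e.right_inv (hOe hz)]
  rw [this.fderiv_eq]

theorem pd_comp_chart (he : e ∈ IsManifold.maximalAtlas 𝓘(ℝ, Plane) ∞ M) {u : M → V}
    {U : Set M} (hU : IsOpen U) (hu : SmoothOn u U) {y : Plane} (hy : y ∈ e.target)
    (hyU : e.symm y ∈ U) (i : Fin 2) :
    pd i (fun z => u (e.symm z)) y =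
      dirDeriv u (e.symm y) (chartInvDeriv e y (EuclideanSpace.single i 1)) :=
  fderiv_comp_chart he hU hu hy hyU _

theorem dirDeriv_add (u : M → V) (x : M) (v w : TangentSpace 𝓘(ℝ, Plane) x) :
    dirDeriv u x (v + w) = dirDeriv u x v + dirDeriv u x w :=
  (mfderiv 𝓘(ℝ, Plane) 𝓘(ℝ, V) u x).map_add v w

theorem dirDeriv_smul (u : M → V) (x : M) (r : ℝ) (v : TangentSpace 𝓘(ℝ, Plane) x) :
    dirDeriv u x (r • v) = r • dirDeriv u x v :=
  (mfderiv 𝓘(ℝ, Plane) 𝓘(ℝ, V) u x).map_smul r v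

theorem exists_chart (x : M) : ∃ e ∈ IsManifold.maximalAtlas 𝓘(ℝ, Plane) ∞ M,
    ∃ y ∈ e.target, e.symm y = x :=
  ⟨chartAt Plane x, IsManifold.chart_mem_maximalAtlas x, chartAt Plane x x,
    mem_chart_target Plane x, (chartAt Plane x).left_inv (mem_chart_source Plane x)⟩

theorem omega_add (F : M → SL2 × SL2) (x : M) (v w : TangentSpace 𝓘(ℝ, Plane) x) :
    omega F x (v + w) = omega F x v + omega F x w := by
  refine Prod.ext ?_ ?_
  · simp only [omega, diff, Prod.fst_add]
    rw [dirDeriv_add, mul_add]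
  · simp only [omega, diff, Prod.snd_add]
    rw [dirDeriv_add, mul_add]

theorem omega_smul (F : M → SL2 × SL2) (x : M) (r : ℝ) (v : TangentSpace 𝓘(ℝ, Plane) x) :
    omega F x (r • v) = r • omega F x v := by
  refine Prod.ext ?_ ?_
  · simp only [omega, diff, Prod.smul_fst]
    rw [dirDeriv_smul, mul_smul_comm]
  · simp only [omega, diff, Prod.smul_snd]
    rw [dirDeriv_smul, mul_smul_comm]

/-- The left-translated differential as a linear map. -/
noncomputable def omegaLin (F : M → SL2 × SL2) (x : M) : Plane →ₗ[ℝ] Mat2 × Mat2 where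
  toFun v := omega F x v
  map_add' := omega_add F x
  map_smul' := omega_smul F x

/-- Derivative of the equation ⟨f, f⟩ = -det f = -1: the left-translated differential is traceless.
-/
theorem ip_leftTranslated_one {f : M → SL2} (hf : IsSmooth f) (x : M)
    (v : TangentSpace 𝓘(ℝ, Plane) x) : ip (((f x)⁻¹ : SL2) * diff f x v) 1 = 0 := by
  obtain ⟨e, he, y, hy, rfl⟩ := exists_chart x
  obtain ⟨w, rfl⟩ := (chartInvDeriv_bijective he hy).2 v
  have d := diffAt (contDiffOn_comp_chart he hf) (isOpen_chart_preimage isOpen_univ) ⟨hy, trivial⟩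
  have hc : ∀ i, ip (toMat f (e.symm y)) (pd i (fun z => toMat f (e.symm z)) y) = 0 := fun i => by
    have h0 : pd i (fun z => ip (toMat f (e.symm z)) (toMat f (e.symm z))) y = 0 :=
      pd_eq_zero isOpen_univ (c := -1) (fun z _ => by rw [ip_self, toMat, (f _).det_coe]) trivial i
    rw [pd_ip d d, ip_comm (pd i _ _)] at h0
    linarith
  rw [← SL2_ip_mul (f (e.symm y)), SL2_mul_inv, mul_one, diff,
    ← fderiv_comp_chart he isOpen_univ hf hy trivial, fderiv_eq_pd, ip_comm, ip_add_right,
    ip_smul_right, ip_smul_right]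
  have h0 := hc 0
  have h1 := hc 1
  simp only [toMat] at h0 h1 ⊢
  rw [h0, h1]; ring

end Transfer

/-! ### Local frames on the surface -/

section Frames

variable {M : Type*} [TopologicalSpace M] [ChartedSpace Plane M] [IsManifold 𝓘(ℝ, Plane) ∞ M]

/-- The left-translated pair with coordinates `s`, `t` in the frame `α`, `β`. -/
def framePair (α β : Mat2) (s t : ℝ) : Mat2 × Mat2 :=
  (s • α - t • β, s • β + t • (α - β))

/-- A local frame `(α, β)` of the left-translated differential of `F`, with structure constants
`m` and `n`. -/
structure LocalFrame (F : M → SL2 × SL2) (U : Set M) (α β : M → Mat2) (m n : ℝ) : Prop where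
  isOpen : IsOpen U
  smooth_α : SmoothOn α U
  smooth_β : SmoothOn β U
  gram : ∀ x ∈ U, IsGramPair (α x) (β x)
  quad : m ^ 2 - m * n + n ^ 2 - m + n = 0
  deriv : ∀ x ∈ U, ∀ v : TangentSpace 𝓘(ℝ, Plane) x, ∃ s t : ℝ,
    omega F x v = framePair (α x) (β x) s t ∧
    dirDeriv α x v = (m * s - (1 + n) * t) • comm (α x) (β x) ∧
    dirDeriv β x v = (n * s + (m - n - 1) * t) • comm (α x) (β x)
  surj : ∀ x ∈ U, ∀ s t : ℝ, ∃ v : TangentSpace 𝓘(ℝ, Plane) x,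
    omega F x v = framePair (α x) (β x) s t

theorem IsAdaptedCoframe.mono {O O' : Set Plane} {a b : Fin 2 → Plane → Mat2}
    {α β : Plane → Mat2} {s t : Fin 2 → Plane → ℝ} (h : IsAdaptedCoframe O a b α β s t)
    (hO : O' ⊆ O) : IsAdaptedCoframe O' a b α β s t where
  smooth_α := h.smooth_α.mono hO
  smooth_β := h.smooth_β.mono hO
  smooth_s i := (h.smooth_s i).mono hO
  smooth_t i := (h.smooth_t i).mono hO
  gram y hy := h.gram y (hO hy)
  fst y hy := h.fst y (hO hy)
  snd y hy := h.snd y (hO hy)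
  det_ne y hy := h.det_ne y (hO hy)

/-- The left-translated differential of a map to `SL(2,ℝ)`, in a chart. -/
noncomputable def chartForm (f : M → SL2) (e : OpenPartialHomeomorph M Plane) (i : Fin 2)
    (y : Plane) : Mat2 :=
  (((f (e.symm y))⁻¹ : SL2) : Mat2) *
    diff f (e.symm y) (chartInvDeriv e y (EuclideanSpace.single i 1))

variable {e : OpenPartialHomeomorph M Plane} {f : M → SL2}

theorem pd_localRep (he : e ∈ IsManifold.maximalAtlas 𝓘(ℝ, Plane) ∞ M) (hf : IsSmooth f)
    {y : Plane} (hy : y ∈ e.target) (i : Fin 2) :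
    pd i (localRep f e) y = localRep f e y * chartForm f e i y := by
  rw [localRep, chartForm, SL2_mul_inv]
  exact pd_comp_chart he isOpen_univ hf hy trivial i

theorem contDiffOn_localRep (he : e ∈ IsManifold.maximalAtlas 𝓘(ℝ, Plane) ∞ M) (hf : IsSmooth f) :
    ContDiffOn ℝ ∞ (localRep f e) e.target :=
  (contDiffOn_comp_chart he hf).mono fun _ hy => ⟨hy, trivial⟩

theorem contDiffOn_chartForm (he : e ∈ IsManifold.maximalAtlas 𝓘(ℝ, Plane) ∞ M) (hf : IsSmooth f)
    (i : Fin 2) : ContDiffOn ℝ ∞ (chartForm f e i) e.target := by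
  have h := contDiffOn_localRep he hf
  refine (contDiffOn_matMul (adjCLM.contDiff.comp_contDiffOn h)
    (contDiffOn_pd e.open_target h i)).congr fun y hy => ?_
  rw [pd_localRep he hf hy]
  exact ((congrArg (· * (localRep f e y * chartForm f e i y)) (adjCLM_coe _)).trans
    (SL2_inv_mul _ _)).symm

theorem maurerCartan_chartForm (he : e ∈ IsManifold.maximalAtlas 𝓘(ℝ, Plane) ∞ M)
    (hf : IsSmooth f) : MaurerCartan e.target (chartForm f e) :=
  maurerCartan_of_leftTranslation e.open_target (contDiffOn_localRep he hf)
    (fun y _ => ⟨f (e.symm y), rfl⟩) (contDiffOn_chartForm he hf)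
    fun _ hy i => pd_localRep he hf hy i

theorem plane_eq (w : Plane) :
    w = w 0 • EuclideanSpace.single 0 (1 : ℝ) + w 1 • EuclideanSpace.single 1 (1 : ℝ) := by
  ext i; fin_cases i <;> simp

variable {F : M → SL2 × SL2}

theorem omega_chart (F : M → SL2 × SL2) (e : OpenPartialHomeomorph M Plane) (y w : Plane) :
    omega F (e.symm y) (chartInvDeriv e y w) =
      (w 0 • chartForm (fstMap F) e 0 y + w 1 • chartForm (fstMap F) e 1 y,
        w 0 • chartForm (sndMap F) e 0 y + w 1 • chartForm (sndMap F) e 1 y) := by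
  conv_lhs => rw [plane_eq w]
  rw [map_add, map_smul, map_smul, omega_add, omega_smul, omega_smul]
  rfl

theorem exists_localFrame (hF : IsDegenerateAlmostComplex F)
    (hP : ∀ x, ¬ PPreservesTangentAt F x) (x₀ : M) :
    ∃ U, x₀ ∈ U ∧ ∃ α β m n, LocalFrame F U α β m n := by
  obtain ⟨e, he, y₀, hy₀, rfl⟩ := exists_chart x₀
  let a := chartForm (fstMap F) e
  let b := chartForm (sndMap F) e
  have sa := contDiffOn_chartForm he hF.smooth_fst
  have sb := contDiffOn_chartForm he hF.smooth_snd
  have hplane : ∀ y ∈ e.target, ip (a 0 y) (b 0 y) = ip (a 0 y) (a 0 y) + ip (b 0 y) (b 0 y) ∧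
      ¬ (ip (a 0 y) (a 0 y) = 0 ∧ ip (b 0 y) (b 0 y) = 0) ∧
      ∃ c d : ℝ, d ≠ 0 ∧ a 1 y = c • a 0 y - d • b 0 y ∧
        b 1 y = c • b 0 y + d • (a 0 y - b 0 y) := by
    intro y hy
    have hb := chartInvDeriv_bijective he hy
    refine degenerate_plane (omegaLin F (e.symm y) ∘ₗ
        (show Plane →L[ℝ] Plane from chartInvDeriv e y).toLinearMap)
      ((hF.immersion (e.symm y)).comp hb.1) (fun v => ?_) (fun v => hF.degenerate _ _ _)
      (fun v => ⟨ip_leftTranslated_one hF.smooth_fst _ _, ip_leftTranslated_one hF.smooth_snd _ _⟩)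
      (fun h => hP (e.symm y) fun v => ?_) (z := (a 0 y, b 0 y)) (z' := (a 1 y, b 1 y)) rfl rfl
    · obtain ⟨w, hw⟩ := hF.almostComplex (e.symm y) (chartInvDeriv e y v)
      obtain ⟨w', rfl⟩ := hb.2 w
      exact ⟨w', hw⟩
    · obtain ⟨v', rfl⟩ := hb.2 v
      obtain ⟨w, hw⟩ := h v'
      exact ⟨chartInvDeriv e y w, hw⟩
  obtain ⟨O', hsub, hO', hy', α, β, s, t, hco⟩ := exists_adaptedCoframe e.open_target sa sb
    (fun y hy => ip_leftTranslated_one hF.smooth_fst _ _)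
    (fun y hy => ip_leftTranslated_one hF.smooth_snd _ _)
    (fun y hy => (hplane y hy).1) (fun y hy => (hplane y hy).2.1)
    (fun y hy => (hplane y hy).2.2) hy₀
  -- Constancy of m and n in `second_order` needs a connected domain, so the chart is shrunk to a
  -- ball.
  obtain ⟨r, hr, hball⟩ := Metric.isOpen_iff.1 hO' y₀ hy'
  set B := Metric.ball y₀ r
  have hB : IsOpen B := Metric.isOpen_ball
  have hBt : B ⊆ e.target := hball.trans hsub
  replace hco := hco.mono hball
  have hyB : y₀ ∈ B := Metric.mem_ball_self hr
  obtain ⟨m, n, hq, hd⟩ := hco.second_order hB (convex_ball y₀ r).isPreconnected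
    (fun y hy => maurerCartan_chartForm he hF.smooth_fst y (hBt hy))
    (fun y hy => maurerCartan_chartForm he hF.smooth_snd y (hBt hy)) hyB
  have hU : ∀ x ∈ e.source ∩ e ⁻¹' B, ∃ y ∈ B, e.symm y = x := fun x hx =>
    ⟨e x, hx.2, e.left_inv hx.1⟩
  refine ⟨e.source ∩ e ⁻¹' B, ⟨e.map_target hy₀, by simpa [e.right_inv hy₀] using hyB⟩,
    fun x => α (e x), fun x => β (e x), m, n, e.isOpen_inter_preimage hB,
    smoothOn_comp_chart he hco.smooth_α, smoothOn_comp_chart he hco.smooth_β,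
    fun x hx => hco.gram _ hx.2, hq, fun x hx v => ?_, fun x hx S T => ?_⟩
  · obtain ⟨y, hy, rfl⟩ := hU x hx
    obtain ⟨w, rfl⟩ := (chartInvDeriv_bijective he (hBt hy)).2 v
    refine ⟨w 0 * s 0 y + w 1 * s 1 y, w 0 * t 0 y + w 1 * t 1 y, ?_, ?_, ?_⟩
    · rw [omega_chart, hco.fst y hy, hco.fst y hy, hco.snd y hy, hco.snd y hy,
        e.right_inv (hBt hy), framePair]
      refine Prod.ext ?_ ?_ <;> simp only <;> module
    · rw [dirDeriv_comp_chart he hB hBt hco.smooth_α hy, fderiv_eq_pd, (hd y hy 0).1,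
        (hd y hy 1).1, e.right_inv (hBt hy)]
      module
    · rw [dirDeriv_comp_chart he hB hBt hco.smooth_β hy, fderiv_eq_pd, (hd y hy 0).2,
        (hd y hy 1).2, e.right_inv (hBt hy)]
      module
  · obtain ⟨y, hy, rfl⟩ := hU x hx
    have hΔ := inv_mul_cancel₀ (hco.det_ne y hy)
    set D := (s 0 y * t 1 y - s 1 y * t 0 y)⁻¹
    -- Cramer's rule for prescribed values S, T of the coframe.
    refine ⟨chartInvDeriv e y !₂[(S * t 1 y - T * s 1 y) * D, (T * s 0 y - S * t 0 y) * D], ?_⟩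
    have e1 : (S * t 1 y - T * s 1 y) * D * s 0 y + (T * s 0 y - S * t 0 y) * D * s 1 y = S := by
      linear_combination S * hΔ
    have e2 : (S * t 1 y - T * s 1 y) * D * t 0 y + (T * s 0 y - S * t 0 y) * D * t 1 y = T := by
      linear_combination T * hΔ
    rw [omega_chart, hco.fst y hy, hco.fst y hy, hco.snd y hy, hco.snd y hy,
      e.right_inv (hBt hy), framePair]
    conv_rhs => rw [← e1, ← e2]
    refine Prod.ext ?_ ?_ <;> simp <;> module

end Frames

/-! ### Uniqueness of frames up to sign, global structure constants, exchange of the factors -/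

section Uniqueness

variable {M : Type*} [TopologicalSpace M] [ChartedSpace Plane M] [IsManifold 𝓘(ℝ, Plane) ∞ M]
  {V W Z : Type*} [NormedAddCommGroup V] [NormedSpace ℝ V] [NormedAddCommGroup W]
  [NormedSpace ℝ W] [NormedAddCommGroup Z] [NormedSpace ℝ Z]

theorem dirDeriv_bilin (B : V →L[ℝ] W →L[ℝ] Z) {u : M → V} {w : M → W} {U : Set M}
    (hU : IsOpen U) (hu : SmoothOn u U) (hw : SmoothOn w U) {x : M} (hx : x ∈ U)
    (v : TangentSpace 𝓘(ℝ, Plane) x) :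
    dirDeriv (fun z => B (u z) (w z)) x v =
      B (u x) (dirDeriv w x v) + B (dirDeriv u x v) (w x) := by
  obtain ⟨e, he, y, hy, rfl⟩ := exists_chart x
  obtain ⟨v, rfl⟩ := (chartInvDeriv_bijective he hy).2 v
  have hB : SmoothOn (fun z => B (u z) (w z)) U :=
    B.isBoundedBilinearMap.contDiff.contMDiff.comp_contMDiffOn (hu.prodMk_space hw)
  have du := diffAt (contDiffOn_comp_chart he hu) (isOpen_chart_preimage hU) ⟨hy, hx⟩
  have dw := diffAt (contDiffOn_comp_chart he hw) (isOpen_chart_preimage hU) ⟨hy, hx⟩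
  rw [← fderiv_comp_chart he hU hB hy hx, ← fderiv_comp_chart he hU hu hy hx,
    ← fderiv_comp_chart he hU hw hy hx, B.fderiv_of_bilinear du dw]
  simp

theorem dirDeriv_const_smul {u : M → V} {U : Set M} (hU : IsOpen U) (hu : SmoothOn u U) {x : M}
    (hx : x ∈ U) (r : ℝ) (v : TangentSpace 𝓘(ℝ, Plane) x) :
    dirDeriv (fun z => r • u z) x v = r • dirDeriv u x v := by
  obtain ⟨e, he, y, hy, rfl⟩ := exists_chart x
  obtain ⟨v, rfl⟩ := (chartInvDeriv_bijective he hy).2 v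
  have hB : SmoothOn (fun z => r • u z) U := (contDiff_const_smul r).contMDiff.comp_contMDiffOn hu
  have du := diffAt (contDiffOn_comp_chart he hu) (isOpen_chart_preimage hU) ⟨hy, hx⟩
  rw [← fderiv_comp_chart he hU hB hy hx, ← fderiv_comp_chart he hU hu hy hx,
    fderiv_fun_const_smul du]
  rfl

theorem smoothOn_matMul {u w : M → Mat2} {U : Set M} (hu : SmoothOn u U) (hw : SmoothOn w U) :
    SmoothOn (fun z => u z * w z) U :=
  mulCLM.isBoundedBilinearMap.contDiff.contMDiff.comp_contMDiffOn (hu.prodMk_space hw)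

theorem smoothOn_comm {u w : M → Mat2} {U : Set M} (hu : SmoothOn u U) (hw : SmoothOn w U) :
    SmoothOn (fun z => comm (u z) (w z)) U :=
  ContMDiffOn.sub (smoothOn_matMul hu hw) (smoothOn_matMul hw hu)

theorem continuousOn_ip {u w : M → Mat2} {U : Set M} (hu : ContinuousOn u U)
    (hw : ContinuousOn w U) : ContinuousOn (fun z => ip (u z) (w z)) U :=
  ipCLM.isBoundedBilinearMap.continuous.comp_continuousOn (hu.prodMk hw)

theorem framePair_one_zero (α β : Mat2) : framePair α β 1 0 = (α, β) := by
  simp [framePair]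

theorem framePair_zero_one (α β : Mat2) : framePair α β 0 1 = (-β, α - β) := by
  simp [framePair]

theorem framePair_smul (α β : Mat2) (r s t : ℝ) :
    framePair (r • α) (r • β) s t = framePair α β (r * s) (r * t) := by
  refine Prod.ext ?_ ?_ <;> simp only [framePair] <;> module

theorem IsGramPair.framePair_inj {α β : Mat2} (h : IsGramPair α β) {s t s' t' : ℝ}
    (e : framePair α β s t = framePair α β s' t') : s = s' ∧ t = t' := by
  have e1 := congrArg Prod.fst e
  simp only [framePair] at e1
  have e2 : s • α + (-t) • β = s' • α + (-t') • β := by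
    rw [neg_smul, neg_smul, ← sub_eq_add_neg, ← sub_eq_add_neg, e1]
  obtain ⟨q1, q2⟩ := h.coeff_eq e2
  exact ⟨q1, neg_injective q2⟩

/-- Two Gram pairs in the same complex line agree up to sign. -/
theorem IsGramPair.eq_or_neg {α β : Mat2} (h : IsGramPair α β) {s t : ℝ}
    (h' : IsGramPair (framePair α β s t).1 (framePair α β s t).2) :
    t = 0 ∧ (s = 1 ∨ s = -1) := by
  have e1 := h'.aa
  have e2 := h'.bb
  simp only [framePair, ip_add_left, ip_sub_left, ip_smul_left, ip_add_right, ip_sub_right,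
    ip_smul_right, h.aa, h.bb, h.ab, h.ba] at e1 e2
  have ht : t = 0 := by
    have e3 : t * (t - 2 * s) = 0 := by linarith
    rcases mul_eq_zero.1 e3 with h0 | h0
    · exact h0
    -- Here s + tK is s(1 + 2K), a multiple of J, which reverses the sign of the norms.
    · have h2 : t = 2 * s := by linarith
      rw [h2] at e1
      nlinarith [sq_nonneg s]
  refine ⟨ht, ?_⟩
  rw [ht] at e1
  exact mul_self_eq_one_iff.1 (by linarith)

/-- Continuous Gram pairs that agree up to sign agree locally up to a constant sign. -/
theorem exists_local_sign {α β α' β' : M → Mat2} {U : Set M} (hU : IsOpen U)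
    (hα : ContinuousOn α U) (hα' : ContinuousOn α' U) (hg : ∀ x ∈ U, IsGramPair (α x) (β x))
    (h : ∀ x ∈ U, ∃ r : ℝ, (r = 1 ∨ r = -1) ∧ α' x = r • α x ∧ β' x = r • β x) {x : M}
    (hx : x ∈ U) : ∃ U' ⊆ U, IsOpen U' ∧ x ∈ U' ∧ ∃ r : ℝ, (r = 1 ∨ r = -1) ∧
      ∀ z ∈ U', α' z = r • α z ∧ β' z = r • β z := by
  have hc := continuousOn_ip hα' hα
  obtain ⟨r, hr, e1, -⟩ := h x hx
  refine ⟨U ∩ (fun z => r * ip (α' z) (α z)) ⁻¹' Set.Ioi 0, Set.inter_subset_left,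
    (continuousOn_const.mul hc).isOpen_inter_preimage hU isOpen_Ioi, ⟨hx, ?_⟩, r, hr, ?_⟩
  · simp only [Set.mem_preimage, Set.mem_Ioi, e1, ip_smul_left, (hg x hx).aa]
    rcases hr with rfl | rfl <;> norm_num
  · rintro z ⟨hz, hz'⟩
    obtain ⟨r', hr', e2, e3⟩ := h z hz
    simp only [Set.mem_preimage, Set.mem_Ioi, e2, ip_smul_left, (hg z hz).aa] at hz'
    have : r = r' := by
      rcases hr with rfl | rfl <;> rcases hr' with rfl | rfl <;> first | rfl | norm_num at hz'
    rw [this]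
    exact ⟨e2, e3⟩

variable {F : M → SL2 × SL2} {U U' : Set M} {α β α' β' : M → Mat2} {m n m' n' : ℝ}

theorem SmoothOn.continuousOn {u : M → V} (hu : SmoothOn u U) : ContinuousOn u U :=
  ContMDiffOn.continuousOn hu

theorem SmoothOn.mono {u : M → V} (hu : SmoothOn u U) (h : U' ⊆ U) : SmoothOn u U' :=
  ContMDiffOn.mono hu h

theorem LocalFrame.sign (h : LocalFrame F U α β m n) (h' : LocalFrame F U' α' β' m' n') {x : M}
    (hx : x ∈ U) (hx' : x ∈ U') :
    ∃ r : ℝ, (r = 1 ∨ r = -1) ∧ α' x = r • α x ∧ β' x = r • β x := by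
  obtain ⟨v, hv⟩ := h'.surj x hx' 1 0
  obtain ⟨s, t, e, -⟩ := h.deriv x hx v
  have hp : (α' x, β' x) = framePair (α x) (β x) s t := by
    rw [← e, hv, framePair_one_zero]
  have g' := h'.gram x hx'
  have g1 : IsGramPair (framePair (α x) (β x) s t).1 (framePair (α x) (β x) s t).2 := by
    rw [← hp]; exact g'
  obtain ⟨rfl, hs⟩ := (h.gram x hx).eq_or_neg g1
  refine ⟨s, hs, ?_, ?_⟩
  · have := congrArg Prod.fst hp
    simpa [framePair] using this
  · have := congrArg Prod.snd hp
    simpa [framePair] using this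

/-- A change of sign of (α, β) also changes s and t but fixes [α, β], so the equations defining m
and n are unchanged. Locally constant signs are needed in order to differentiate the relation
between the two frames. -/
theorem LocalFrame.constants_eq (h : LocalFrame F U α β m n) (h' : LocalFrame F U' α' β' m' n')
    {x : M} (hx : x ∈ U) (hx' : x ∈ U') : m' = m ∧ n' = n := by
  obtain ⟨W, hW, oW, hxW, r, hr, hs⟩ := exists_local_sign (h.isOpen.inter h'.isOpen)
    ((h.smooth_α.mono Set.inter_subset_left).continuousOn)
    ((h'.smooth_α.mono Set.inter_subset_right).continuousOn)
    (fun z hz => h.gram z hz.1) (fun z hz => h.sign h' hz.1 hz.2) ⟨hx, hx'⟩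
  -- This vector has coordinates (r, 0) in the first frame and (1, 0) in the second, so the
  -- derivatives of the frames in its direction isolate m and n.
  obtain ⟨v, hv⟩ := h.surj x hx r 0
  obtain ⟨s, t, e, dα, dβ⟩ := h.deriv x hx v
  obtain ⟨s', t', e', dα', dβ'⟩ := h'.deriv x hx' v
  have g := h.gram x hx
  have hr2 : r * r = 1 := by rcases hr with rfl | rfl <;> norm_num
  obtain ⟨q1, q2⟩ := g.framePair_inj (hv.symm.trans e)
  rw [(hs x hxW).1, (hs x hxW).2, framePair_smul] at e'
  obtain ⟨q3, q4⟩ := g.framePair_inj (hv.symm.trans e')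
  have hr0 : r ≠ 0 := by rintro rfl; norm_num at hr2
  have ht' : t' = 0 := (mul_eq_zero.1 q4.symm).resolve_left hr0
  have hs' : s' = 1 := by
    apply mul_left_cancel₀ hr0
    rw [mul_one, ← q3]
  subst q1 q2 ht' hs'
  have hκ : comm (α' x) (β' x) = comm (α x) (β x) := by
    rw [(hs x hxW).1, (hs x hxW).2, comm_smul_left, comm_smul_right, smul_smul, hr2, one_smul]
  rw [dirDeriv_congr oW (fun z hz => (hs z hz).1) hxW,
    dirDeriv_const_smul oW (h.smooth_α.mono fun z hz => (hW hz).1) hxW, dα, hκ, smul_smul] at dα'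
  rw [dirDeriv_congr oW (fun z hz => (hs z hz).2) hxW,
    dirDeriv_const_smul oW (h.smooth_β.mono fun z hz => (hW hz).1) hxW, dβ, hκ, smul_smul] at dβ'
  have k1 := smul_left_injective ℝ g.comm_ne_zero dα'
  have k2 := smul_left_injective ℝ g.comm_ne_zero dβ'
  constructor
  · linear_combination m * hr2 - k1
  · linear_combination n * hr2 - k2

/-- The constants of overlapping frames agree, so they are locally constant on a connected surface.
-/
theorem exists_structure_constants [ConnectedSpace M] (hF : IsDegenerateAlmostComplex F)
    (hP : ∀ x, ¬ PPreservesTangentAt F x) :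
    ∃ m n : ℝ, ∀ x : M, ∃ U, x ∈ U ∧ ∃ α β, LocalFrame F U α β m n := by
  choose U hU α β m n hfr using exists_localFrame hF hP
  have hc : IsLocallyConstant fun x => (m x, n x) := by
    rw [IsLocallyConstant.iff_exists_open]
    intro x
    refine ⟨U x, (hfr x).isOpen, hU x, fun z hz => ?_⟩
    obtain ⟨e1, e2⟩ := (hfr x).constants_eq (hfr z) hz (hU z)
    rw [e1, e2]
  obtain ⟨x₀⟩ := (inferInstance : Nonempty M)
  refine ⟨m x₀, n x₀, fun x => ⟨U x, hU x, α x, β x, ?_⟩⟩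
  have := hc.apply_eq_of_preconnectedSpace x x₀
  simp only [Prod.mk.injEq] at this
  rw [← this.1, ← this.2]
  exact hfr x

/-- Exchange of the two factors. -/
def swapMap (F : M → SL2 × SL2) : M → SL2 × SL2 := fun x => ((F x).2, (F x).1)

theorem omega_swapMap (F : M → SL2 × SL2) (x : M) (v : TangentSpace 𝓘(ℝ, Plane) x) :
    omega (swapMap F) x v = P (omega F x v) := rfl

/-- P conjugates: s + tK² = (s - t) - tK. -/
theorem P_framePair (α β : Mat2) (s t : ℝ) :
    P (framePair α β s t) = framePair β α (s - t) (-t) := by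
  refine Prod.ext ?_ ?_ <;> simp only [framePair, P] <;> module

/-- Transfers every statement about the first factor to the second. -/
theorem LocalFrame.swap (h : LocalFrame F U α β m n) :
    LocalFrame (swapMap F) U β α (-n) (-m) where
  isOpen := h.isOpen
  smooth_α := h.smooth_β
  smooth_β := h.smooth_α
  gram x hx := (h.gram x hx).swap
  quad := by linear_combination h.quad
  deriv x hx v := by
    obtain ⟨s, t, e, d1, d2⟩ := h.deriv x hx v
    refine ⟨s - t, -t, ?_, ?_, ?_⟩
    · rw [omega_swapMap, e, P_framePair]
    · rw [d2, comm_swap (β x) (α x)]; module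
    · rw [d1, comm_swap (β x) (α x)]; module
  surj x hx s t := by
    obtain ⟨v, hv⟩ := h.surj x hx (s - t) (-t)
    refine ⟨v, ?_⟩
    rw [omega_swapMap, hv, P_framePair]
    congr 1 <;> ring

end Uniqueness

/-! ### The extrinsic geometry of the first factor -/

section Extrinsic

variable {M : Type*} [TopologicalSpace M] [ChartedSpace Plane M] [IsManifold 𝓘(ℝ, Plane) ∞ M]
  {F : M → SL2 × SL2} {U : Set M} {α β : M → Mat2} {m n : ℝ}

/-- `F` admits local frames with structure constants `m`, `n` around every point. -/
def HasFrames (F : M → SL2 × SL2) (m n : ℝ) : Prop :=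
  ∀ x : M, ∃ U, x ∈ U ∧ ∃ α β, LocalFrame F U α β m n

/-- The unit normal determined by a frame. -/
noncomputable def frameNormal (f : M → SL2) (α β : M → Mat2) (x : M) : Mat2 :=
  -(1 / √3) • ((f x : Mat2) * comm (α x) (β x))

theorem diff_eq_of_omega {x : M} {v : TangentSpace 𝓘(ℝ, Plane) x} {A B : Mat2} {s t : ℝ}
    (h : omega F x v = framePair A B s t) :
    diff (fstMap F) x v = (fstMap F x : Mat2) * (s • A - t • B) := by
  have := congrArg Prod.fst h
  simp only [omega, framePair] at this
  rw [← this, SL2_mul_inv]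

theorem immersed_fst (H : HasFrames F m n) (hf : IsSmooth (fstMap F))
    (hi : ∀ x, Function.Injective (omega F x)) : IsImmersedSurface (fstMap F) := by
  refine ⟨hf, fun x v w hvw => hi x ?_⟩
  obtain ⟨U, hx, α, β, h⟩ := H x
  obtain ⟨s, t, e, -⟩ := h.deriv x hx v
  obtain ⟨s', t', e', -⟩ := h.deriv x hx w
  have h1 : (omega F x v).1 = (omega F x w).1 := by simp only [omega]; rw [hvw]
  rw [e, e'] at h1
  simp only [framePair] at h1
  have h2 : s • α x + (-t) • β x = s' • α x + (-t') • β x := by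
    rw [neg_smul, neg_smul, ← sub_eq_add_neg, ← sub_eq_add_neg, h1]
  obtain ⟨q1, q2⟩ := (h.gram x hx).coeff_eq h2
  rw [e, e', q1, neg_injective q2]

theorem lorentzian_fst (H : HasFrames F m n) : IsLorentzian (fstMap F) := by
  intro x
  obtain ⟨U, hx, α, β, h⟩ := H x
  have g := h.gram x hx
  -- The induced metric is (s² + t²)/2 - 2st; (1, 0) and (2, 1) are orthogonal with norms 1/2 and
  -- -3/2, and are rescaled here.
  obtain ⟨v, hv⟩ := h.surj x hx (√2) 0
  obtain ⟨w, hw⟩ := h.surj x hx (2 * √(2 / 3)) (√(2 / 3))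
  have e1 : √2 * √2 = 2 := Real.mul_self_sqrt (by norm_num)
  have e2 : √(2 / 3) * √(2 / 3) = 2 / 3 := Real.mul_self_sqrt (by norm_num)
  refine ⟨v, w, ?_, ?_, ?_⟩ <;>
    simp only [diff_eq_of_omega hv, diff_eq_of_omega hw, SL2_ip_mul, ip_sub_left, ip_sub_right,
      ip_smul_left, ip_smul_right, g.aa, g.ab, g.ba, g.bb]
  · linear_combination (1 / 2) * e1
  · linear_combination (-3 / 2) * e2
  · ring

theorem sqrt_three_inv_mul : (-(1 / √3)) * (-(1 / √3)) = 1 / 3 := by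
  rw [neg_mul_neg, inv_sqrt_three_sq]

theorem LocalFrame.unitNormal (h : LocalFrame F U α β m n) (hf : IsSmooth (fstMap F)) :
    IsUnitNormalOn (fstMap F) U (frameNormal (fstMap F) α β) := by
  refine ⟨(contDiff_const_smul _).contMDiff.comp_contMDiffOn
    (smoothOn_matMul (hf.mono (Set.subset_univ _)) (smoothOn_comm h.smooth_α h.smooth_β)),
    fun x hx => ⟨?_, ?_, fun v => ?_⟩⟩
  · rw [frameNormal, ip_smul_left, SL2_ip_mul_self, ip_comm_one, mul_zero]
  · rw [frameNormal, ip_smul_left, ip_smul_right, SL2_ip_mul, (h.gram x hx).comm_norm,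
      ← mul_assoc, sqrt_three_inv_mul]
    norm_num
  · obtain ⟨s, t, e, -⟩ := h.deriv x hx v
    rw [diff_eq_of_omega e, frameNormal, ip_smul_right, SL2_ip_mul, ip_sub_left, ip_smul_left,
      ip_smul_left, ip_comm (α x), ip_comm (β x), ip_comm_left, ip_comm_right]
    ring

/-- A unit normal is determined up to sign. -/
theorem LocalFrame.unitNormal_sq (h : LocalFrame F U α β m n) {W : Set M} {N : M → Mat2}
    (hN : IsUnitNormalOn (fstMap F) W N) {x : M} (hx : x ∈ U) (hxW : x ∈ W) :
    N x = ip (N x) (frameNormal (fstMap F) α β x) • frameNormal (fstMap F) α β x ∧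
      ip (N x) (frameNormal (fstMap F) α β x) ^ 2 = 1 := by
  obtain ⟨n1, n2, n3⟩ := hN.2 x hxW
  have g := h.gram x hx
  set η := (((fstMap F x)⁻¹ : SL2) : Mat2) * N x with hη
  have hNη : N x = (fstMap F x : Mat2) * η := by rw [hη, SL2_mul_inv]
  rw [hNη, SL2_ip_mul_self] at n1
  rw [hNη, SL2_ip_mul] at n2
  have hα : ip η (α x) = 0 := by
    obtain ⟨v, hv⟩ := h.surj x hx 1 0
    have := n3 v
    rw [diff_eq_of_omega hv, hNη, SL2_ip_mul, ip_comm] at this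
    simpa using this
  have hβ : ip η (β x) = 0 := by
    obtain ⟨v, hv⟩ := h.surj x hx 0 1
    have := n3 v
    rw [diff_eq_of_omega hv, hNη, SL2_ip_mul, ip_comm] at this
    simpa [ip_neg_right] using this
  have e := g.eq_smul_comm n1 hα hβ
  have hip : ip (N x) (frameNormal (fstMap F) α β x) =
      -(1 / √3) * ip η (comm (α x) (β x)) := by
    rw [hNη, frameNormal, ip_smul_right, SL2_ip_mul]
  have hs := sqrt_three_inv_mul
  rw [hip]
  constructor
  · rw [hNη, frameNormal, smul_smul]
    conv_lhs => rw [e]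
    rw [mul_smul_comm]
    congr 1
    linear_combination (-ip η (comm (α x) (β x))) * hs
  · rw [e, ip_smul_left, ip_smul_right, g.comm_norm] at n2
    linear_combination ip η (comm (α x) (β x)) ^ 2 * hs + n2

/-- The commutator as a continuous bilinear map. -/
noncomputable def commCLM : Mat2 →L[ℝ] Mat2 →L[ℝ] Mat2 :=
  (LinearMap.mk₂ ℝ comm comm_add_left (fun r A B => comm_smul_left r A B)
    (fun A B C => comm_add_right B C A)
    (fun r A B => comm_smul_right r A B)).toContinuousBilinearMap

theorem LocalFrame.dirDeriv_comm (h : LocalFrame F U α β m n) {x : M} (hx : x ∈ U)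
    (v : TangentSpace 𝓘(ℝ, Plane) x) {μ ν : ℝ} (hμ : dirDeriv α x v = μ • comm (α x) (β x))
    (hν : dirDeriv β x v = ν • comm (α x) (β x)) :
    dirDeriv (fun z => comm (α z) (β z)) x v =
      (2 * μ - 4 * ν) • α x + (2 * ν - 4 * μ) • β x := by
  have g := h.gram x hx
  refine (dirDeriv_bilin commCLM h.isOpen h.smooth_α h.smooth_β hx v).trans ?_
  rw [hμ, hν]
  change comm (α x) (ν • comm (α x) (β x)) + comm (μ • comm (α x) (β x)) (β x) = _
  rw [comm_smul_left, comm_smul_right, g.comm_comm_right,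
    g.comm_comm_left]
  module

/-- The matrix of the shape operator in the coordinates `s`, `t`. -/
noncomputable def shapeMatrix (m n : ℝ) : Matrix (Fin 2) (Fin 2) ℝ :=
  (1 / √3) • !![-2 + 2 * m - 4 * n, 3 + 2 * n - 4 * m; -1 + 4 * m - 2 * n, -2 * n - 2 * m]

theorem LocalFrame.dirDeriv_normal (h : LocalFrame F U α β m n) (hf : IsSmooth (fstMap F)) {x : M}
    (hx : x ∈ U) {v : TangentSpace 𝓘(ℝ, Plane) x} {s t : ℝ}
    (hv : omega F x v = framePair (α x) (β x) s t) :
    dirDeriv (frameNormal (fstMap F) α β) x v = -((fstMap F x : Mat2) *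
      ((shapeMatrix m n).mulVec ![s, t] 0 • α x - (shapeMatrix m n).mulVec ![s, t] 1 • β x)) := by
  have g := h.gram x hx
  obtain ⟨s', t', e, d1, d2⟩ := h.deriv x hx v
  obtain ⟨rfl, rfl⟩ := g.framePair_inj (hv.symm.trans e)
  have sκ := smoothOn_comm h.smooth_α h.smooth_β
  have sp : SmoothOn (toMat (fstMap F)) U := hf.mono (Set.subset_univ _)
  have e1 : dirDeriv (frameNormal (fstMap F) α β) x v = -(1 / √3) •
      dirDeriv (fun z => toMat (fstMap F) z * comm (α z) (β z)) x v :=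
    dirDeriv_const_smul h.isOpen (smoothOn_matMul sp sκ) hx _ v
  have e2 : dirDeriv (fun z => toMat (fstMap F) z * comm (α z) (β z)) x v =
      toMat (fstMap F) x * dirDeriv (fun z => comm (α z) (β z)) x v +
        dirDeriv (toMat (fstMap F)) x v * comm (α x) (β x) :=
    dirDeriv_bilin mulCLM h.isOpen sp sκ hx v
  have e3 : dirDeriv (toMat (fstMap F)) x v = (fstMap F x : Mat2) * (s • α x - t • β x) :=
    diff_eq_of_omega hv
  -- A tangent vector is orthogonal to κ, so the product is half the commutator, with no radial
  -- part.
  have e4 : (s • α x - t • β x) * comm (α x) (β x) =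
      (-2 * s + t) • α x + (s - 2 * t) • β x := by
    have h1 : ip (s • α x - t • β x) 1 = 0 := by
      rw [ip_sub_left, ip_smul_left, ip_smul_left, g.tr₁, g.tr₂]; ring
    have h2 : ip (s • α x - t • β x) (comm (α x) (β x)) = 0 := by
      rw [ip_sub_left, ip_smul_left, ip_smul_left, ip_comm (α x), ip_comm (β x), ip_comm_left,
        ip_comm_right]; ring
    rw [mul_eq_half_comm h1 (ip_comm_one _ _), h2, comm_sub_left, comm_smul_left, comm_smul_left,
      g.comm_comm_left, comm_swap (β x), g.comm_comm_right]
    module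
  rw [e1, e2, e3, h.dirDeriv_comm hx v d1 d2, mul_assoc, e4, toMat, ← mul_add, ← mul_smul_comm,
    ← mul_neg]
  congr 1
  simp only [shapeMatrix, Matrix.mulVec, dotProduct, Fin.sum_univ_two, Matrix.smul_apply,
    smul_eq_mul, Matrix.of_apply, Matrix.cons_val_zero, Matrix.cons_val_one, Matrix.cons_val']
  module

/-- Identifies the tangent plane with ℝ², so that the shape operator is conjugate to a matrix
independent of the point and has its characteristic polynomial. -/
theorem LocalFrame.exists_coordinates (h : LocalFrame F U α β m n) {x : M} (hx : x ∈ U)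
    (hi : Function.Injective (omega F x)) :
    ∃ φ : Plane ≃ₗ[ℝ] (Fin 2 → ℝ), ∀ v : Plane,
      omega F x v = framePair (α x) (β x) (φ v 0) (φ v 1) := by
  obtain ⟨v₀, h₀⟩ : ∃ v : Plane, omegaLin F x v = _ := h.surj x hx 1 0
  obtain ⟨v₁, h₁⟩ : ∃ v : Plane, omegaLin F x v = _ := h.surj x hx 0 1
  let ψ : (Fin 2 → ℝ) →ₗ[ℝ] Plane :=
    { toFun := fun c => c 0 • v₀ + c 1 • v₁
      map_add' := fun c d => by simp only [Pi.add_apply]; module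
      map_smul' := fun r c => by simp only [Pi.smul_apply, smul_eq_mul, RingHom.id_apply]; module }
  have hψ : ∀ c, omegaLin F x (ψ c) = framePair (α x) (β x) (c 0) (c 1) := fun c => by
    change omegaLin F x (c 0 • v₀ + c 1 • v₁) = _
    rw [map_add, map_smul, map_smul, h₀, h₁, framePair_one_zero, framePair_zero_one]
    refine Prod.ext ?_ ?_
    · simp only [framePair, Prod.fst_add, Prod.smul_fst]
      module
    · simp only [framePair, Prod.snd_add, Prod.smul_snd]
  have hb : Function.Bijective ψ := by
    refine ⟨fun c d hcd => ?_, fun v => ?_⟩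
    · have := hψ c
      rw [hcd, hψ d] at this
      obtain ⟨q1, q2⟩ := (h.gram x hx).framePair_inj this
      ext i
      fin_cases i
      exacts [q1.symm, q2.symm]
    · obtain ⟨s, t, e, -⟩ := h.deriv x hx v
      refine ⟨![s, t], hi ?_⟩
      rw [e]
      exact hψ _
  refine ⟨(LinearEquiv.ofBijective ψ hb).symm, fun v => ?_⟩
  rw [← hψ]
  exact congrArg (omegaLin F x) ((LinearEquiv.ofBijective ψ hb).apply_symm_apply v).symm

theorem LocalFrame.nablaSL_normal (h : LocalFrame F U α β m n) (hf : IsSmooth (fstMap F))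
    {W : Set M} (hW : IsOpen W) {N : M → Mat2} {r : ℝ}
    (hr : ∀ z ∈ U ∩ W, N z = r • frameNormal (fstMap F) α β z) {x : M} (hx : x ∈ U)
    (hxW : x ∈ W) {v w : TangentSpace 𝓘(ℝ, Plane) x} {s t : ℝ}
    (hv : omega F x v = framePair (α x) (β x) s t)
    (hw : omega F x w = framePair (α x) (β x) ((r • shapeMatrix m n).mulVec ![s, t] 0)
      ((r • shapeMatrix m n).mulVec ![s, t] 1)) :
    nablaSL (fstMap F) N x v = -diff (fstMap F) x w := by
  have hn := h.unitNormal hf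
  have e1 : dirDeriv N x v = r • dirDeriv (frameNormal (fstMap F) α β) x v := by
    rw [dirDeriv_congr (h.isOpen.inter hW) hr ⟨hx, hxW⟩]
    exact dirDeriv_const_smul h.isOpen hn.1 hx r v
  simp only [nablaSL]
  rw [hr x ⟨hx, hxW⟩, ip_smul_right, (hn.2 x hx).2.2, mul_zero, zero_smul, sub_zero, e1,
    h.dirDeriv_normal hf hx hv, diff_eq_of_omega hw, smul_neg, ← mul_smul_comm]
  congr 2
  simp only [Matrix.smul_mulVec, Pi.smul_apply, smul_eq_mul]
  module

theorem LocalFrame.exists_shapeOperator (h : LocalFrame F U α β m n) (hf : IsSmooth (fstMap F))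
    (hi : ∀ x, Function.Injective (omega F x)) {W : Set M} (hW : IsOpen W) {N : M → Mat2} {r : ℝ}
    (hr : ∀ z ∈ U ∩ W, N z = r • frameNormal (fstMap F) α β z) {x : M} (hx : x ∈ U)
    (hxW : x ∈ W) :
    ∃ S, IsShapeOperator (fstMap F) N x S ∧ S.charpoly = (r • shapeMatrix m n).charpoly := by
  obtain ⟨φ, hφ⟩ := h.exists_coordinates hx (hi x)
  refine ⟨φ.symm.conj (Matrix.toLin' (r • shapeMatrix m n)), fun v => ?_, ?_⟩
  · refine h.nablaSL_normal hf hW hr hx hxW (hφ v) ((hφ _).trans ?_)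
    have e2 : ![φ v 0, φ v 1] = φ v := by ext i; fin_cases i <;> rfl
    simp only [LinearEquiv.conj_apply, LinearMap.comp_apply, LinearEquiv.coe_coe,
      LinearEquiv.apply_symm_apply, LinearEquiv.symm_symm, Matrix.toLin'_apply, e2]
  · rw [LinearEquiv.charpoly_conj, Matrix.charpoly_toLin']

/-- [α, β] is even in the frame, so the local normals agree whichever frame is chosen. -/
theorem exists_normal (H : HasFrames F m n) : ∃ N : M → Mat2, ∀ U α β, LocalFrame F U α β m n →
    ∀ x ∈ U, N x = frameNormal (fstMap F) α β x := by
  choose U hU α β h using H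
  refine ⟨fun x => frameNormal (fstMap F) (α x) (β x) x, fun U' α' β' h' x hx => ?_⟩
  obtain ⟨r, hr, e1, e2⟩ := (h x).sign h' (hU x) hx
  have hr2 : r * r = 1 := by rcases hr with rfl | rfl <;> norm_num
  simp only [frameNormal]
  rw [e1, e2, comm_smul_left, comm_smul_right, smul_smul, hr2, one_smul]

theorem unitNormal_of_frames (H : HasFrames F m n) (hf : IsSmooth (fstMap F)) {N : M → Mat2}
    (hN : ∀ U α β, LocalFrame F U α β m n → ∀ x ∈ U, N x = frameNormal (fstMap F) α β x) :
    IsUnitNormalOn (fstMap F) Set.univ N := by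
  refine ⟨fun x _ => ?_, fun x _ => ?_⟩
  · obtain ⟨U, hx, α, β, h⟩ := H x
    have := (h.unitNormal hf).1.congr (fun z hz => hN U α β h z hz)
    exact (this.contMDiffAt (h.isOpen.mem_nhds hx)).contMDiffWithinAt
  · obtain ⟨U, hx, α, β, h⟩ := H x
    rw [hN U α β h x hx]
    exact (h.unitNormal hf).2 x hx

/-- Over a connected set all unit normals agree up to a constant sign. -/
theorem unitNormal_sign (H : HasFrames F m n) (hf : IsSmooth (fstMap F)) {N : M → Mat2}
    (hN : ∀ U α β, LocalFrame F U α β m n → ∀ x ∈ U, N x = frameNormal (fstMap F) α β x)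
    {W : Set M} (hW : IsPreconnected W) {N' : M → Mat2}
    (hN' : IsUnitNormalOn (fstMap F) W N') :
    ∃ r : ℝ, r * r = 1 ∧ ∀ x ∈ W, N' x = r • N x := by
  have hu := unitNormal_of_frames H hf hN
  have key : ∀ x ∈ W, N' x = ip (N' x) (N x) • N x ∧ ip (N' x) (N x) ^ 2 = 1 := fun x hx => by
    obtain ⟨U, hxU, α, β, h⟩ := H x
    rw [hN U α β h x hxU]
    exact h.unitNormal_sq hN' hxU hx
  have hc : ContinuousOn (fun x => ip (N' x) (N x)) W :=
    continuousOn_ip hN'.1.continuousOn (hu.1.continuousOn.mono (Set.subset_univ _))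
  rcases hW.eq_or_eq_neg_of_sq_eq hc (g := fun _ => (1 : ℝ)) continuousOn_const
    (fun x hx => by simpa using (key x hx).2) (fun _ => one_ne_zero) with h | h
  · refine ⟨1, by norm_num, fun x hx => ?_⟩
    have := (key x hx).1
    have e : ip (N' x) (N x) = _ := h hx
    rw [e] at this
    simpa using this
  · refine ⟨-1, by norm_num, fun x hx => ?_⟩
    have := (key x hx).1
    have e : ip (N' x) (N x) = _ := h hx
    rw [e] at this
    simpa using this

theorem isoparametric_fst (H : HasFrames F m n) (hf : IsSmooth (fstMap F))
    (hi : ∀ x, Function.Injective (omega F x)) : IsIsoparametric (fstMap F) := by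
  obtain ⟨N, hN⟩ := exists_normal H
  intro W oW hW N' hN'
  obtain ⟨r, -, hr⟩ := unitNormal_sign H hf hN hW hN'
  refine ⟨((r • shapeMatrix m n).charpoly.map (algebraMap ℝ ℂ)).roots, fun x hx => ?_⟩
  obtain ⟨U, hxU, α, β, h⟩ := H x
  obtain ⟨S, hS, hc⟩ := h.exists_shapeOperator hf hi oW (N := N') (r := r)
    (fun z hz => by rw [hr z hz.2, hN U α β h z hz.1]) hxU hx
  exact ⟨S, hS, by rw [principalCurvatures, hc]⟩

end Extrinsic

/-! ### Flat metrics with constant coefficients in a closed coframe -/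

section Flat

/-- `U`, `V` is the frame dual to the closed coframe `s`, `t`. -/
structure IsClosedCoframe (O : Set Plane) (s t U V : Fin 2 → Plane → ℝ) : Prop where
  smooth_s : ∀ i, ContDiffOn ℝ ∞ (s i) O
  smooth_t : ∀ i, ContDiffOn ℝ ∞ (t i) O
  smooth_U : ∀ i, ContDiffOn ℝ ∞ (U i) O
  smooth_V : ∀ i, ContDiffOn ℝ ∞ (V i) O
  closed_s : ∀ y ∈ O, ∀ i j, pd i (s j) y = pd j (s i) y
  closed_t : ∀ y ∈ O, ∀ i j, pd i (t j) y = pd j (t i) y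
  sU : ∀ y ∈ O, s 0 y * U 0 y + s 1 y * U 1 y = 1
  tU : ∀ y ∈ O, t 0 y * U 0 y + t 1 y * U 1 y = 0
  sV : ∀ y ∈ O, s 0 y * V 0 y + s 1 y * V 1 y = 0
  tV : ∀ y ∈ O, t 0 y * V 0 y + t 1 y * V 1 y = 1
  dual : ∀ y ∈ O, ∀ i j, U i y * s j y + V i y * t j y = if i = j then 1 else 0

/-- The metric with coefficients `[[1/2, -1], [-1, 1/2]]` in the coframe `s`, `t`. -/
noncomputable def coframeMetric (s t : Fin 2 → Plane → ℝ) (y : Plane) (i j : Fin 2) : ℝ :=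
  (1 / 2) * (s i y * s j y + t i y * t j y) - (s i y * t j y + t i y * s j y)

variable {O : Set Plane} {s t U V : Fin 2 → Plane → ℝ}
  {γ : Plane → Matrix (Fin 2) (Fin 2) ℝ}

theorem exists_closedCoframe (hs : ∀ i, ContDiffOn ℝ ∞ (s i) O)
    (ht : ∀ i, ContDiffOn ℝ ∞ (t i) O) (cs : ∀ y ∈ O, pd 0 (s 1) y = pd 1 (s 0) y)
    (ct : ∀ y ∈ O, pd 0 (t 1) y = pd 1 (t 0) y)
    (hd : ∀ y ∈ O, s 0 y * t 1 y - s 1 y * t 0 y ≠ 0) :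
    ∃ U V, IsClosedCoframe O s t U V := by
  have sΔ : ContDiffOn ℝ ∞ (fun y => s 0 y * t 1 y - s 1 y * t 0 y) O :=
    ((hs 0).mul (ht 1)).sub ((hs 1).mul (ht 0))
  refine ⟨![fun y => t 1 y / (s 0 y * t 1 y - s 1 y * t 0 y),
      fun y => -t 0 y / (s 0 y * t 1 y - s 1 y * t 0 y)],
    ![fun y => -s 1 y / (s 0 y * t 1 y - s 1 y * t 0 y),
      fun y => s 0 y / (s 0 y * t 1 y - s 1 y * t 0 y)], hs, ht, fun i => ?_, fun i => ?_,
    fun y hy i j => ?_, fun y hy i j => ?_, fun y hy => ?_, fun y hy => ?_, fun y hy => ?_,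
    fun y hy => ?_, fun y hy i j => ?_⟩
  · fin_cases i
    exacts [(ht 1).div sΔ hd, (ht 0).neg.div sΔ hd]
  · fin_cases i
    exacts [(hs 1).neg.div sΔ hd, (hs 0).div sΔ hd]
  · fin_cases i <;> fin_cases j
    exacts [rfl, cs y hy, (cs y hy).symm, rfl]
  · fin_cases i <;> fin_cases j
    exacts [rfl, ct y hy, (ct y hy).symm, rfl]
  · have := inv_mul_cancel₀ (hd y hy)
    simp only [Matrix.cons_val_zero, Matrix.cons_val_one, div_eq_mul_inv]
    linear_combination this
  · simp only [Matrix.cons_val_zero, Matrix.cons_val_one, div_eq_mul_inv]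
    ring
  · simp only [Matrix.cons_val_zero, Matrix.cons_val_one, div_eq_mul_inv]
    ring
  · have := inv_mul_cancel₀ (hd y hy)
    simp only [Matrix.cons_val_zero, Matrix.cons_val_one, div_eq_mul_inv]
    linear_combination this
  · have := inv_mul_cancel₀ (hd y hy)
    fin_cases i <;> fin_cases j <;> simp [div_eq_mul_inv] <;>
      first | linear_combination this | ring1

namespace IsClosedCoframe

variable (h : IsClosedCoframe O s t U V)
include h

/-- The coefficients are those of the inverse of [[1/2, -1], [-1, 1/2]], in the dual frame. -/
theorem inverse_metric {y : Plane} (hy : y ∈ O) (hγ : ∀ i j, γ y i j = coframeMetric s t y i j)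
    (k l : Fin 2) : (γ y)⁻¹ k l = -(2 / 3) * (U k y * U l y + V k y * V l y) -
      (4 / 3) * (U k y * V l y + V k y * U l y) := by
  have key : (Matrix.of fun k l : Fin 2 => -(2 / 3) * (U k y * U l y + V k y * V l y) -
      (4 / 3) * (U k y * V l y + V k y * U l y)) * γ y = 1 := by
    ext i j
    rw [Matrix.mul_apply, Fin.sum_univ_two, Matrix.one_apply, ← h.dual y hy i j]
    simp only [Matrix.of_apply, hγ, coframeMetric]
    have e1 := h.sU y hy
    have e2 := h.tU y hy
    have e3 := h.sV y hy
    have e4 := h.tV y hy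
    calc _ = (-(2 / 3) * U i y - (4 / 3) * V i y) *
          ((s 0 y * U 0 y + s 1 y * U 1 y) * (1 / 2 * s j y - t j y) +
            (t 0 y * U 0 y + t 1 y * U 1 y) * (1 / 2 * t j y - s j y)) +
          (-(2 / 3) * V i y - (4 / 3) * U i y) *
          ((s 0 y * V 0 y + s 1 y * V 1 y) * (1 / 2 * s j y - t j y) +
            (t 0 y * V 0 y + t 1 y * V 1 y) * (1 / 2 * t j y - s j y)) := by ring
      _ = _ := by rw [e1, e2, e3, e4]; ring
  rw [Matrix.inv_eq_left_inv key]
  rfl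

theorem pd_metric (hO : IsOpen O) (hγ : ∀ y ∈ O, ∀ i j, γ y i j = coframeMetric s t y i j)
    {y : Plane} (hy : y ∈ O) (l i j : Fin 2) :
    pd l (fun z => γ z i j) y =
      (1 / 2) * (pd l (s i) y * s j y + s i y * pd l (s j) y + pd l (t i) y * t j y +
        t i y * pd l (t j) y) -
      (pd l (s i) y * t j y + s i y * pd l (t j) y + pd l (t i) y * s j y +
        t i y * pd l (s j) y) := by
  have ds := fun i => diffAt (h.smooth_s i) hO hy
  have dt := fun i => diffAt (h.smooth_t i) hO hy
  rw [pd_congr hO (fun z hz => hγ z hz i j) hy]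
  simp only [coframeMetric]
  have d1 := ((ds i).fun_mul (ds j)).fun_add ((dt i).fun_mul (dt j))
  have d2 := ((ds i).fun_mul (dt j)).fun_add ((dt i).fun_mul (ds j))
  rw [pd_sub (d1.const_mul _) d2, pd_const_mul d1,
    pd_add ((ds i).fun_mul (ds j)) ((dt i).fun_mul (dt j)),
    pd_add ((ds i).fun_mul (dt j)) ((dt i).fun_mul (ds j)),
    pd_mul (ds i) (ds j), pd_mul (dt i) (dt j), pd_mul (ds i) (dt j), pd_mul (dt i) (ds j)]
  ring

/-- Metric coefficients being constant and the coframe closed, the Levi-Civita connection is the one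
for which s and t are parallel. -/
theorem christoffel_eq (hO : IsOpen O) (hγ : ∀ y ∈ O, ∀ i j, γ y i j = coframeMetric s t y i j)
    {y : Plane} (hy : y ∈ O) (k i j : Fin 2) :
    christoffel γ k i j y = U k y * pd i (s j) y + V k y * pd i (t j) y := by
  have e : ∀ l, pd i (fun z => γ z j l) y + pd j (fun z => γ z i l) y -
      pd l (fun z => γ z i j) y =
      pd i (s j) y * (s l y - 2 * t l y) + pd i (t j) y * (t l y - 2 * s l y) := fun l => by
    rw [h.pd_metric hO hγ hy, h.pd_metric hO hγ hy, h.pd_metric hO hγ hy,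
      h.closed_s y hy l i, h.closed_s y hy l j, h.closed_s y hy j i,
      h.closed_t y hy l i, h.closed_t y hy l j, h.closed_t y hy j i]
    ring
  simp only [christoffel, e, Fin.sum_univ_two, h.inverse_metric hy (hγ y hy)]
  have e1 := h.sU y hy
  have e2 := h.tU y hy
  have e3 := h.sV y hy
  have e4 := h.tV y hy
  generalize pd i (s j) y = S
  generalize pd i (t j) y = T
  calc _ = (1 / 2) * ((-(2 / 3) * U k y - (4 / 3) * V k y) *
        ((s 0 y * U 0 y + s 1 y * U 1 y) * (S - 2 * T) +
          (t 0 y * U 0 y + t 1 y * U 1 y) * (T - 2 * S)) +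
        (-(2 / 3) * V k y - (4 / 3) * U k y) *
        ((s 0 y * V 0 y + s 1 y * V 1 y) * (S - 2 * T) +
          (t 0 y * V 0 y + t 1 y * V 1 y) * (T - 2 * S))) := by ring
    _ = _ := by rw [e1, e2, e3, e4]; ring

/-- Obtained by differentiating the duality relations and solving for the derivatives of the dual
frame. -/
theorem pd_dual (hO : IsOpen O) {y : Plane} (hy : y ∈ O) (i l : Fin 2) :
    pd i (U l) y = -((U l y * pd i (s 0) y + V l y * pd i (t 0) y) * U 0 y +
        (U l y * pd i (s 1) y + V l y * pd i (t 1) y) * U 1 y) ∧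
      pd i (V l) y = -((U l y * pd i (s 0) y + V l y * pd i (t 0) y) * V 0 y +
        (U l y * pd i (s 1) y + V l y * pd i (t 1) y) * V 1 y) := by
  have ds := fun i => diffAt (h.smooth_s i) hO hy
  have dt := fun i => diffAt (h.smooth_t i) hO hy
  have dU := fun i => diffAt (h.smooth_U i) hO hy
  have dV := fun i => diffAt (h.smooth_V i) hO hy
  have q : ∀ {a b : Fin 2 → Plane → ℝ} {c : ℝ} (da : ∀ i, DifferentiableAt ℝ (a i) y)
      (db : ∀ i, DifferentiableAt ℝ (b i) y) (_ : ∀ z ∈ O, a 0 z * b 0 z + a 1 z * b 1 z = c),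
      a 0 y * pd i (b 0) y + pd i (a 0) y * b 0 y +
        (a 1 y * pd i (b 1) y + pd i (a 1) y * b 1 y) = 0 := fun da db hc => by
    have e := pd_eq_zero hO hc hy i
    rw [pd_add ((da 0).fun_mul (db 0)) ((da 1).fun_mul (db 1)), pd_mul (da 0) (db 0),
      pd_mul (da 1) (db 1)] at e
    exact e
  have e1 := q ds dU h.sU
  have e2 := q dt dU h.tU
  have e3 := q ds dV h.sV
  have e4 := q dt dV h.tV
  have d0 := h.dual y hy l 0
  have d1 := h.dual y hy l 1
  have hsel : ∀ x0 x1 : ℝ, (U l y * s 0 y + V l y * t 0 y) * x0 +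
      (U l y * s 1 y + V l y * t 1 y) * x1 = if l = 0 then x0 else x1 := fun x0 x1 => by
    rw [d0, d1]
    fin_cases l <;> simp
  have f1 := hsel (pd i (U 0) y) (pd i (U 1) y)
  have f2 := hsel (pd i (V 0) y) (pd i (V 1) y)
  have g1 : (if l = 0 then pd i (U 0) y else pd i (U 1) y) = pd i (U l) y := by
    fin_cases l <;> simp
  have g2 : (if l = 0 then pd i (V 0) y else pd i (V 1) y) = pd i (V l) y := by
    fin_cases l <;> simp
  rw [← g1, ← g2, ← f1, ← f2]
  constructor
  · linear_combination U l y * e1 + V l y * e2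
  · linear_combination U l y * e3 + V l y * e4

theorem riemann_eq_zero (hO : IsOpen O)
    (hγ : ∀ y ∈ O, ∀ i j, γ y i j = coframeMetric s t y i j) {y : Plane} (hy : y ∈ O)
    (l k i j : Fin 2) : riemann γ l k i j y = 0 := by
  have dU := fun i => diffAt (h.smooth_U i) hO hy
  have dV := fun i => diffAt (h.smooth_V i) hO hy
  have dS := fun i j => diffAt (contDiffOn_pd hO (h.smooth_s j) i) hO hy
  have dT := fun i j => diffAt (contDiffOn_pd hO (h.smooth_t j) i) hO hy
  have e : ∀ i j, pd i (christoffel γ l j k) y =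
      U l y * pd i (pd j (s k)) y + pd i (U l) y * pd j (s k) y +
        (V l y * pd i (pd j (t k)) y + pd i (V l) y * pd j (t k) y) := fun i j => by
    rw [pd_congr hO (fun z hz => h.christoffel_eq hO hγ hz l j k) hy,
      pd_add ((dU l).fun_mul (dS j k)) ((dV l).fun_mul (dT j k)), pd_mul (dU l) (dS j k),
      pd_mul (dV l) (dT j k)]
  simp only [riemann, e, h.christoffel_eq hO hγ hy, Fin.sum_univ_two,
    (h.pd_dual hO hy _ _).1, (h.pd_dual hO hy _ _).2,
    pd_pd_comm hO (h.smooth_s k) hy i j, pd_pd_comm hO (h.smooth_t k) hy i j]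
  ring

end IsClosedCoframe

end Flat

/-! ### The intrinsic geometry and the mean curvature of the first factor -/

section Charts

variable {M : Type*} [TopologicalSpace M] [ChartedSpace Plane M] [IsManifold 𝓘(ℝ, Plane) ∞ M]
  {F : M → SL2 × SL2} {U : Set M} {α β : M → Mat2} {m n : ℝ}
  {e : OpenPartialHomeomorph M Plane}

/-- A local frame in a chart. -/
theorem LocalFrame.exists_coframe (h : LocalFrame F U α β m n)
    (he : e ∈ IsManifold.maximalAtlas 𝓘(ℝ, Plane) ∞ M) (hp : IsSmooth (fstMap F)) :
    ∃ s t : Fin 2 → Plane → ℝ,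
      IsAdaptedCoframe (e.target ∩ e.symm ⁻¹' U) (chartForm (fstMap F) e)
        (chartForm (sndMap F) e) (fun y => α (e.symm y)) (fun y => β (e.symm y)) s t ∧
      ∀ y ∈ e.target ∩ e.symm ⁻¹' U, ∀ i,
        pd i (fun z => α (e.symm z)) y =
          (m * s i y - (1 + n) * t i y) • comm (α (e.symm y)) (β (e.symm y)) ∧
        pd i (fun z => β (e.symm z)) y =
          (n * s i y + (m - n - 1) * t i y) • comm (α (e.symm y)) (β (e.symm y)) := by
  set O := e.target ∩ e.symm ⁻¹' U
  have sα := contDiffOn_comp_chart he h.smooth_α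
  have sβ := contDiffOn_comp_chart he h.smooth_β
  have sa := fun i => (contDiffOn_chartForm he hp i).mono (Set.inter_subset_left : O ⊆ _)
  let s : Fin 2 → Plane → ℝ := fun i y =>
    (4 / 3) * ip (chartForm (fstMap F) e i y) (β (e.symm y)) -
      (2 / 3) * ip (chartForm (fstMap F) e i y) (α (e.symm y))
  let t : Fin 2 → Plane → ℝ := fun i y =>
    (2 / 3) * ip (chartForm (fstMap F) e i y) (β (e.symm y)) -
      (4 / 3) * ip (chartForm (fstMap F) e i y) (α (e.symm y))
  have key : ∀ y ∈ O, ∀ i,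
      omega F (e.symm y) (chartInvDeriv e y (EuclideanSpace.single i 1)) =
        framePair (α (e.symm y)) (β (e.symm y)) (s i y) (t i y) ∧
      pd i (fun z => α (e.symm z)) y =
          (m * s i y - (1 + n) * t i y) • comm (α (e.symm y)) (β (e.symm y)) ∧
      pd i (fun z => β (e.symm z)) y =
          (n * s i y + (m - n - 1) * t i y) • comm (α (e.symm y)) (β (e.symm y)) := by
    intro y hy i
    obtain ⟨s', t', e1, e2, e3⟩ := h.deriv _ hy.2 (chartInvDeriv e y (EuclideanSpace.single i 1))
    have g := h.gram _ hy.2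
    have e4 : chartForm (fstMap F) e i y = s' • α (e.symm y) - t' • β (e.symm y) :=
      congrArg Prod.fst e1
    have hs : s i y = s' := by
      simp only [s, e4, ip_sub_left, ip_smul_left, g.aa, g.ab, g.ba, g.bb]; ring
    have ht : t i y = t' := by
      simp only [t, e4, ip_sub_left, ip_smul_left, g.aa, g.ab, g.ba, g.bb]; ring
    rw [hs, ht, pd_comp_chart he h.isOpen h.smooth_α hy.1 hy.2,
      pd_comp_chart he h.isOpen h.smooth_β hy.1 hy.2]
    exact ⟨e1, e2, e3⟩
  refine ⟨s, t, ⟨sα, sβ, fun i => ?_, fun i => ?_, fun y hy => h.gram _ hy.2,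
    fun y hy i => congrArg Prod.fst (key y hy i).1, fun y hy i => congrArg Prod.snd (key y hy i).1,
    fun y hy h0 => ?_⟩, fun y hy i => (key y hy i).2⟩
  · exact (contDiffOn_const.mul (contDiffOn_ip (sa i) sβ)).sub
      (contDiffOn_const.mul (contDiffOn_ip (sa i) sα))
  · exact (contDiffOn_const.mul (contDiffOn_ip (sa i) sβ)).sub
      (contDiffOn_const.mul (contDiffOn_ip (sa i) sα))
  · have hsum : ∀ w : Plane, omega F (e.symm y) (chartInvDeriv e y w) =
        framePair (α (e.symm y)) (β (e.symm y)) (w 0 * s 0 y + w 1 * s 1 y)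
          (w 0 * t 0 y + w 1 * t 1 y) := fun w => by
      conv_lhs => rw [plane_eq w]
      rw [map_add, map_smul, map_smul, omega_add, omega_smul, omega_smul, (key y hy 0).1,
        (key y hy 1).1]
      refine Prod.ext ?_ ?_ <;>
        simp only [framePair, Prod.fst_add, Prod.snd_add, Prod.smul_fst, Prod.smul_snd] <;> module
    have g := h.gram _ hy.2
    obtain ⟨v, hv⟩ := h.surj _ hy.2 1 0
    obtain ⟨v', hv'⟩ := h.surj _ hy.2 0 1
    obtain ⟨w, rfl⟩ := (chartInvDeriv_bijective he hy.1).2 v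
    obtain ⟨w', rfl⟩ := (chartInvDeriv_bijective he hy.1).2 v'
    obtain ⟨q1, q2⟩ := g.framePair_inj ((hsum w).symm.trans hv)
    obtain ⟨q3, q4⟩ := g.framePair_inj ((hsum w').symm.trans hv')
    -- w and w' have coordinates (1, 0) and (0, 1), so a product of determinants equals 1 although
    -- one factor is zero.
    have : (1 : ℝ) = 0 := by
      calc (1 : ℝ) = (w 0 * s 0 y + w 1 * s 1 y) * (w' 0 * t 0 y + w' 1 * t 1 y) -
            (w 0 * t 0 y + w 1 * t 1 y) * (w' 0 * s 0 y + w' 1 * s 1 y) := by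
              rw [q1, q2, q3, q4]; ring
        _ = (w 0 * w' 1 - w 1 * w' 0) * (s 0 y * t 1 y - s 1 y * t 0 y) := by ring
        _ = 0 := by rw [h0, mul_zero]
    exact one_ne_zero this

theorem IsAdaptedCoframe.gram_eq {O : Set Plane} {b : Fin 2 → Plane → Mat2}
    {α β : Plane → Mat2} {s t : Fin 2 → Plane → ℝ} {f : M → SL2}
    (h : IsAdaptedCoframe O (chartForm f e) b α β s t)
    (he : e ∈ IsManifold.maximalAtlas 𝓘(ℝ, Plane) ∞ M) (hf : IsSmooth f) (hO : O ⊆ e.target)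
    {y : Plane} (hy : y ∈ O) (i j : Fin 2) :
    ip (chartForm f e i y) (chartForm f e j y) = coframeMetric s t y i j ∧
      NKSL.gram f e y i j = coframeMetric s t y i j := by
  have g := h.gram y hy
  have e1 : ip (chartForm f e i y) (chartForm f e j y) = coframeMetric s t y i j := by
    rw [h.fst y hy, h.fst y hy, coframeMetric]
    simp only [ip_sub_left, ip_sub_right, ip_smul_left, ip_smul_right, g.aa, g.ab, g.ba, g.bb]
    ring
  refine ⟨e1, ?_⟩
  rw [NKSL.gram, Matrix.of_apply, pd_localRep he hf (hO hy), pd_localRep he hf (hO hy), localRep,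
    SL2_ip_mul, e1]

theorem LocalFrame.exists_closedCoframe (h : LocalFrame F U α β m n)
    (he : e ∈ IsManifold.maximalAtlas 𝓘(ℝ, Plane) ∞ M) (hp : IsSmooth (fstMap F))
    (hq : IsSmooth (sndMap F)) {s t : Fin 2 → Plane → ℝ}
    (hc : IsAdaptedCoframe (e.target ∩ e.symm ⁻¹' U) (chartForm (fstMap F) e)
        (chartForm (sndMap F) e) (fun y => α (e.symm y)) (fun y => β (e.symm y)) s t) :
    ∃ X Y, IsClosedCoframe (e.target ∩ e.symm ⁻¹' U) s t X Y := by
  have hO : IsOpen (e.target ∩ e.symm ⁻¹' U) := isOpen_chart_preimage h.isOpen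
  have ha : MaurerCartan (e.target ∩ e.symm ⁻¹' U) (chartForm (fstMap F) e) :=
    fun y hy => maurerCartan_chartForm he hp y hy.1
  have hb : MaurerCartan (e.target ∩ e.symm ⁻¹' U) (chartForm (sndMap F) e) :=
    fun y hy => maurerCartan_chartForm he hq y hy.1
  exact NKSL.exists_closedCoframe hc.smooth_s hc.smooth_t
    (fun y hy => (hc.first_order hO ha hb hy).1) (fun y hy => (hc.first_order hO ha hb hy).2.1)
    hc.det_ne

theorem flat_fst (H : HasFrames F m n) (hp : IsSmooth (fstMap F)) (hq : IsSmooth (sndMap F)) :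
    IsFlat (fstMap F) := by
  intro e he y hy l k i j
  obtain ⟨U, hx, α, β, h⟩ := H (e.symm y)
  obtain ⟨s, t, hc, -⟩ := h.exists_coframe he hp
  obtain ⟨X, Y, hcl⟩ := h.exists_closedCoframe he hp hq hc
  exact hcl.riemann_eq_zero (isOpen_chart_preimage h.isOpen)
    (fun z hz i j => (hc.gram_eq he hp Set.inter_subset_left hz i j).2) ⟨hy, hx⟩ l k i j

/-- From ∂ᵢ(p aⱼ) = p(aᵢaⱼ + ∂ᵢaⱼ). The symmetric part of aᵢaⱼ is the radial term, and the
Christoffel term cancels the derivatives of sⱼ and tⱼ. What remains is along κ: half the commutator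
together with the derivatives of α and β. -/
theorem LocalFrame.secondFundForm_eq (h : LocalFrame F U α β m n)
    (he : e ∈ IsManifold.maximalAtlas 𝓘(ℝ, Plane) ∞ M) (hp : IsSmooth (fstMap F))
    {s t X Y : Fin 2 → Plane → ℝ}
    (hc : IsAdaptedCoframe (e.target ∩ e.symm ⁻¹' U) (chartForm (fstMap F) e)
        (chartForm (sndMap F) e) (fun y => α (e.symm y)) (fun y => β (e.symm y)) s t)
    (hd : ∀ y ∈ e.target ∩ e.symm ⁻¹' U, ∀ i,
        pd i (fun z => α (e.symm z)) y =
          (m * s i y - (1 + n) * t i y) • comm (α (e.symm y)) (β (e.symm y)) ∧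
        pd i (fun z => β (e.symm z)) y =
          (n * s i y + (m - n - 1) * t i y) • comm (α (e.symm y)) (β (e.symm y)))
    (hcl : IsClosedCoframe (e.target ∩ e.symm ⁻¹' U) s t X Y) {y : Plane}
    (hy : y ∈ e.target ∩ e.symm ⁻¹' U) (i j : Fin 2) :
    secondFundForm (fstMap F) e i j y =
      (m * s i y * s j y - (1 / 2 + n) * (s i y * t j y + t i y * s j y) -
        (m - n - 1) * t i y * t j y) •
          ((fstMap F (e.symm y) : Mat2) * comm (α (e.symm y)) (β (e.symm y))) := by
  set O := e.target ∩ e.symm ⁻¹' U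
  have hO : IsOpen O := isOpen_chart_preimage h.isOpen
  have hOt : O ⊆ e.target := Set.inter_subset_left
  have g := h.gram _ hy.2
  have sp := (contDiffOn_localRep he hp).mono hOt
  have sa := fun i => (contDiffOn_chartForm he hp i).mono hOt
  have dp := diffAt sp hO hy
  have da := fun i => diffAt (sa i) hO hy
  have dα := diffAt hc.smooth_α hO hy
  have dβ := diffAt hc.smooth_β hO hy
  have ds := fun i => diffAt (hc.smooth_s i) hO hy
  have dt := fun i => diffAt (hc.smooth_t i) hO hy
  have hγ : ∀ z ∈ O, ∀ i j, NKSL.gram (fstMap F) e z i j = coframeMetric s t z i j :=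
    fun z hz i j => (hc.gram_eq he hp hOt hz i j).2
  have pa : pd i (chartForm (fstMap F) e j) y =
      s j y • pd i (fun z => α (e.symm z)) y + pd i (s j) y • α (e.symm y) -
      (t j y • pd i (fun z => β (e.symm z)) y + pd i (t j) y • β (e.symm y)) := by
    rw [pd_congr hO (fun z hz => hc.fst z hz j) hy,
      pd_sub ((ds j).fun_smul dα) ((dt j).fun_smul dβ), pd_smul (ds j) dα, pd_smul (dt j) dβ]
  have tr := fun i => ip_leftTranslated_one hp (e.symm y)
    (chartInvDeriv e y (EuclideanSpace.single i 1))
  have paa : chartForm (fstMap F) e i y * chartForm (fstMap F) e j y =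
      (1 / 2 : ℝ) • comm (chartForm (fstMap F) e i y) (chartForm (fstMap F) e j y) +
      NKSL.gram (fstMap F) e y i j • (1 : Mat2) := by
    rw [hγ y hy, ← (hc.gram_eq he hp hOt hy i j).1]
    exact mul_eq_half_comm (tr i) (tr j)
  have pc : comm (chartForm (fstMap F) e i y) (chartForm (fstMap F) e j y) =
      (t i y * s j y - s i y * t j y) • comm (α (e.symm y)) (β (e.symm y)) := by
    rw [hc.fst y hy, hc.fst y hy]
    simp only [comm_sub_left, comm_sub_right, comm_smul_left, comm_smul_right, comm_self,
      comm_swap (β (e.symm y)) (α (e.symm y))]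
    module
  have pΓ : ∑ k, christoffel (NKSL.gram (fstMap F) e) k i j y • pd k (localRep (fstMap F) e) y =
      localRep (fstMap F) e y *
        (pd i (s j) y • α (e.symm y) - pd i (t j) y • β (e.symm y)) := by
    have e1 := hcl.sU y hy
    have e2 := hcl.tU y hy
    have e3 := hcl.sV y hy
    have e4 := hcl.tV y hy
    rw [Fin.sum_univ_two, pd_localRep he hp (hOt hy), pd_localRep he hp (hOt hy),
      ← mul_smul_comm, ← mul_smul_comm, ← mul_add, hcl.christoffel_eq hO hγ hy,
      hcl.christoffel_eq hO hγ hy, hc.fst y hy, hc.fst y hy]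
    congr 1
    generalize pd i (s j) y = S
    generalize pd i (t j) y = T
    calc _ = (S * (s 0 y * X 0 y + s 1 y * X 1 y) + T * (s 0 y * Y 0 y + s 1 y * Y 1 y)) •
          α (e.symm y) - (S * (t 0 y * X 0 y + t 1 y * X 1 y) +
            T * (t 0 y * Y 0 y + t 1 y * Y 1 y)) • β (e.symm y) := by module
      _ = _ := by rw [e1, e2, e3, e4]; module
  rw [secondFundForm, pΓ, pd_congr hO (fun z hz => pd_localRep he hp (hOt hz) j) hy,
    pd_matMul dp (da j), pd_localRep he hp (hOt hy), mul_assoc, paa, pa, pc, (hd y hy i).1,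
    (hd y hy i).2]
  have e5 : NKSL.gram (fstMap F) e y i j • localRep (fstMap F) e y =
      localRep (fstMap F) e y * (NKSL.gram (fstMap F) e y i j • (1 : Mat2)) := by
    rw [mul_smul_comm, mul_one]
  rw [e5, ← mul_add, ← mul_sub, ← mul_sub, ← mul_smul_comm]
  change localRep (fstMap F) e y * _ = localRep (fstMap F) e y * _
  congr 1
  module

theorem LocalFrame.meanCurvatureVector_eq (h : LocalFrame F U α β m n)
    (hp : IsSmooth (fstMap F)) (hq : IsSmooth (sndMap F)) {x : M} (hx : x ∈ U) :
    meanCurvatureVector (fstMap F) x = (-√3 * (n + 1 / 3)) • frameNormal (fstMap F) α β x := by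
  have he := IsManifold.chart_mem_maximalAtlas (I := 𝓘(ℝ, Plane)) (n := ∞) x
  have hxe := (chartAt Plane x).left_inv (mem_chart_source Plane x)
  have hy : chartAt Plane x x ∈ (chartAt Plane x).target ∩ (chartAt Plane x).symm ⁻¹' U :=
    ⟨mem_chart_target Plane x, by rw [Set.mem_preimage, hxe]; exact hx⟩
  obtain ⟨s, t, hc, hd⟩ := h.exists_coframe he hp
  obtain ⟨X, Y, hcl⟩ := h.exists_closedCoframe he hp hq hc
  have hγ := fun i j => (hc.gram_eq he hp Set.inter_subset_left hy i j).2
  have e1 := hcl.sU _ hy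
  have e2 := hcl.tU _ hy
  have e3 := hcl.sV _ hy
  have e4 := hcl.tV _ hy
  have r3 : √3 * (1 / √3) = 1 := by rw [mul_one_div, div_self (by positivity)]
  rw [meanCurvatureVector]
  simp only [h.secondFundForm_eq he hp hc hd hcl hy, hcl.inverse_metric hy hγ, Fin.sum_univ_two,
    smul_smul, ← add_smul]
  rw [hxe, frameNormal, smul_smul]
  congr 1
  set y := chartAt Plane x x
  generalize s 0 y = s0 at *
  generalize s 1 y = s1 at *
  generalize t 0 y = t0 at *
  generalize t 1 y = t1 at *
  generalize X 0 y = x0 at *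
  generalize X 1 y = x1 at *
  generalize Y 0 y = y0 at *
  generalize Y 1 y = y1 at *
  -- Half the trace against the inverse metric, with the pairings of coframe and dual frame as
  -- variables so that duality can be substituted.
  have key : ∀ p q p' q' : ℝ, p = 1 → q = 0 → p' = 0 → q' = 1 →
      (1 / 2) * (-(2 / 3) * ((m * p * p - (1 / 2 + n) * (2 * p * q) - (m - n - 1) * q * q) +
        (m * p' * p' - (1 / 2 + n) * (2 * p' * q') - (m - n - 1) * q' * q')) -
        (4 / 3) * (2 * (m * p * p' - (1 / 2 + n) * (p * q' + q * p') -
          (m - n - 1) * q * q'))) = n + 1 / 3 := by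
    rintro p q p' q' rfl rfl rfl rfl; ring
  have k := key _ _ _ _ e1 e2 e3 e4
  have e6 : -√3 * (n + 1 / 3) * -(1 / √3) = n + 1 / 3 := by linear_combination (n + 1 / 3) * r3
  rw [e6, ← k]
  ring

theorem constantMeanCurvature_fst (H : HasFrames F m n) (hp : IsSmooth (fstMap F))
    (hq : IsSmooth (sndMap F)) : HasConstantMeanCurvature (fstMap F) := by
  obtain ⟨N, hN⟩ := exists_normal H
  intro W _ hW N' hN'
  obtain ⟨r, hr2, hr⟩ := unitNormal_sign H hp hN hW hN'
  refine ⟨-√3 * (n + 1 / 3) * r, fun x hx => ?_⟩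
  obtain ⟨U, hxU, α, β, h⟩ := H x
  rw [h.meanCurvatureVector_eq hp hq hxU, hr x hx, hN U α β h x hxU, smul_smul, mul_assoc, hr2,
    mul_one]

end Charts

/-! ### Principal curvatures -/

section Curvatures

variable {M : Type*} [TopologicalSpace M] [ChartedSpace Plane M] [IsManifold 𝓘(ℝ, Plane) ∞ M]
  {F : M → SL2 × SL2} {m n θ : ℝ}

theorem sqrt_three_mul_inv : √3 * (1 / √3) = 1 := by
  rw [mul_one_div, div_self (by positivity)]

theorem shapeMatrix_trace (m n : ℝ) : (shapeMatrix m n).trace = -(6 * (n + 1 / 3)) / √3 := by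
  simp only [shapeMatrix, Matrix.trace_fin_two, Matrix.smul_apply, smul_eq_mul, Matrix.of_apply,
    Matrix.cons_val_zero, Matrix.cons_val_one, Matrix.cons_val']
  ring

/-- The determinant is 1 plus a multiple of the circle relation. -/
theorem shapeMatrix_det (hq : m ^ 2 - m * n + n ^ 2 - m + n = 0) : (shapeMatrix m n).det = 1 := by
  have h := inv_sqrt_three_sq
  simp only [shapeMatrix, Matrix.det_fin_two, Matrix.smul_apply, smul_eq_mul, Matrix.of_apply,
    Matrix.cons_val_zero, Matrix.cons_val_one, Matrix.cons_val']
  linear_combination (3 + 12 * (m ^ 2 - m * n + n ^ 2 - m + n)) * h + 4 * hq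

/-- A real `2 × 2` matrix of determinant `1` and trace `4 sin θ / √3` has the eigenvalues
`curvaturePair θ`. -/
theorem roots_charpoly_eq_curvaturePair {A : Matrix (Fin 2) (Fin 2) ℝ}
    (ht : A.trace = 4 * Real.sin θ / √3) (hd : A.det = 1) :
    (A.charpoly.map (algebraMap ℝ ℂ)).roots = curvaturePair θ := by
  -- Only the square of the root matters, so its branch is irrelevant: the roots are determined by
  -- their sum and product.
  have hz : Complex.sqrt ((-1 - 2 * Real.cos (2 * θ) : ℝ) : ℂ) ^ 2 =
      4 * ((Real.sin θ : ℝ) : ℂ) ^ 2 - 3 := by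
    have h1 : Complex.sqrt ((-1 - 2 * Real.cos (2 * θ) : ℝ) : ℂ) ^ 2 =
        ((-1 - 2 * Real.cos (2 * θ) : ℝ) : ℂ) := by
      rw [Complex.sqrt, ← Complex.cpow_nat_mul]
      norm_num
    have h2 : -1 - 2 * Real.cos (2 * θ) = 4 * Real.sin θ ^ 2 - 3 := by
      have := Real.sin_sq_add_cos_sq θ
      rw [Real.cos_two_mul]
      linarith
    rw [h1, h2]
    push_cast
    ring
  have h3 : ((√3 : ℝ) : ℂ) ^ 2 = 3 := by
    rw [← Complex.ofReal_pow, Real.sq_sqrt (by norm_num)]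
    norm_num
  have h3' : ((√3 : ℝ) : ℂ) ≠ 0 := by
    intro h
    rw [h] at h3
    norm_num at h3
  rw [curvaturePair]
  set z := Complex.sqrt ((-1 - 2 * Real.cos (2 * θ) : ℝ) : ℂ)
  set r₁ := (-z + ((2 * Real.sin θ : ℝ) : ℂ)) / ((√3 : ℝ) : ℂ) with hr₁
  set r₂ := (z + ((2 * Real.sin θ : ℝ) : ℂ)) / ((√3 : ℝ) : ℂ) with hr₂
  have e1 : ((A.trace : ℝ) : ℂ) = r₁ + r₂ := by
    rw [ht, hr₁, hr₂]
    push_cast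
    ring
  have e2 : ((A.det : ℝ) : ℂ) = r₁ * r₂ := by
    rw [hd, hr₁, hr₂, div_mul_div_comm, eq_div_iff (mul_ne_zero h3' h3')]
    simp only [Complex.ofReal_mul, Complex.ofReal_ofNat, Complex.ofReal_one]
    linear_combination h3 + hz
  have e3 : A.charpoly.map (algebraMap ℝ ℂ) =
      (Polynomial.X - Polynomial.C r₁) * (Polynomial.X - Polynomial.C r₂) := by
    rw [Matrix.charpoly_fin_two]
    simp only [Polynomial.map_add, Polynomial.map_sub, Polynomial.map_pow, Polynomial.map_mul,
      Polynomial.map_X, Polynomial.map_C, Complex.coe_algebraMap, e1, e2, Polynomial.C_add,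
      Polynomial.C_mul]
    ring
  rw [e3, Polynomial.roots_mul (mul_ne_zero (Polynomial.X_sub_C_ne_zero _)
    (Polynomial.X_sub_C_ne_zero _)), Polynomial.roots_X_sub_C, Polynomial.roots_X_sub_C]
  rfl

theorem hasCurvatures_fst (H : HasFrames F m n) (hp : IsSmooth (fstMap F))
    (hq : IsSmooth (sndMap F)) (hi : ∀ x, Function.Injective (omega F x)) {N : M → Mat2}
    (hN : ∀ U α β, LocalFrame F U α β m n → ∀ x ∈ U, N x = frameNormal (fstMap F) α β x)
    (hθ : Real.sin θ = -(3 / 2) * (n + 1 / 3)) : HasCurvatures (fstMap F) N θ := by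
  refine ⟨unitNormal_of_frames H hp hN, fun x => ?_⟩
  obtain ⟨U, hxU, α, β, h⟩ := H x
  refine ⟨?_, ?_⟩
  · obtain ⟨S, hS, hc⟩ := h.exists_shapeOperator hp hi isOpen_univ (N := N) (r := 1)
      (fun z hz => by rw [one_smul, hN U α β h z hz.1]) hxU (Set.mem_univ x)
    refine ⟨S, hS, ?_⟩
    rw [principalCurvatures, hc, one_smul]
    refine roots_charpoly_eq_curvaturePair ?_ (shapeMatrix_det h.quad)
    rw [shapeMatrix_trace, hθ]
    ring
  · rw [h.meanCurvatureVector_eq hp hq hxU, hN U α β h x hxU]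
    congr 1
    have h3 : √3 * √3 = 3 := Real.mul_self_sqrt (by norm_num)
    rw [eq_div_iff (by positivity), hθ]
    linear_combination (-(n + 1 / 3)) * h3

/-- The angle determined by the structure constants. -/
theorem exists_angle (hq : m ^ 2 - m * n + n ^ 2 - m + n = 0) :
    ∃ φ : ℝ, Real.cos φ = -(√3 / 2) * (m + n) ∧ Real.sin φ = 3 / 2 * (m - n - 2 / 3) := by
  have h3 : √3 * √3 = 3 := Real.mul_self_sqrt (by norm_num)
  -- Centred at m = 1/3, n = -1/3, the circle relation reads |z| = 1.
  set z : ℂ := ⟨-(√3 / 2) * (m + n), 3 / 2 * (m - n - 2 / 3)⟩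
  have hz : ‖z‖ = 1 := by
    rw [← sq_eq_sq₀ (norm_nonneg _) zero_le_one, Complex.sq_norm, Complex.normSq_mk]
    linear_combination (1 / 4 * (m + n) ^ 2) * h3 + 3 * hq
  have hz0 : z ≠ 0 := by
    rw [← norm_ne_zero_iff, hz]
    exact one_ne_zero
  exact ⟨z.arg, by rw [Complex.cos_arg hz0, hz, div_one], by rw [Complex.sin_arg, hz, div_one]⟩

theorem sin_add_pi_div_three {φ : ℝ} (hc : Real.cos φ = -(√3 / 2) * (m + n))
    (hs : Real.sin φ = 3 / 2 * (m - n - 2 / 3)) :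
    Real.sin (φ + Real.pi / 3) = -(3 / 2) * (n + 1 / 3) := by
  have h3 : √3 * √3 = 3 := Real.mul_self_sqrt (by norm_num)
  rw [Real.sin_add, hc, hs, Real.cos_pi_div_three, Real.sin_pi_div_three]
  linear_combination (-(1 / 4) * (m + n)) * h3

theorem sin_sub_pi_div_three {φ : ℝ} (hc : Real.cos φ = -(√3 / 2) * (m + n))
    (hs : Real.sin φ = 3 / 2 * (m - n - 2 / 3)) :
    Real.sin (φ - Real.pi / 3) = -(3 / 2) * (-m + 1 / 3) := by
  have h3 : √3 * √3 = 3 := Real.mul_self_sqrt (by norm_num)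
  rw [Real.sin_sub, hc, hs, Real.cos_pi_div_three, Real.sin_pi_div_three]
  linear_combination (1 / 4 * (m + n)) * h3

end Curvatures

/-! ### Adapted vector fields -/

section Adapted

theorem g_self_P {α β : Mat2} (h : IsGramPair α β) : g (α, β) (P (α, β)) = 1 := by
  rw [g_eq]
  simp only [P, h.aa, h.ab, h.ba, h.bb]
  norm_num

theorem g_J_P {α β : Mat2} :
    g (α, β) (J (P (α, β))) = (1 / √3) * (ip β β - ip α α) := by
  rw [g_eq]
  simp only [P, J, ip_smul_right, ip_sub_right, ip_comm β α]
  ring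

/-- The condition on JPX equates the two norms; nullity and g(X, PX) = 1 then fix all three inner
products. Adapted fields are thus the same as normalized frames. -/
theorem isGramPair_of_g {z : Mat2 × Mat2} (h₁ : ip z.1 1 = 0) (h₂ : ip z.2 1 = 0)
    (h0 : g z z = 0) (hP : g z (P z) = 1) (hJ : g z (J (P z)) = 0) : IsGramPair z.1 z.2 := by
  obtain ⟨α, β⟩ := z
  rw [g_J_P] at hJ
  have e1 := (mul_eq_zero.1 hJ).resolve_left (by positivity)
  rw [g_eq] at h0 hP
  simp only [P, ip_comm β α] at h0 hP
  refine ⟨h₁, h₂, ?_, ?_, ?_⟩ <;> simp only <;> linarith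

theorem G_P (α β : Mat2) :
    G (α, β) (P (α, β)) = (-(1 / √3) • comm α β, -(1 / √3) • comm α β) := by
  simp only [G, Gamma, J, P, comm_smul_right, comm_sub_right, comm_self, comm_swap β α]
  generalize 1 / √3 = r
  refine Prod.ext ?_ ?_ <;> simp only [Prod.fst_sub, Prod.snd_sub] <;> module

theorem J_G_P (α β : Mat2) :
    J (G (α, β) (P (α, β))) = ((1 / 3 : ℝ) • comm α β, -(1 / 3 : ℝ) • comm α β) := by
  rw [G_P, ← inv_sqrt_three_sq]
  simp only [J]
  generalize 1 / √3 = r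
  refine Prod.ext ?_ ?_ <;> simp only <;> module

theorem Gamma_self (α β : Mat2) :
    Gamma (α, β) (α, β) = (-(1 / 3 : ℝ) • comm α β, (1 / 3 : ℝ) • comm α β) := by
  simp only [Gamma, comm_self, comm_swap β α]
  refine Prod.ext ?_ ?_ <;> simp only <;> module

variable {M : Type*} [TopologicalSpace M] [ChartedSpace Plane M] [IsManifold 𝓘(ℝ, Plane) ∞ M]
  {F : M → SL2 × SL2} {U W : Set M} {α β : M → Mat2} {m n : ℝ}
  {X : ∀ x : M, TangentSpace 𝓘(ℝ, Plane) x}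

theorem dirDeriv_prodMk {V V' : Type*} [NormedAddCommGroup V] [NormedSpace ℝ V]
    [NormedAddCommGroup V'] [NormedSpace ℝ V'] {u : M → V} {w : M → V'} (hU : IsOpen U)
    (hu : SmoothOn u U) (hw : SmoothOn w U) {x : M} (hx : x ∈ U)
    (v : TangentSpace 𝓘(ℝ, Plane) x) :
    dirDeriv (fun z => (u z, w z)) x v = (dirDeriv u x v, dirDeriv w x v) := by
  obtain ⟨e, he, y, hy, rfl⟩ := exists_chart x
  obtain ⟨v, rfl⟩ := (chartInvDeriv_bijective he hy).2 v
  have hB : SmoothOn (fun z => (u z, w z)) U := hu.prodMk_space hw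
  have du := diffAt (contDiffOn_comp_chart he hu) (isOpen_chart_preimage hU) ⟨hy, hx⟩
  have dw := diffAt (contDiffOn_comp_chart he hw) (isOpen_chart_preimage hU) ⟨hy, hx⟩
  rw [← fderiv_comp_chart he hU hB hy hx, ← fderiv_comp_chart he hU hu hy hx,
    ← fderiv_comp_chart he hU hw hy hx, du.fderiv_prodMk dw]
  rfl

/-- The derivative of a smooth map along a smooth vector field is continuous. -/
theorem continuousOn_dirDeriv {V : Type*} [NormedAddCommGroup V] [NormedSpace ℝ V] {u : M → V}
    (hu : SmoothOn u Set.univ)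
    (hX : ContMDiffOn 𝓘(ℝ, Plane) 𝓘(ℝ, Plane).tangent ∞
      (fun x => (⟨x, X x⟩ : TangentBundle 𝓘(ℝ, Plane) M)) W) :
    ContinuousOn (fun x => dirDeriv u x (X x)) W := by
  have h1 : ContMDiff 𝓘(ℝ, Plane).tangent 𝓘(ℝ, V).tangent ∞
      (tangentMap 𝓘(ℝ, Plane) 𝓘(ℝ, V) u) :=
    ContMDiff.contMDiff_tangentMap (contMDiffOn_univ.1 hu) (by simp)
  exact (((contMDiff_snd_tangentBundle_modelSpace V 𝓘(ℝ, V)).comp h1).comp_contMDiffOn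
    hX).continuousOn

/-- Continuity is what makes the sign relating an adapted field to a local frame locally constant.
-/
theorem continuousOn_along_fst (hp : IsSmooth (fstMap F))
    (hX : ContMDiffOn 𝓘(ℝ, Plane) 𝓘(ℝ, Plane).tangent ∞
      (fun x => (⟨x, X x⟩ : TangentBundle 𝓘(ℝ, Plane) M)) W) :
    ContinuousOn (fun x => (along F X x).1) W := by
  have h1 : ContinuousOn (fun x => adjCLM (toMat (fstMap F) x)) W :=
    adjCLM.continuous.comp_continuousOn (hp.continuousOn.mono (Set.subset_univ _))
  refine (mulCLM.isBoundedBilinearMap.continuous.comp_continuousOn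
    (h1.prodMk (continuousOn_dirDeriv hp hX))).congr fun x _ => ?_
  exact congrArg (· * diff (fstMap F) x (X x)) (adjCLM_coe _).symm

theorem IsAdaptedField.isGramPair (hF : IsDegenerateAlmostComplex F) (hX : IsAdaptedField F W X)
    {x : M} (hx : x ∈ W) : IsGramPair (along F X x).1 (along F X x).2 :=
  isGramPair_of_g (ip_leftTranslated_one hF.smooth_fst x (X x))
    (ip_leftTranslated_one hF.smooth_snd x (X x)) (hF.degenerate x _ _) (hX.2 x hx).1
    (hX.2 x hx).2

theorem LocalFrame.along_eq (h : LocalFrame F U α β m n) (hF : IsDegenerateAlmostComplex F)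
    (hX : IsAdaptedField F W X) {x : M} (hx : x ∈ U) (hxW : x ∈ W) :
    ∃ r : ℝ, (r = 1 ∨ r = -1) ∧ (along F X x).1 = r • α x ∧ (along F X x).2 = r • β x := by
  have g' := hX.isGramPair hF hxW
  obtain ⟨s, t, e, -⟩ := h.deriv x hx (X x)
  have e' : along F X x = framePair (α x) (β x) s t := e
  rw [e'] at g' ⊢
  obtain ⟨rfl, hs⟩ := (h.gram x hx).eq_or_neg g'
  exact ⟨s, hs, by simp [framePair], by simp [framePair]⟩

theorem LocalFrame.GXPX_eq (h : LocalFrame F U α β m n) (hF : IsDegenerateAlmostComplex F)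
    (hX : IsAdaptedField F W X) {x : M} (hx : x ∈ U) (hxW : x ∈ W) :
    GXPX F X x = (-(1 / √3) • comm (α x) (β x), -(1 / √3) • comm (α x) (β x)) ∧
      J (GXPX F X x) = ((1 / 3 : ℝ) • comm (α x) (β x), -(1 / 3 : ℝ) • comm (α x) (β x)) := by
  obtain ⟨r, hr, e1, e2⟩ := h.along_eq hF hX hx hxW
  have hr2 : r * r = 1 := by rcases hr with rfl | rfl <;> norm_num
  have e3 : along F X x = (r • α x, r • β x) := Prod.ext e1 e2
  have e4 : comm (r • α x) (r • β x) = comm (α x) (β x) := by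
    rw [comm_smul_left, comm_smul_right, smul_smul, hr2, one_smul]
  rw [GXPX, e3, J_G_P, G_P, e4]
  exact ⟨rfl, rfl⟩

/-- X is locally ±(α, β), and ∇_X X is even in X. The derivative of the frame contributes (mκ, nκ),
and the connection term shifts the coefficients by -1/3 and 1/3. -/
theorem LocalFrame.nablaNK_along (h : LocalFrame F U α β m n) (hF : IsDegenerateAlmostComplex F)
    (hW : IsOpen W) (hX : IsAdaptedField F W X) {x : M} (hx : x ∈ U) (hxW : x ∈ W) :
    nablaNK F (along F X) x (X x) =
      ((m - 1 / 3) • comm (α x) (β x), (n + 1 / 3) • comm (α x) (β x)) := by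
  obtain ⟨U', hU', oU', hxU', r, hr, hs⟩ := exists_local_sign (h.isOpen.inter hW)
    (h.smooth_α.mono Set.inter_subset_left).continuousOn
    ((continuousOn_along_fst hF.smooth_fst hX.1).mono Set.inter_subset_right)
    (β' := fun z => (along F X z).2)
    (fun z hz => h.gram z hz.1) (fun z hz => h.along_eq hF hX hz.1 hz.2) ⟨hx, hxW⟩
  have hr2 : r * r = 1 := by rcases hr with rfl | rfl <;> norm_num
  have hr0 : r ≠ 0 := by rintro rfl; norm_num at hr2
  have sα : SmoothOn (fun z => r • α z) U' := (contDiff_const_smul r).contMDiff.comp_contMDiffOn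
    (h.smooth_α.mono fun z hz => (hU' hz).1)
  have sβ : SmoothOn (fun z => r • β z) U' := (contDiff_const_smul r).contMDiff.comp_contMDiffOn
    (h.smooth_β.mono fun z hz => (hU' hz).1)
  have e1 : ∀ z ∈ U', along F X z = (r • α z, r • β z) := fun z hz =>
    Prod.ext (hs z hz).1 (hs z hz).2
  have e2 : omega F x (X x) = (r • α x, r • β x) := e1 x hxU'
  obtain ⟨s, t, e3, d1, d2⟩ := h.deriv x hx (X x)
  have e4 : framePair (α x) (β x) r 0 = (r • α x, r • β x) := by simp [framePair]
  obtain ⟨rfl, rfl⟩ := (h.gram x hx).framePair_inj (e4.trans (e2.symm.trans e3))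
  have e5 : comm (r • α x) (r • β x) = comm (α x) (β x) := by
    rw [comm_smul_left, comm_smul_right, smul_smul, hr2, one_smul]
  rw [nablaNK, dirDeriv_congr oU' e1 hxU', dirDeriv_prodMk oU' sα sβ hxU', e1 x hxU', e2,
    Gamma_self, e5, dirDeriv_const_smul h.isOpen h.smooth_α hx,
    dirDeriv_const_smul h.isOpen h.smooth_β hx, d1, d2, smul_smul, smul_smul]
  have e6 : r * (m * r - (1 + n) * 0) = m := by linear_combination m * hr2
  have e7 : r * (n * r + (m - n - 1) * 0) = n := by linear_combination n * hr2
  rw [e6, e7]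
  refine Prod.ext ?_ ?_ <;> simp only [Prod.fst_add, Prod.snd_add] <;> module

/-- The field dual to the coframe with s = 1 and t = 0, carried from the chart to the surface. -/
theorem LocalFrame.exists_adaptedField (h : LocalFrame F U α β m n)
    (hF : IsDegenerateAlmostComplex F) {x : M} (hx : x ∈ U) :
    ∃ W : Set M, IsOpen W ∧ x ∈ W ∧ ∃ X, IsAdaptedField F W X := by
  obtain ⟨e, he, y₀, hy₀, rfl⟩ := exists_chart x
  set O := e.target ∩ e.symm ⁻¹' U
  have hO : IsOpen O := isOpen_chart_preimage h.isOpen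
  obtain ⟨s, t, hc, -⟩ := h.exists_coframe he hF.smooth_fst
  obtain ⟨X, Y, hcl⟩ := h.exists_closedCoframe he hF.smooth_fst hF.smooth_snd hc
  let w : Plane → Plane := fun y =>
    X 0 y • EuclideanSpace.single 0 (1 : ℝ) + X 1 y • EuclideanSpace.single 1 (1 : ℝ)
  have sw : ContDiffOn ℝ ∞ w O :=
    ((hcl.smooth_U 0).smul contDiffOn_const).add ((hcl.smooth_U 1).smul contDiffOn_const)
  let Z : Plane → Plane := fun y => chartInvDeriv e y (w y)
  have hZ : ∀ y ∈ O, omega F (e.symm y) (Z y) = (α (e.symm y), β (e.symm y)) := fun y hy => by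
    have w0 : w y 0 = X 0 y := by simp [w]
    have w1 : w y 1 = X 1 y := by simp [w]
    have e1 := hcl.sU y hy
    have e2 := hcl.tU y hy
    refine (omega_chart F e y (w y)).trans ?_
    rw [hc.fst y hy, hc.fst y hy, hc.snd y hy, hc.snd y hy, w0, w1]
    refine Prod.ext ?_ ?_
    · calc _ = (s 0 y * X 0 y + s 1 y * X 1 y) • α (e.symm y) -
            (t 0 y * X 0 y + t 1 y * X 1 y) • β (e.symm y) := by module
        _ = _ := by rw [e1, e2]; module
    · calc _ = (s 0 y * X 0 y + s 1 y * X 1 y) • β (e.symm y) +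
            (t 0 y * X 0 y + t 1 y * X 1 y) • (α (e.symm y) - β (e.symm y)) := by module
        _ = _ := by rw [e1, e2]; module
  have hW : ∀ x ∈ e.source ∩ e ⁻¹' O, ∃ y ∈ O, e.symm y = x := fun x hx =>
    ⟨e x, hx.2, e.left_inv hx.1⟩
  refine ⟨e.source ∩ e ⁻¹' O, e.isOpen_inter_preimage hO,
    ⟨e.map_target hy₀, by
      rw [Set.mem_preimage, e.right_inv hy₀]
      exact ⟨hy₀, hx⟩⟩, fun x => Z (e x), ?_, fun x hx => ?_⟩
  -- Smoothness as a section of the tangent bundle: the tangent map of the inverse chart, after the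
  -- coordinate field, after the chart.
  · have h1 : ContMDiffOn 𝓘(ℝ, Plane).tangent 𝓘(ℝ, Plane).tangent ∞
        (tangentMapWithin 𝓘(ℝ, Plane) 𝓘(ℝ, Plane) e.symm e.target)
        (Bundle.TotalSpace.proj ⁻¹' e.target) :=
      (contMDiffOn_symm_of_mem_maximalAtlas he).contMDiffOn_tangentMapWithin (by simp)
        e.open_target.uniqueMDiffOn
    have h2 : ContMDiffOn 𝓘(ℝ, Plane) 𝓘(ℝ, Plane).tangent ∞
        (fun y => (⟨y, w y⟩ : TangentBundle 𝓘(ℝ, Plane) Plane)) O :=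
      contMDiffOn_vectorSpace_iff_contDiffOn.2 sw
    have h3 := (h1.comp h2 fun y hy => hy.1).comp ((contMDiffOn_of_mem_maximalAtlas he).mono
      (Set.inter_subset_left : e.source ∩ e ⁻¹' O ⊆ _)) fun x hx => hx.2
    refine h3.congr fun x hx => ?_
    have e1 : ∀ (z z' : M) (v : Plane), z = z' →
        (⟨z, v⟩ : TangentBundle 𝓘(ℝ, Plane) M) = ⟨z', v⟩ := by rintro z _ v rfl; rfl
    have e2 : mfderivWithin 𝓘(ℝ, Plane) 𝓘(ℝ, Plane) e.symm e.target (e x) =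
        mfderiv 𝓘(ℝ, Plane) 𝓘(ℝ, Plane) e.symm (e x) :=
      mfderivWithin_of_isOpen e.open_target hx.2.1
    refine (e1 x (e.symm (e x)) (Z (e x)) (e.left_inv hx.1).symm).trans ?_
    simp only [Function.comp_apply, tangentMapWithin, e2]
    rfl
  · obtain ⟨y, hy, rfl⟩ := hW x hx
    have e1 : along F (fun x => Z (e x)) (e.symm y) = (α (e.symm y), β (e.symm y)) := by
      rw [← hZ y hy]
      change omega F _ (Z (e (e.symm y))) = _
      rw [e.right_inv hy.1]
    have g' := h.gram _ hy.2
    rw [e1, g_self_P g', g_J_P, g'.aa, g'.bb]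
    simp

theorem isAngle_of_frames (H : HasFrames F m n) (hF : IsDegenerateAlmostComplex F) {φ : ℝ}
    (hc : Real.cos φ = -(√3 / 2) * (m + n)) (hs : Real.sin φ = 3 / 2 * (m - n - 2 / 3)) :
    IsAngle F φ := by
  have h3 := sqrt_three_mul_inv
  refine ⟨fun x => ?_, fun W hW X hX x hx => ?_⟩
  · obtain ⟨U, hxU, α, β, h⟩ := H x
    exact h.exists_adaptedField hF hxU
  · obtain ⟨U, hxU, α, β, h⟩ := H x
    obtain ⟨e1, e2⟩ := h.GXPX_eq hF hX hxU hx
    rw [h.nablaNK_along hF hW hX hxU hx, e2, e1, hc, hs]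
    refine Prod.ext ?_ ?_ <;>
      simp only [Prod.fst_add, Prod.snd_add, Prod.smul_fst, Prod.smul_snd, smul_smul, ← add_smul]
      <;> congr 1
    · linear_combination (-(1 / 2) * (m + n)) * h3
    · linear_combination (-(1 / 2) * (m + n)) * h3

theorem HasFrames.swap (H : HasFrames F m n) : HasFrames (swapMap F) (-n) (-m) := fun x => by
  obtain ⟨U, hx, α, β, h⟩ := H x
  exact ⟨U, hx, β, α, h.swap⟩

theorem injective_omega_swapMap {x : M} (h : Function.Injective (omega F x)) :
    Function.Injective (omega (swapMap F) x) := fun v w hvw => by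
  rw [omega_swapMap, omega_swapMap] at hvw
  exact h (Prod.ext (congrArg Prod.snd hvw) (congrArg Prod.fst hvw))

theorem sqrt_three_div_three : √3 * (1 / 3) = 1 / √3 := by
  linear_combination (-√3) * inv_sqrt_three_sq + (1 / √3) * sqrt_three_mul_inv

/-- G(X, PX) has equal components and JG(X, PX) opposite ones; this combination cancels the second
component. -/
theorem normal_fst_eq (H : HasFrames F m n) (hF : IsDegenerateAlmostComplex F) {N : M → Mat2}
    (hN : ∀ U α β, LocalFrame F U α β m n → ∀ x ∈ U, N x = frameNormal (fstMap F) α β x)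
    (hX : IsAdaptedField F W X) {x : M} (hx : x ∈ W) :
    ((((fstMap F x)⁻¹ : SL2) : Mat2) * N x, (0 : Mat2)) =
      (1 / 2 : ℝ) • GXPX F X x - (√3 / 2) • J (GXPX F X x) := by
  have h3 := sqrt_three_div_three
  obtain ⟨U, hxU, α, β, h⟩ := H x
  obtain ⟨e1, e2⟩ := h.GXPX_eq hF hX hxU hx
  rw [e2, e1, hN U α β h x hxU, frameNormal, mul_smul_comm, SL2_inv_mul]
  refine Prod.ext ?_ ?_ <;>
    simp only [Prod.fst_sub, Prod.snd_sub, Prod.smul_fst, Prod.smul_snd, smul_smul, ← sub_smul]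
  · congr 1
    linear_combination (1 / 2) * h3
  · rw [eq_comm, smul_eq_zero]
    left
    linear_combination (1 / 2) * h3

/-- The frame of the exchanged map is (β, α), so [α, β] enters with the opposite sign. -/
theorem normal_snd_eq (H : HasFrames F m n) (hF : IsDegenerateAlmostComplex F) {N : M → Mat2}
    (hN : ∀ U α β, LocalFrame (swapMap F) U α β (-n) (-m) →
      ∀ x ∈ U, N x = frameNormal (sndMap F) α β x)
    (hX : IsAdaptedField F W X) {x : M} (hx : x ∈ W) :
    ((0 : Mat2), (((sndMap F x)⁻¹ : SL2) : Mat2) * N x) =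
      -(1 / 2 : ℝ) • GXPX F X x - (√3 / 2) • J (GXPX F X x) := by
  have h3 := sqrt_three_div_three
  obtain ⟨U, hxU, α, β, h⟩ := H x
  obtain ⟨e1, e2⟩ := h.GXPX_eq hF hX hxU hx
  rw [e2, e1, hN U β α h.swap x hxU, frameNormal, mul_smul_comm, SL2_inv_mul, comm_swap (β x)]
  refine Prod.ext ?_ ?_ <;>
    simp only [Prod.fst_sub, Prod.snd_sub, Prod.smul_fst, Prod.smul_snd, smul_smul, ← sub_smul,
      smul_neg, ← neg_smul]
  · rw [eq_comm, smul_eq_zero]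
    left
    linear_combination (-(1 / 2)) * h3
  · congr 1
    linear_combination (-(1 / 2)) * h3

theorem properties_fst (H : HasFrames F m n) (hp : IsSmooth (fstMap F))
    (hq : IsSmooth (sndMap F)) (hi : ∀ x, Function.Injective (omega F x)) :
    IsImmersedSurface (fstMap F) ∧ IsLorentzian (fstMap F) ∧ IsFlat (fstMap F) ∧
      IsIsoparametric (fstMap F) ∧ HasConstantMeanCurvature (fstMap F) :=
  ⟨immersed_fst H hp hi, lorentzian_fst H, flat_fst H hp hq, isoparametric_fst H hp hi,
    constantMeanCurvature_fst H hp hq⟩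

end Adapted

end NKSL

theorem mainTheorem4 {M : Type*} [TopologicalSpace M] [ChartedSpace Plane M]
    [IsManifold 𝓘(ℝ, Plane) ∞ M] [ConnectedSpace M]
    (F : M → SL2 × SL2) (hF : IsDegenerateAlmostComplex F)
    (hP : ∀ x, ¬ PPreservesTangentAt F x) :
    (IsImmersedSurface (fstMap F) ∧ IsLorentzian (fstMap F) ∧ IsFlat (fstMap F) ∧
      IsIsoparametric (fstMap F) ∧ HasConstantMeanCurvature (fstMap F)) ∧
    (IsImmersedSurface (sndMap F) ∧ IsLorentzian (sndMap F) ∧ IsFlat (sndMap F) ∧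
      IsIsoparametric (sndMap F) ∧ HasConstantMeanCurvature (sndMap F)) ∧
    ∃ φ : ℝ, IsAngle F φ ∧
      (∃ N : M → Mat2, HasCurvatures (fstMap F) N (φ + Real.pi / 3) ∧
        ∀ U : Set M, IsOpen U → ∀ X, IsAdaptedField F U X → ∀ x ∈ U,
          ((((fstMap F x)⁻¹ : SL2) : Mat2) * N x, (0 : Mat2)) =
            (1 / 2 : ℝ) • GXPX F X x - (√3 / 2) • J (GXPX F X x)) ∧
      (∃ N : M → Mat2, HasCurvatures (sndMap F) N (φ - Real.pi / 3) ∧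
        ∀ U : Set M, IsOpen U → ∀ X, IsAdaptedField F U X → ∀ x ∈ U,
          ((0 : Mat2), (((sndMap F x)⁻¹ : SL2) : Mat2) * N x) =
            -(1 / 2 : ℝ) • GXPX F X x - (√3 / 2) • J (GXPX F X x)) := by
  obtain ⟨m, n, H⟩ := exists_structure_constants hF hP
  have H : HasFrames F m n := H
  have H' := H.swap
  have hp := hF.smooth_fst
  have hq := hF.smooth_snd
  have hi := hF.immersion
  have hi' := fun x => injective_omega_swapMap (hi x)
  refine ⟨properties_fst H hp hq hi, properties_fst H' hq hp hi', ?_⟩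
  -- The circle relation is carried by the local frames, so one point of the surface is needed to
  -- extract it.
  obtain ⟨φ, hc, hs⟩ : ∃ φ : ℝ, Real.cos φ = -(√3 / 2) * (m + n) ∧
      Real.sin φ = 3 / 2 * (m - n - 2 / 3) := by
    obtain ⟨x⟩ := (inferInstance : Nonempty M)
    obtain ⟨U, -, α, β, h⟩ := H x
    exact exists_angle h.quad
  obtain ⟨N, hN⟩ := exists_normal H
  obtain ⟨N', hN'⟩ := exists_normal H'
  exact ⟨φ, isAngle_of_frames H hF hc hs,
    ⟨N, hasCurvatures_fst H hp hq hi hN (sin_add_pi_div_three hc hs),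
      fun W _ X hX x hx => normal_fst_eq H hF hN hX hx⟩,
    ⟨N', hasCurvatures_fst H' hq hp hi' hN' (sin_sub_pi_div_three hc hs),
      fun W _ X hX x hx => normal_snd_eq H hF hN' hX hx⟩⟩
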